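/- **Setting.** Let $K$ be a complete discrete valuation field of characteristic $0$ with residue field $k$ of characteristic $p>0$, ring of integers $\mathcal O_K$, uniformizer $\pi$, and absolute value normalized by $|p|=p^{-1}$. Let $q$ be a positive power of $p$ and let $\sigma$ be a $q$-Frobenius on $\mathcal O_K$ (a ring endomorphism with $\sigma(a)\equiv a^q \bmod \pi$), extended to a ring endomorphism $\sigma$ of $\mathcal O_K[\![x]\!]$ with $\sigma(x)\equiv x^q \bmod \pi$. Let $\mathcal E$ be the fraction field of the $p$-adic completion of $\mathcal O_K[\![x]\!][x^{-1}]$, let $\mathcal E^{\sigma}$ be the direct limit of $\mathcal E\xrightarrow{\sigma}\mathcal E\xrightarrow{\sigma}\cdots$, and let $\Gamma^{\mathrm{alg}}$ be the ring of integers of the completion of the maximal unramified extension of $\mathcal E^\sigma$. It is a complete discrete valuation ring with uniformizer $\pi$ and residue field $k(\!(x)\!)^{\mathrm{alg}}$, and $\sigma$ extends uniquely to a $q$-Frobenius of it. **Overconvergent and analytic rings.** Every $g\in\Gamma^{\mathrm{alg}}[p^{-1}]$ is uniquely $g=\sum_{i\gg-\infty}\pi^i[\bar x_i]$ with Teichmüller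 lifts $[\bar x_i]$ of elements $\bar x_i\in k(\!(x)\!)^{\mathrm{alg}}$. Put $v_n(g)=\min_{i\le n}v(\bar x_i)$, where $v$ is the valuation of $k(\!(x)\!)^{\mathrm{alg}}$ with $v(x)=1$. For $r>0$ put $v_{n,r}(g)=r\,v_n(g)+n$; for $r=0$ put $v_{n,0}(g)=n$ if $v_n(g)<\infty$ and $v_{n,0}(g)=\infty$ otherwise. Put $w_r(g)=\min_{n\in\mathbb Z} v_{n,r}(g)$ and $|g|_{p^{-r}}=|\pi|^{w_r(g)}$; in particular $|\cdot|_1$ is the $p$-adic norm. Let $\Gamma^{\mathrm{alg}}_r[p^{-1}]$ be the ring of all $g\in\Gamma^{\mathrm{alg}}[p^{-1}]$ with $v_{n,r}(g)\to\infty$ as $n\to\infty$, let $\Gamma^{\mathrm{alg}}_{\mathrm{con}}[p^{-1}]=\bigcup_{r>0}\Gamma^{\mathrm{alg}}_r[p^{-1}]$, let $\Gamma^{\mathrm{alg}}_{\mathrm{an},r}$ be the Fréchet completion of $\Gamma^{\mathrm{alg}}_r[p^{-1}]$ for the family $(w_s)_{0<s\le r}$, and let $\Gamma^{\mathrm{alg}}_{\mathrm{an,con}}=\bigcup_{r>0}\Gamma^{\mathrm{alg}}_{\mathrm{an},r}$.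 The Frobenius $\sigma$, and the norms $|\cdot|_\rho$ for $\rho<1$ close to $1$, extend to $\Gamma^{\mathrm{alg}}_{\mathrm{an,con}}$ by continuity. Let $\Gamma^{\mathrm{alg}}_{\log,\mathrm{an,con}}=\Gamma^{\mathrm{alg}}_{\mathrm{an,con}}[\log x]$, with an indeterminate $\log x$, and extend $\sigma$ to it by $$\sigma(\log x)=q\log x+\sum_{i\ge1}\frac{(-1)^{i-1}}{i}\Bigl(\frac{\sigma(x)}{x^q}-1\Bigr)^i .$$ **Log-growth.** For $\lambda\in\mathbb R$ let $\mathrm{Fil}_\lambda\Gamma^{\mathrm{alg}}_{\mathrm{an,con}}$ be the set of $g$ with $|g|_\rho=O\bigl((\log(1/\rho))^{-\lambda}\bigr)$ as $\rho\uparrow1$, and for $\lambda\ge0$ let $$\mathrm{Fil}_\lambda\Gamma^{\mathrm{alg}}_{\log,\mathrm{an,con}}=\bigoplus_{i=0}^{\lfloor\lambda\rfloor}\mathrm{Fil}_{\lambda-i}\Gamma^{\mathrm{alg}}_{\mathrm{an,con}}\cdot(\log x)^i .$$ An element $y$ of $\Gamma^{\mathrm{alg}}_{\log,\mathrm{an,con}}$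 is *bounded* if $y\in\mathrm{Fil}_0$. For $\lambda>0$ it is *exactly of log-growth $\lambda$* if $y\in\mathrm{Fil}_\lambda$ and $y\notin\mathrm{Fil}_\delta$ for all $0\le\delta<\lambda$. **Theorem.** Let $n\ge1$, and let $f(\sigma)=a_0+a_1\sigma+\dots+a_n\sigma^n$ with $a_i\in\Gamma^{\mathrm{alg}}_{\mathrm{con}}[p^{-1}]$, $a_0\ne0$ and $a_n\neq0$. Let the Newton polygon of $f(\sigma)$ be the boundary of the lower convex hull of the points $(i,-\log_q|a_i|_1)$, $0\le i\le n$, and suppose that (*) each of these points, for $0\le i\le n$, lies on the Newton polygon (in particular all $a_i$ are nonzero). Let $-s_1<\dots<-s_k$ be the slopes of the Newton polygon. If $y\in\Gamma^{\mathrm{alg}}_{\log,\mathrm{an,con}}$ satisfies $f(\sigma)y=a_0y+a_1\sigma(y)+\dots+a_n\sigma^n(y)=0$, then $y$ is either bounded or exactly of log-growth $s_j$ for some $j$ with $s_j>0$. -/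

import Mathlib

universe u

namespace LogGrowth

/-! ## Existence of the ring `Γ^alg`

The lemmas of this section construct it: a direct limit along Frobenius followed by a localization
makes the residue field perfect, an adic completion makes it an algebra over the Witt vectors of its
residue field, and base change to the Witt vectors of a larger perfect field, completed once more,
enlarges the residue field. -/

section Construction

open scoped TensorProduct

theorem exists_adic_completion {B F : Type u} [CommRing B] [Field F] (t ϖ : B)
    (ht : ∀ b, t * b = 0 → b = 0) (hϖt : ϖ ∣ t) (res : B →+* F)
    (hker : RingHom.ker res = Ideal.span {ϖ}) :
    ∃ (A : Type u) (_ : CommRing A) (ι : B →+* A) (res' : A →+* F),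
      IsAdicComplete (Ideal.span {ι t}) A ∧ (∀ a, ι ϖ * a = 0 → a = 0) ∧
      res'.comp ι = res ∧ RingHom.ker res' = Ideal.span {ι ϖ} ∧
      (∀ a, ∃ b a', a = ι b + ι t * a') ∧
      ∀ τ : B →+* B, t ∣ τ t → ∃ τ' : A →+* A, τ'.comp ι = ι.comp τ := by
  obtain ⟨I, hI⟩ : ∃ I : Ideal B, I = Ideal.span {t} := ⟨_, rfl⟩
  have hfp : ∀ {S : Type u} [CommRing S] (J : Ideal S) {m n : ℕ} (h : m ≤ n) (x : S),
      Ideal.Quotient.factorPow J h (Ideal.Quotient.mk (J ^ n) x) = Ideal.Quotient.mk (J ^ m) x :=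
    fun J m n h x => rfl
  have hfg : I.FG := ⟨{t}, by simp [hI]⟩
  let A := AdicCompletion I B
  let ι : B →+* A := algebraMap B A
  have hresI : ∀ a ∈ I, res a = 0 := by
    intro a ha
    rw [← RingHom.mem_ker, hker, Ideal.mem_span_singleton]
    exact hϖt.trans (Ideal.mem_span_singleton.1 (hI ▸ ha))
  let res' : A →+* F := (Ideal.Quotient.lift I res hresI).comp
    (AdicCompletion.evalOneₐ I : A →ₐ[B] B ⧸ I).toRingHom
  have hres : res'.comp ι = res := by
    ext b
    rfl
  have hmap : I.map ι = Ideal.span {ι t} := by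
    have h := Ideal.map_span ι {t}
    rw [← hI, Set.image_singleton] at h
    exact h
  have hcomp : IsAdicComplete (Ideal.span {ι t}) A := by
    rw [← hmap]
    exact (IsAdicComplete.map_algebraMap_iff I A).2 (AdicCompletion.isAdicComplete hfg)
  have hdec : ∀ a : A, ∃ b a', a = ι b + ι t * a' := by
    intro a
    obtain ⟨b, hb⟩ := Ideal.Quotient.mk_surjective (AdicCompletion.evalOneₐ I a)
    have : a - ι b ∈ RingHom.ker (AdicCompletion.evalOneₐ I : A →ₐ[B] B ⧸ I).toRingHom := by
      rw [RingHom.mem_ker, map_sub, sub_eq_zero]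
      exact hb.symm
    rw [AdicCompletion.ker_evalOneₐ_eq_map I hfg] at this
    change a - ι b ∈ I.map ι at this
    rw [hmap, Ideal.mem_span_singleton] at this
    obtain ⟨a', ha'⟩ := this
    exact ⟨b, a', by rw [← ha']; ring⟩
  have htA : ∀ a : A, ι t * a = 0 → a = 0 := by
    intro a ha
    apply AdicCompletion.ext_evalₐ
    intro n
    rw [map_zero]
    obtain ⟨b, hb⟩ := Ideal.Quotient.mk_surjective (AdicCompletion.evalₐ I (n+1) a)
    have h1 : AdicCompletion.evalₐ I (n+1) (ι t * a) = 0 := by rw [ha, map_zero]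
    rw [map_mul, ← hb] at h1
    have h2 : AdicCompletion.evalₐ I (n+1) (ι t) = Ideal.Quotient.mk _ t :=
      AdicCompletion.evalₐ_of I (n+1) t
    rw [h2, ← map_mul, Ideal.Quotient.eq_zero_iff_mem, hI, Ideal.span_singleton_pow,
      Ideal.mem_span_singleton] at h1
    obtain ⟨c, hc⟩ := h1
    have h3 : b = t ^ n * c := by
      rw [← sub_eq_zero]
      apply ht
      rw [mul_sub, hc]; ring
    have h4 : AdicCompletion.evalₐ I n a
        = Ideal.Quotient.factorPow I (Nat.le_succ n) (AdicCompletion.evalₐ I (n+1) a) := by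
      obtain ⟨x, rfl⟩ := AdicCompletion.mk_surjective I B a
      rw [AdicCompletion.evalₐ_mk, AdicCompletion.evalₐ_mk, hfp]
      exact (AdicCompletion.Ideal.mk_eq_mk I (Nat.le_succ n) x).symm
    rw [h4, ← hb, hfp, Ideal.Quotient.eq_zero_iff_mem, hI,
      Ideal.span_singleton_pow, Ideal.mem_span_singleton, h3]
    exact dvd_mul_right _ _
  refine ⟨A, inferInstance, ι, res', hcomp, ?_, hres, ?_, hdec, ?_⟩
  · intro a ha
    obtain ⟨c, rfl⟩ := hϖt
    apply htA
    rw [map_mul, mul_right_comm, ha, zero_mul]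
  · have hϖ0 : res' (ι ϖ) = 0 := by
      have : res' (ι ϖ) = res ϖ := congrArg (fun f => f ϖ) hres
      rw [this, ← RingHom.mem_ker, hker]
      exact Ideal.mem_span_singleton_self ϖ
    ext a
    rw [RingHom.mem_ker, Ideal.mem_span_singleton]
    constructor
    · intro h
      obtain ⟨b, a', rfl⟩ := hdec a
      obtain ⟨c, hc⟩ := hϖt
      rw [hc, map_mul, map_add, map_mul, map_mul, hϖ0, zero_mul, zero_mul, add_zero] at h
      have h' : res b = 0 := by
        have : res' (ι b) = res b := congrArg (fun f => f b) hres
        rw [← this, h]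
      rw [← RingHom.mem_ker, hker, Ideal.mem_span_singleton] at h'
      refine dvd_add (map_dvd ι h') (Dvd.dvd.mul_right (map_dvd ι ⟨c, hc⟩) _)
    · rintro ⟨c, rfl⟩
      rw [map_mul, hϖ0, zero_mul]
  · intro τ hτ
    have hIJ : ∀ n, ∀ b ∈ I ^ n,
        ((Ideal.Quotient.mk ((I.map ι) ^ n)).comp (ι.comp τ)) b = 0 := by
      intro n b hb
      rw [hI, Ideal.span_singleton_pow, Ideal.mem_span_singleton] at hb
      obtain ⟨c, rfl⟩ := hb
      rw [RingHom.comp_apply, Ideal.Quotient.eq_zero_iff_mem, hmap, Ideal.span_singleton_pow,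
        Ideal.mem_span_singleton, RingHom.comp_apply, map_mul, map_mul, map_pow, map_pow]
      exact Dvd.dvd.mul_right (pow_dvd_pow_of_dvd (map_dvd ι hτ) n) _
    let f : (n : ℕ) → A →+* A ⧸ (I.map ι) ^ n := fun n =>
      (Ideal.Quotient.lift (I ^ n) _ (hIJ n)).comp
        (AdicCompletion.evalₐ I n : A →ₐ[B] B ⧸ I ^ n).toRingHom
    have hf : ∀ {m n : ℕ} (hle : m ≤ n),
        (Ideal.Quotient.factorPow (I.map ι) hle).comp (f n) = f m := by
      intro m n hle
      ext a
      obtain ⟨x, rfl⟩ := AdicCompletion.mk_surjective I B a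
      have e1 : ∀ k, f k (AdicCompletion.mk I B x)
          = Ideal.Quotient.mk ((I.map ι) ^ k) (ι (τ (x.val k))) := by
        intro k
        change Ideal.Quotient.lift (I ^ k) _ (hIJ k)
          (AdicCompletion.evalₐ I k (AdicCompletion.mk I B x)) = _
        rw [AdicCompletion.evalₐ_mk, Ideal.Quotient.lift_mk]
        rfl
      rw [RingHom.comp_apply, e1, e1, hfp]
      have h5 := AdicCompletion.Ideal.mk_eq_mk I hle x
      rw [Ideal.Quotient.mk_eq_mk_iff_sub_mem] at h5
      have h6 := hIJ m _ h5
      rw [map_sub, sub_eq_zero] at h6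
      exact h6
    have : IsAdicComplete (I.map ι) A := hmap ▸ hcomp
    refine ⟨IsAdicComplete.liftRingHom (I.map ι) f hf, ?_⟩
    apply RingHom.coe_inj
    apply IsHausdorff.funext' (I.map ι)
    intro n b
    rw [RingHom.comp_apply, IsAdicComplete.mk_liftRingHom]
    change Ideal.Quotient.lift (I ^ n) _ (hIJ n)
          (AdicCompletion.evalₐ I n (AdicCompletion.of I B b)) = _
    rw [AdicCompletion.evalₐ_of, Ideal.Quotient.lift_mk]
    rfl

theorem exists_perfect_base {R F : Type u} [CommRing R] [IsDomain R] [Field F] (p : ℕ)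
    [Fact p.Prime] [CharP F p] [PerfectRing F p] (f : ℕ) (hf : 0 < f) (ϖ : R) (red : R →+* F)
    (hker : RingHom.ker red = Ideal.span {ϖ}) (φ : R →+* R)
    (hφ : ∀ r, red (φ r) = red r ^ p ^ f) (hp0 : (p : R) ≠ 0) (e : ℕ)
    (hpe : Associated (p : R) (ϖ ^ e)) :
    ∃ (D : Type u) (_ : CommRing D) (j : R →+* D) (red' : D →+* F) (φ' : D →+* D),
      (∀ b, j ϖ * b = 0 → b = 0) ∧ RingHom.ker red' = Ideal.span {j ϖ} ∧
      red'.comp j = red ∧ φ'.comp j = j.comp φ ∧ (∀ d, red' (φ' d) = red' d ^ p ^ f) ∧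
      (∀ d, ∃ d', red' d' ^ p = red' d) ∧ (∀ d, red' d ≠ 0 → ∃ d', red' d * red' d' = 1) := by
  have hredϖ : red ϖ = 0 := by
    rw [← RingHom.mem_ker, hker]; exact Ideal.mem_span_singleton_self ϖ
  have hredp : (p : F) = 0 := CharP.cast_eq_zero F p
  have he : e ≠ 0 := by
    rintro rfl
    have h1 : IsUnit (p : R) := by
      rw [pow_zero] at hpe; exact (associated_one_iff_isUnit.1 hpe)
    have := h1.map red
    rw [map_natCast, hredp] at this
    exact not_isUnit_zero this
  have hϖ0 : ϖ ≠ 0 := by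
    rintro rfl
    rw [zero_pow he, associated_zero_iff_eq_zero] at hpe
    exact hp0 hpe
  -- Frobenius multiplies the uniformizer by a unit
  have hφϖ : Associated ϖ (φ ϖ) := by
    have h1 : φ ϖ ∈ RingHom.ker red := by
      rw [RingHom.mem_ker, hφ, hredϖ, zero_pow (pow_ne_zero _ (Fact.out : p.Prime).ne_zero)]
    rw [hker, Ideal.mem_span_singleton] at h1
    obtain ⟨u, hu⟩ := h1
    have h2 : Associated (ϖ ^ e) ((φ ϖ) ^ e) := by
      have h3 := hpe.map φ
      rw [map_natCast, map_pow] at h3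
      exact hpe.symm.trans h3
    obtain ⟨w, hw⟩ := h2
    rw [hu, mul_pow] at hw
    have h4 : (w : R) = u ^ e := mul_left_cancel₀ (pow_ne_zero e hϖ0) hw
    have h5 : IsUnit u := by
      rw [← isUnit_pow_iff he, ← h4]; exact w.isUnit
    exact ⟨h5.unit, hu.symm⟩
  have hφn : ∀ n, Associated ϖ ((φ ^ n) ϖ) := by
    intro n
    induction n with
    | zero => exact Associated.refl _
    | succ n ih =>
      have h := hφϖ.trans (ih.map φ)
      rw [pow_succ']; exact h
  have hredn : ∀ n r, red ((φ ^ n) r) = red r ^ p ^ (f * n) := by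
    intro n
    induction n with
    | zero => intro r; simp
    | succ n ih =>
      intro r
      rw [pow_succ', RingHom.mul_def, RingHom.comp_apply, hφ, ih, ← pow_mul, ← pow_add, mul_add, mul_one]
  let G : ℕ → Type u := fun _ => R
  let T : ∀ i j : ℕ, i ≤ j → (R →+* R) := fun i j _ => φ ^ (j - i)
  have : DirectedSystem G (T · · ·) := by
    refine ⟨fun i x => ?_, fun k j i hij hjk x => ?_⟩
    · change (φ ^ (i - i)) x = x
      rw [Nat.sub_self]; rfl
    · change (φ ^ (k - j)) ((φ ^ (j - i)) x) = (φ ^ (k - i)) x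
      rw [show k - i = (k - j) + (j - i) by omega, pow_add]; rfl
  let S : Type u := DirectLimit G T
  let of : ∀ i, R →+* S := fun i => DirectLimit.Ring.of G T i
  have of_T : ∀ i n x, of (i + n) ((φ ^ n) x) = of i x := by
    intro i n x
    have := DirectLimit.Ring.of_f (G := G) (f := T) (Nat.le_add_right i n) x
    change of (i + n) ((φ ^ (i + n - i)) x) = of i x at this
    rwa [Nat.add_sub_cancel_left] at this
  have hsurj : ∀ s : S, ∃ i x, s = of i x := fun s => DirectLimit.exists_eq_mk T s
  have hzero : ∀ i x, of i x = 0 → ∃ n, (φ ^ n) x = 0 := by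
    intro i x h
    have h0 : (of i x : S) = of i 0 := by rw [h, map_zero]
    obtain ⟨k, h1, h2, h3⟩ := Quotient.eq.1 h0
    refine ⟨k - i, ?_⟩
    change (φ ^ (k - i)) x = (φ ^ (k - i)) 0 at h3
    rw [h3, map_zero]
  let fr : ∀ n, F ≃+* F := fun n => iterateFrobeniusEquiv F p n
  have hfr : ∀ n z, (fr n) z = z ^ p ^ n := fun n z => rfl
  let g : ∀ i, G i →+* F := fun i => ((fr (f * i)).symm : F →+* F).comp red
  have hg : ∀ i r, g i r = (fr (f * i)).symm (red r) := fun i r => rfl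
  have hgc : ∀ i j (hij : i ≤ j) x, g j (T i j hij x) = g i x := by
    intro i j hij x
    rw [hg, hg]
    change (fr (f * j)).symm (red ((φ ^ (j - i)) x)) = _
    rw [RingEquiv.symm_apply_eq, hredn, hfr, 
      show f * j = f * i + f * (j - i) by rw [← mul_add]; congr 1; omega, pow_add, pow_mul ((fr (f * i)).symm (red x)),
      ← hfr (f * i), RingEquiv.apply_symm_apply]
  let redS : S →+* F := DirectLimit.Ring.lift G T F g hgc
  have hredS : ∀ i r, redS (of i r) = (fr (f * i)).symm (red r) := fun i r => rfl
  let φS : S →+* S := DirectLimit.Ring.lift G T S (fun i => (of i).comp φ) (by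
    intro i j hij x
    change of j (φ ((φ ^ (j - i)) x)) = of i (φ x)
    have h := of_T i (j - i) (φ x)
    rw [Nat.add_sub_of_le hij] at h
    rw [← h]
    congr 1
    have : φ * φ ^ (j - i) = φ ^ (j - i) * φ := (Commute.refl φ).pow_right (j - i)
    exact congrArg (fun (t : R →+* R) => t x) this)
  have hφS : ∀ i r, φS (of i r) = of i (φ r) := fun i r => rfl
  have hofϖ : ∀ i, Associated (of i ϖ) (of 0 ϖ) := by
    intro i
    have h := of_T 0 i ϖ
    rw [zero_add] at h
    rw [← h]
    exact (hφn i).map (of i)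
  have : IsDomain S := by
    have : Nontrivial S := by
      refine ⟨0, 1, fun h => ?_⟩
      have := congrArg redS h
      rw [map_zero, map_one] at this
      exact zero_ne_one this
    have : NoZeroDivisors S := by
      refine ⟨fun {a b} hab => ?_⟩
      obtain ⟨i, x, y, rfl, rfl⟩ := DirectLimit.exists_eq_mk₂ T a b
      change of i x * of i y = 0 at hab
      rw [← map_mul] at hab
      obtain ⟨n, hn⟩ := hzero _ _ hab
      rw [map_mul, mul_eq_zero] at hn
      rcases hn with hn | hn
      · left
        change of i x = 0
        rw [← of_T i n, hn, map_zero]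
      · right
        change of i y = 0
        rw [← of_T i n, hn, map_zero]
    exact NoZeroDivisors.to_isDomain S
  have hϖS : of 0 ϖ ≠ 0 := by
    intro h
    obtain ⟨n, hn⟩ := hzero _ _ h
    have := hφn n
    rw [hn] at this
    exact hϖ0 ((associated_zero_iff_eq_zero _).1 this)
  have hkerS : RingHom.ker redS = Ideal.span {of 0 ϖ} := by
    ext s
    rw [RingHom.mem_ker, Ideal.mem_span_singleton]
    constructor
    · intro h
      obtain ⟨i, x, rfl⟩ := hsurj s
      rw [hredS, map_eq_zero_iff _ (RingEquiv.injective _), ← RingHom.mem_ker, hker,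
        Ideal.mem_span_singleton] at h
      exact (hofϖ i).symm.dvd.trans (map_dvd (of i) h)
    · rintro ⟨c, rfl⟩
      rw [map_mul, hredS, hredϖ, map_zero, zero_mul]
  have hφS' : ∀ s, redS (φS s) = redS s ^ p ^ f := by
    intro s
    obtain ⟨i, x, rfl⟩ := hsurj s
    rw [hφS, hredS, hredS, hφ, map_pow]
  have hperf : ∀ s, ∃ s', redS s' ^ p = redS s := by
    intro s
    obtain ⟨i, x, rfl⟩ := hsurj s
    refine ⟨of (i + 1) (x ^ p ^ (f - 1)), ?_⟩
    rw [← map_pow, ← map_pow, ← pow_mul, ← pow_succ, Nat.sub_add_cancel hf, ← of_T i 1, pow_one,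
      hredS, hredS, hφ, map_pow]
  -- localize at the prime ideal generated by the uniformizer
  let P : Ideal S := RingHom.ker redS
  have : P.IsPrime := RingHom.ker_isPrime redS
  have hPφ : P = P.comap φS := by
    ext s
    rw [Ideal.mem_comap, RingHom.mem_ker, RingHom.mem_ker, hφS',
      pow_eq_zero_iff (pow_ne_zero _ (Fact.out : p.Prime).ne_zero)]
  let D := Localization.AtPrime P
  let l : S →+* D := algebraMap S D
  have hunit : ∀ y : P.primeCompl, IsUnit (redS y) := by
    intro y
    exact isUnit_iff_ne_zero.2 (fun h => y.2 h)
  let redD : D →+* F := IsLocalization.lift hunit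
  have hredD : ∀ s, redD (l s) = redS s := fun s => IsLocalization.lift_eq hunit s
  let φD : D →+* D := Localization.localRingHom P P φS hPφ
  have hφD : ∀ s, φD (l s) = l (φS s) := fun s => Localization.localRingHom_to_map P P φS hPφ s
  have hDsurj : ∀ d : D, ∃ (s : S) (y : P.primeCompl), d * l y = l s := by
    intro d
    obtain ⟨⟨s, y⟩, h⟩ := IsLocalization.surj P.primeCompl d
    exact ⟨s, y, h⟩
  have hlu : ∀ y : P.primeCompl, IsUnit (l y) := fun y => IsLocalization.map_units D y
  have hinj : Function.Injective l := IsLocalization.injective D (P.primeCompl_le_nonZeroDivisors)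
  refine ⟨D, inferInstance, l.comp (of 0), redD, φD, ?_, ?_, ?_, ?_, ?_, ?_, ?_⟩
  · intro b hb
    obtain ⟨s, y, h⟩ := hDsurj b
    have h1 : l (of 0 ϖ * s) = 0 := by
      rw [map_mul, ← h, ← mul_assoc]
      change l.comp (of 0) ϖ * b * l y = 0
      rw [hb, zero_mul]
    have h2 : s = 0 := by
      have h3 := hinj (h1.trans (map_zero l).symm)
      exact (mul_eq_zero.1 h3).resolve_left hϖS
    rw [h2, map_zero] at h
    exact ((hlu y).mul_left_eq_zero).1 h
  · ext d
    rw [RingHom.mem_ker, Ideal.mem_span_singleton]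
    constructor
    · intro h
      obtain ⟨s, y, h1⟩ := hDsurj d
      have h2 : redS s = 0 := by rw [← hredD, ← h1, map_mul, h, zero_mul]
      rw [← RingHom.mem_ker, hkerS, Ideal.mem_span_singleton] at h2
      have h3 := map_dvd l h2
      rw [← h1] at h3
      exact (hlu y).dvd_mul_right.1 h3
    · rintro ⟨c, rfl⟩
      rw [map_mul, RingHom.comp_apply, hredD, hredS, hredϖ, map_zero, zero_mul]
  · ext r
    rw [RingHom.comp_apply, RingHom.comp_apply, hredD, hredS]
    rw [RingEquiv.symm_apply_eq, hfr, mul_zero, pow_zero, pow_one]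
  · ext r
    rw [RingHom.comp_apply, RingHom.comp_apply, hφD, hφS]; rfl
  · intro d
    obtain ⟨s, y, h⟩ := hDsurj d
    have h1 := congrArg (fun t => redD (φD t)) h
    simp only [map_mul, hφD, hredD, hφS'] at h1
    have h2 := congrArg redD h
    rw [map_mul, hredD, hredD] at h2
    rw [← h2, mul_pow] at h1
    exact mul_right_cancel₀ (pow_ne_zero _ (hunit y).ne_zero) h1
  · intro d
    obtain ⟨s, y, h⟩ := hDsurj d
    obtain ⟨s', hs'⟩ := hperf s
    obtain ⟨y', hy'⟩ := hperf y
    have hy0 : redS y' ≠ 0 := by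
      intro h0
      rw [h0, zero_pow (Fact.out : p.Prime).ne_zero] at hy'
      exact (hunit y).ne_zero hy'.symm
    obtain ⟨v, hv⟩ := hlu ⟨y', hy0⟩
    refine ⟨l s' * ↑v⁻¹, ?_⟩
    have h2 := congrArg redD h
    rw [map_mul, hredD, hredD] at h2
    have h3 : redD (↑v⁻¹ : D) * redS y' = 1 := by
      rw [← hredD, ← map_mul]
      change redD (↑v⁻¹ * l ((⟨y', hy0⟩ : P.primeCompl) : S)) = 1
      rw [← hv, Units.inv_mul, map_one]
    have h4 : (redD (↑v⁻¹ : D)) ^ p * redS y = 1 := by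
      rw [← hy', ← mul_pow, h3, one_pow]
    apply mul_right_cancel₀ (hunit y).ne_zero
    rw [h2, map_mul, mul_pow, mul_assoc, h4, mul_one, hredD, hs']
  · intro d hd
    obtain ⟨s, y, h⟩ := hDsurj d
    have h2 := congrArg redD h
    rw [map_mul, hredD, hredD] at h2
    have hs0 : redS s ≠ 0 := by
      rw [← h2]; exact mul_ne_zero hd (hunit y).ne_zero
    obtain ⟨v, hv⟩ := hlu ⟨s, hs0⟩
    refine ⟨l y * ↑v⁻¹, ?_⟩
    rw [map_mul, ← mul_assoc, hredD, h2, ← hredD, ← map_mul]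
    change redD (l ((⟨s, hs0⟩ : P.primeCompl) : S) * ↑v⁻¹) = 1
    rw [← hv, Units.mul_inv, map_one]


theorem exists_tensor_lift {W C V T : Type*} [CommRing W] [CommRing C] [CommRing V] [CommRing T]
    [Algebra W C] [Algebra W V] (f : C →+* T) (g : V →+* T)
    (h : ∀ w, f (algebraMap W C w) = g (algebraMap W V w)) :
    ∃ k : C ⊗[W] V →+* T, ∀ c v, k (c ⊗ₜ v) = f c * g v := by
  let : Algebra W T := (f.comp (algebraMap W C)).toAlgebra
  let f' : C →ₐ[W] T := { f with commutes' := fun w => rfl }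
  let g' : V →ₐ[W] T := { g with commutes' := fun w => (h w).symm }
  refine ⟨(Algebra.TensorProduct.lift f' g' (fun _ _ => Commute.all _ _)).toRingHom, ?_⟩
  intro c v
  exact Algebra.TensorProduct.lift_tmul f' g' _ c v

theorem exists_unramified_base_change {C F κ : Type u} [CommRing C] [Field F] [Field κ] (p : ℕ)
    [Fact p.Prime] [CharP F p] [PerfectRing F p] [CharP κ p] [PerfectRing κ p] (f : ℕ)
    (θ : WittVector p κ →+* C) (ψ : κ →+* F) (res : C →+* F) (ϖ : C)
    (hϖ : ∀ c, ϖ * c = 0 → c = 0) (hker : RingHom.ker res = Ideal.span {ϖ})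
    (hθ : ∀ x, res (θ x) = ψ (x.coeff 0)) (hsurj : ∀ c, ∃ z, ψ z = res c)
    (σ : C →+* C) (hσ : ∀ c, res (σ c) = res c ^ p ^ f)
    (hσθ : ∀ x, σ (θ x) = θ (WittVector.map (iterateFrobenius κ p f) x)) :
    ∃ (B : Type u) (_ : CommRing B) (ι : C →+* B) (res' : B →+* F) (σ' : B →+* B),
      (∀ b, ι ϖ * b = 0 → b = 0) ∧ RingHom.ker res' = Ideal.span {ι ϖ} ∧
      Function.Surjective res' ∧ res'.comp ι = res ∧ σ'.comp ι = ι.comp σ ∧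
      (∀ b, res' (σ' b) = res' b ^ p ^ f) := by
  let : Algebra (WittVector p κ) C := θ.toAlgebra
  let : Algebra (WittVector p κ) (WittVector p F) := (WittVector.map ψ).toAlgebra
  have halgC : ∀ w, algebraMap (WittVector p κ) C w = θ w := fun w => rfl
  have halgF : ∀ w, algebraMap (WittVector p κ) (WittVector p F) w = WittVector.map ψ w :=
    fun w => rfl
  have hinj : Function.Injective (algebraMap (WittVector p κ) (WittVector p F)) :=
    WittVector.map_injective ψ ψ.injective
  have : FaithfulSMul (WittVector p κ) (WittVector p F) :=
    (faithfulSMul_iff_algebraMap_injective _ _).2 hinj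
  have : Module.IsTorsionFree (WittVector p κ) (WittVector p F) := inferInstance
  have hflat : Module.Flat (WittVector p κ) (WittVector p F) := inferInstance
  let B := C ⊗[WittVector p κ] (WittVector p F)
  let ι : C →+* B := Algebra.TensorProduct.includeLeftRingHom
  have hι : ∀ c, ι c = c ⊗ₜ 1 := fun c => rfl
  obtain ⟨res', hres'⟩ := exists_tensor_lift (W := WittVector p κ) (V := WittVector p F) res
    (WittVector.constantCoeff : WittVector p F →+* F) (fun w => by
      rw [halgC, halgF, hθ, WittVector.constantCoeff_apply, WittVector.map_coeff])
  let inc : WittVector p F →+* B :=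
    (Algebra.TensorProduct.includeRight :
      WittVector p F →ₐ[WittVector p κ] B).toRingHom
  have hinc : ∀ v, inc v = 1 ⊗ₜ v := fun v => rfl
  have hbal : ∀ w, ι (θ w) = inc (WittVector.map ψ w) := by
    intro w
    rw [hι, hinc, ← halgC, ← halgF]
    rw [Algebra.algebraMap_eq_smul_one, Algebra.algebraMap_eq_smul_one, TensorProduct.smul_tmul]
  have hfrob : ∀ (w : WittVector p κ),
      WittVector.map (iterateFrobenius F p f) (WittVector.map ψ w)
        = WittVector.map ψ (WittVector.map (iterateFrobenius κ p f) w) := by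
    intro w
    ext n
    simp only [WittVector.map_coeff, iterateFrobenius_def, map_pow]
  obtain ⟨σ', hσ'⟩ := exists_tensor_lift (W := WittVector p κ) (V := WittVector p F)
    (ι.comp σ) (inc.comp (WittVector.map (iterateFrobenius F p f))) (fun w => by
      rw [halgC, halgF, RingHom.comp_apply, RingHom.comp_apply, hσθ, hbal, hfrob])
  have hresϖ : res ϖ = 0 := by
    rw [← RingHom.mem_ker, hker]; exact Ideal.mem_span_singleton_self ϖ
  have hdvd : ∀ c, res c = 0 → ϖ ∣ c := by
    intro c hc
    rwa [← RingHom.mem_ker, hker, Ideal.mem_span_singleton] at hc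
  have hp : ϖ ∣ (p : C) := hdvd _ (by rw [map_natCast, CharP.cast_eq_zero])
  -- every element is congruent modulo the uniformizer to a Witt vector
  have hdec : ∀ b : B, ∃ v b', b = inc v + ι ϖ * b' := by
    intro b
    induction b using TensorProduct.induction_on with
    | zero => exact ⟨0, 0, by simp⟩
    | tmul c v =>
      obtain ⟨z, hz⟩ := hsurj c
      have h1 : ϖ ∣ c - θ (WittVector.teichmuller p z) := hdvd _ (by
        rw [map_sub, hθ, WittVector.teichmuller_coeff_zero, hz, sub_self])
      obtain ⟨d, hd⟩ := h1
      refine ⟨WittVector.map ψ (WittVector.teichmuller p z) * v, d ⊗ₜ v, ?_⟩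
      have h2 : c = θ (WittVector.teichmuller p z) + ϖ * d := by rw [← hd]; ring
      have h3 : (c ⊗ₜ v : B) = ι c * inc v := by
        rw [hι, hinc, Algebra.TensorProduct.tmul_mul_tmul, mul_one, one_mul]
      have h4 : (d ⊗ₜ v : B) = ι d * inc v := by
        rw [hι, hinc, Algebra.TensorProduct.tmul_mul_tmul, mul_one, one_mul]
      rw [h3, h4, map_mul inc, ← hbal, h2, map_add, map_mul ι]
      ring
    | add x y hx hy =>
      obtain ⟨v, b, rfl⟩ := hx
      obtain ⟨w, c, rfl⟩ := hy
      exact ⟨v + w, b + c, by rw [map_add]; ring⟩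
  refine ⟨B, inferInstance, ι, res', σ', ?_, ?_, ?_, ?_, ?_, ?_⟩
  · intro b hb
    let L : C →ₗ[WittVector p κ] C := LinearMap.mulLeft _ ϖ
    have hL : Function.Injective L := by
      rw [injective_iff_map_eq_zero]
      exact fun c hc => hϖ c hc
    have h1 : Function.Injective (L.rTensor (WittVector p F)) :=
      Module.Flat.rTensor_preserves_injective_linearMap L hL
    apply h1
    rw [map_zero]
    have h2 : ∀ b : B, L.rTensor (WittVector p F) b = ι ϖ * b := by
      intro b
      induction b using TensorProduct.induction_on with
      | zero => rw [map_zero, mul_zero]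
      | tmul c v =>
        rw [LinearMap.rTensor_tmul, hι, Algebra.TensorProduct.tmul_mul_tmul, one_mul]
        rfl
      | add x y hx hy => rw [map_add, hx, hy, mul_add]
    rw [h2, hb]
  · ext b
    rw [RingHom.mem_ker, Ideal.mem_span_singleton]
    have hιϖ : res' (ι ϖ) = 0 := by rw [hι, hres', hresϖ, zero_mul]
    constructor
    · intro h
      obtain ⟨v, b', rfl⟩ := hdec b
      rw [map_add, map_mul, hιϖ, zero_mul, add_zero, hinc, hres', map_one, one_mul] at h
      have h1 : v ∈ Ideal.span {(p : WittVector p F)} := by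
        rw [WittVector.mem_span_p_iff_coeff_zero_eq_zero]; exact h
      rw [Ideal.mem_span_singleton] at h1
      have h2 := map_dvd inc h1
      rw [map_natCast, ← map_natCast ι] at h2
      exact dvd_add ((map_dvd ι hp).trans h2) (dvd_mul_right _ _)
    · rintro ⟨c, rfl⟩
      rw [map_mul, hιϖ, zero_mul]
  · intro z
    refine ⟨inc (WittVector.teichmuller p z), ?_⟩
    rw [hinc, hres', map_one, one_mul, WittVector.constantCoeff_apply,
      WittVector.teichmuller_coeff_zero]
  · ext c
    rw [RingHom.comp_apply, hι, hres', map_one, mul_one]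
  · ext c
    rw [RingHom.comp_apply, RingHom.comp_apply, hι, hσ', map_one, mul_one, RingHom.comp_apply]
  · intro b
    induction b using TensorProduct.induction_on with
    | zero => rw [map_zero, map_zero, zero_pow (pow_ne_zero _ (Fact.out : p.Prime).ne_zero)]
    | tmul c v =>
      rw [hσ', map_mul, RingHom.comp_apply, RingHom.comp_apply, hι, hinc, hres', hres', hres',
        map_one, map_one, one_mul, mul_one, hσ, mul_pow, WittVector.constantCoeff_apply,
        WittVector.constantCoeff_apply, WittVector.map_coeff, iterateFrobenius_def]
    | add x y hx hy =>
      rw [map_add, map_add, map_add, hx, hy, add_pow_char_pow]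

theorem exists_theta {C F : Type u} [CommRing C] [Field F] (p : ℕ)
    [Fact p.Prime] [CharP F p] [PerfectRing F p] (f : ℕ)
    [IsAdicComplete (Ideal.span {(p : C)}) C] (res : C →+* F) (ϖ : C)
    (hker : RingHom.ker res = Ideal.span {ϖ}) (e : ℕ) (hpe : (p : C) ∣ ϖ ^ e)
    (hperf : ∀ c, ∃ c', res c' ^ p = res c) (hinv : ∀ c, res c ≠ 0 → ∃ c', res c * res c' = 1)
    (σ : C →+* C) (hσ : ∀ c, res (σ c) = res c ^ p ^ f) :
    ∃ (κ : Type u) (_ : Field κ) (_ : CharP κ p) (_ : PerfectRing κ p)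
      (θ : WittVector p κ →+* C) (ψ : κ →+* F), (∀ x, res (θ x) = ψ (x.coeff 0)) ∧
      (∀ c, ∃ z, ψ z = res c) ∧
      (∀ x, σ (θ x) = θ (WittVector.map (iterateFrobenius κ p f) x)) := by
  have hp1 : 1 < p := (Fact.out : p.Prime).one_lt
  have hresp : res (p : C) = 0 := by rw [map_natCast, CharP.cast_eq_zero]
  have hnu : Fact ¬IsUnit (p : C) := ⟨fun h => by
    have := h.map res
    rw [hresp] at this
    exact not_isUnit_zero this⟩
  have hdvd : ∀ c, res c = 0 → ϖ ∣ c := by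
    intro c hc
    rwa [← RingHom.mem_ker, hker, Ideal.mem_span_singleton] at hc
  have hpe' : ∀ k, (p : C) ∣ ϖ ^ p ^ (e + k) := fun k =>
    hpe.trans (pow_dvd_pow _ ((Nat.le_add_right e k).trans (Nat.lt_pow_self hp1).le))
  have hresI : ∀ a ∈ Ideal.span {(p : C)}, res a = 0 := by
    intro a ha
    rw [Ideal.mem_span_singleton] at ha
    obtain ⟨b, rfl⟩ := ha
    rw [map_mul, hresp, zero_mul]
  let mk : C →+* ModP C p := Ideal.Quotient.mk _
  have hmk0 : ∀ c, mk c = 0 ↔ (p : C) ∣ c := fun c => by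
    rw [← Ideal.mem_span_singleton]; exact Ideal.Quotient.eq_zero_iff_mem
  let r1 : ModP C p →+* F := Ideal.Quotient.lift _ res hresI
  have hr1 : ∀ c, r1 (mk c) = res c := fun c => rfl
  have hmks : Function.Surjective mk := Ideal.Quotient.mk_surjective
  have hchar : ∀ a b : C, res a = res b → ∀ k, mk a ^ p ^ (e + k) = mk b ^ p ^ (e + k) := by
    intro a b hab k
    rw [← sub_eq_zero, ← sub_pow_char_pow, ← map_sub, ← map_pow, hmk0]
    exact (hpe' k).trans (pow_dvd_pow_of_dvd (hdvd _ (by rw [map_sub, hab, sub_self])) _)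
  let κ := PreTilt C p
  let ψ : κ →+* F := r1.comp (PreTilt.coeff 0)
  have hcoeff : ∀ (x : κ) n, ψ x = (r1 (PreTilt.coeff n x)) ^ p ^ n := by
    intro x n
    induction n with
    | zero => rw [pow_zero, pow_one]; rfl
    | succ n ih => rw [ih, ← PreTilt.coeff_pow_p, map_pow, ← pow_mul, ← pow_succ']
  have hψinj : Function.Injective ψ := by
    rw [injective_iff_map_eq_zero]
    intro x hx
    have h1 : ∀ n, r1 (PreTilt.coeff n x) = 0 := by
      intro n
      have := hcoeff x n
      rw [hx] at this
      exact eq_zero_of_pow_eq_zero this.symm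
    apply Perfection.ext
    intro n
    change PreTilt.coeff n x = 0
    have h2 : ∀ k, PreTilt.coeff n x = PreTilt.coeff (n + k) x ^ p ^ k := by
      intro k
      induction k with
      | zero => simp
      | succ k ih => rw [ih, ← PreTilt.coeff_pow_p, ← pow_mul, ← pow_succ', add_assoc]
    obtain ⟨c, hc⟩ := hmks (PreTilt.coeff (n + e) x)
    have h3 := h1 (n + e)
    rw [← hc, hr1] at h3
    have h4 := hchar c 0 (by rw [h3, map_zero]) 0
    rw [add_zero, map_zero, zero_pow (pow_ne_zero _ (by omega)), hc] at h4
    rw [h2 e, h4]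
  have hψsurj : ∀ c, ∃ z, ψ z = res c := by
    intro c
    choose r hr using hperf
    have hrn : ∀ n, res (r^[n] c) ^ p ^ n = res c := by
      intro n
      induction n with
      | zero => simp
      | succ n ih => rw [Function.iterate_succ_apply', pow_succ', pow_mul, hr, ih]
    let s : ℕ → ModP C p := fun n => mk (r^[n + e] c) ^ p ^ e
    have hs : ∀ n, s (n + 1) ^ p = s n := by
      intro n
      change (mk (r^[n + 1 + e] c) ^ p ^ e) ^ p = mk (r^[n + e] c) ^ p ^ e
      have h := hchar ((r^[n + 1 + e] c) ^ p) (r^[n + e] c) (by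
        rw [map_pow, show n + 1 + e = (n + e) + 1 by omega, Function.iterate_succ_apply', hr]) 0
      rw [add_zero] at h
      rw [← h, ← pow_mul, map_pow, ← pow_mul, mul_comm]
    refine ⟨(⟨s, hs⟩ : Perfection (ModP C p) p), ?_⟩
    change r1 (mk (r^[0 + e] c) ^ p ^ e) = res c
    rw [map_pow, hr1, zero_add, hrn]
  have hfield : IsField κ := by
    refine ⟨⟨0, 1, fun h => ?_⟩, mul_comm, ?_⟩
    · have := congrArg ψ h
      rw [map_zero, map_one] at this
      exact zero_ne_one this
    · intro x hx
      have h1 : ψ x ≠ 0 := fun h => hx (hψinj (h.trans (map_zero ψ).symm))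
      obtain ⟨c, hc⟩ := hmks (PreTilt.coeff 0 x)
      have h2 : ψ x = res c := by rw [← hr1, hc]; rfl
      rw [h2] at h1
      obtain ⟨c', hc'⟩ := hinv c h1
      obtain ⟨z, hz⟩ := hψsurj c'
      exact ⟨z, hψinj (by rw [map_mul, map_one, h2, hz, hc'])⟩
  refine ⟨κ, hfield.toField, inferInstanceAs (CharP (PreTilt C p) p),
    inferInstanceAs (PerfectRing (PreTilt C p) p), WittVector.fontaineTheta C p, ψ, ?_, hψsurj, ?_⟩
  · intro x
    have := congrArg r1 (WittVector.mk_fontaineTheta x)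
    exact this
  · have hteich : ∀ z : PreTilt C p, σ z.untilt = z.untilt ^ p ^ f := by
      intro z
      rw [IsHausdorff.eq_iff_smodEq (I := Ideal.span {(p : C)})]
      intro n
      rw [SModEq.sub_mem, smul_eq_mul, Ideal.mul_top, Ideal.span_singleton_pow,
        Ideal.mem_span_singleton]
      set y := PreTilt.untilt (((frobeniusEquiv (PreTilt C p) p).symm^[e + n]) z) with hy
      have h1 : y ^ p ^ (e + n) = z.untilt := PreTilt.untilt_iterate_frobeniusEquiv_symm_pow z _
      have h2 := hchar (σ y) (y ^ p ^ f) (by rw [hσ, map_pow]) 0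
      rw [add_zero, ← sub_eq_zero, ← map_pow mk, ← map_pow mk, ← map_sub, hmk0] at h2
      have h3 := dvd_sub_pow_of_dvd_sub h2 n
      rw [← pow_mul, ← pow_mul, ← pow_add, ← map_pow, h1, ← pow_mul, mul_comm (p ^ f),
        pow_mul, h1] at h3
      exact (pow_dvd_pow _ (Nat.le_succ n)).trans h3
    have key : σ.comp (WittVector.fontaineTheta C p) = (WittVector.fontaineTheta C p).comp
        (WittVector.map (iterateFrobenius (PreTilt C p) p f)) := by
      apply RingHom.coe_inj
      apply IsHausdorff.funext' (Ideal.span {(p : C)})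
      intro n x
      have h : (Ideal.Quotient.mk (Ideal.span {(p : C)} ^ n)).comp
          (σ.comp (WittVector.fontaineTheta C p)) =
          (Ideal.Quotient.mk (Ideal.span {(p : C)} ^ n)).comp ((WittVector.fontaineTheta C p).comp
            (WittVector.map (iterateFrobenius (PreTilt C p) p f))) := by
        apply WittVector.eq_of_apply_teichmuller_eq
        · refine ⟨n, ?_⟩
          rw [← map_natCast (Ideal.Quotient.mk (Ideal.span {(p : C)} ^ n)), ← map_pow,
            Ideal.Quotient.eq_zero_iff_mem]
          exact Ideal.pow_mem_pow (Ideal.mem_span_singleton_self _) n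
        · intro z
          simp only [RingHom.comp_apply, WittVector.fontaineTheta_teichmuller,
            WittVector.map_teichmuller, iterateFrobenius_def, map_pow, hteich]
      exact congrArg (fun g => g x) h
    intro x
    exact congrArg (fun g => g x) key

theorem isDiscreteValuationRing_of_complete {A F : Type u} [CommRing A] [Field F] (ϖ : A)
    [hc : IsAdicComplete (Ideal.span {ϖ}) A] (hϖ : ∀ a, ϖ * a = 0 → a = 0) (res : A →+* F)
    (hker : RingHom.ker res = Ideal.span {ϖ}) (hsurj : Function.Surjective res) :
    ∃ _ : IsDomain A, IsDiscreteValuationRing A ∧ Irreducible ϖ := by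
  have hres0 : res ϖ = 0 := by
    rw [← RingHom.mem_ker, hker]; exact Ideal.mem_span_singleton_self ϖ
  have hdvd : ∀ c, res c = 0 → ϖ ∣ c := by
    intro c hc
    rwa [← RingHom.mem_ker, hker, Ideal.mem_span_singleton] at hc
  have hunit : ∀ a, res a ≠ 0 → IsUnit a := by
    intro a ha
    obtain ⟨b, hb⟩ := hsurj (res a)⁻¹
    obtain ⟨c, hc'⟩ := hdvd (a * b - 1) (by
      rw [map_sub, map_mul, hb, map_one, mul_inv_cancel₀ ha, sub_self])
    have h1 : ϖ ∈ (⊥ : Ideal A).jacobson :=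
      IsAdicComplete.le_jacobson_bot (Ideal.span {ϖ}) (Ideal.mem_span_singleton_self ϖ)
    have h2 := Ideal.mem_jacobson_bot.1 h1 c
    rw [← hc', sub_add_cancel] at h2
    exact isUnit_of_mul_isUnit_left h2
  have hpow : ∀ n a, ϖ ^ n * a = 0 → a = 0 := by
    intro n
    induction n with
    | zero => intro a h; simpa using h
    | succ n ih => intro a h; rw [pow_succ, mul_assoc] at h; exact hϖ a (ih _ h)
  have hfac : ∀ a, a ≠ 0 → ∃ n, ∃ u, IsUnit u ∧ a = ϖ ^ n * u := by
    intro a ha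
    by_contra hcon
    have hall : ∀ n, ϖ ^ n ∣ a := by
      intro n
      induction n with
      | zero => simp
      | succ n ih =>
        obtain ⟨u, hu⟩ := ih
        by_cases h : res u = 0
        · obtain ⟨v, rfl⟩ := hdvd u h
          exact ⟨v, by rw [hu]; ring⟩
        · exact absurd ⟨n, u, hunit u h, hu⟩ hcon
    apply ha
    apply hc.toIsHausdorff.haus'
    intro n
    rw [SModEq.zero, smul_eq_mul, Ideal.mul_top, Ideal.span_singleton_pow,
      Ideal.mem_span_singleton]
    exact hall n
  have hnt : Nontrivial A := ⟨0, 1, fun h => by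
    have := congrArg res h
    rw [map_zero, map_one] at this
    exact zero_ne_one this⟩
  have hnz : NoZeroDivisors A := by
    refine ⟨fun {a b} hab => ?_⟩
    by_contra hcon
    rw [not_or] at hcon
    obtain ⟨n, u, hu, rfl⟩ := hfac a hcon.1
    obtain ⟨m, v, hv, rfl⟩ := hfac b hcon.2
    have h1 : ϖ ^ (n + m) * (u * v) = 0 := by rw [← hab]; ring
    exact (hu.mul hv).ne_zero (hpow _ _ h1)
  have hdom : IsDomain A := NoZeroDivisors.to_isDomain A
  have hirr : Irreducible ϖ := by
    refine ⟨fun h => ?_, fun {a b} hab => ?_⟩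
    · have := h.map res
      rw [hres0] at this
      exact not_isUnit_zero this
    · by_contra hcon
      rw [not_or] at hcon
      obtain ⟨a', rfl⟩ := hdvd a (by by_contra h; exact hcon.1 (hunit a h))
      obtain ⟨b', rfl⟩ := hdvd b (by by_contra h; exact hcon.2 (hunit b h))
      have h1 : ϖ * (1 - a' * (ϖ * b')) = 0 := by
        rw [mul_sub, mul_one, ← mul_assoc, ← hab, sub_self]
      have h2 := congrArg res (hϖ _ h1)
      rw [map_sub, map_one, map_mul, map_mul, hres0, zero_mul, mul_zero, sub_zero, map_zero] at h2
      exact one_ne_zero h2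
  refine ⟨hdom, ?_, hirr⟩
  apply IsDiscreteValuationRing.ofHasUnitMulPowIrreducibleFactorization
  refine ⟨ϖ, hirr, fun {x} hx => ?_⟩
  obtain ⟨n, u, hu, rfl⟩ := hfac x hx
  exact ⟨n, hu.unit, rfl⟩

theorem exists_unramified_lift {R F : Type u} [CommRing R] [IsDomain R] [Field F] (p : ℕ)
    [Fact p.Prime] [CharP F p] [PerfectRing F p] (f : ℕ) (hf : 0 < f) (ϖ : R) (red : R →+* F)
    (hker : RingHom.ker red = Ideal.span {ϖ}) (φ : R →+* R)
    (hφ : ∀ r, red (φ r) = red r ^ p ^ f) (hp0 : (p : R) ≠ 0) (e : ℕ)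
    (hpe : Associated (p : R) (ϖ ^ e)) :
    ∃ (A : Type u) (_ : CommRing A) (_ : IsDomain A) (ι : R →+* A) (res : A →+* F) (σ : A →+* A),
      IsDiscreteValuationRing A ∧ Irreducible (ι ϖ) ∧ IsAdicComplete (Ideal.span {ι ϖ}) A ∧
      Function.Surjective res ∧ RingHom.ker res = Ideal.span {ι ϖ} ∧
      (∀ r, res (ι r) = red r) ∧ (∀ r, σ (ι r) = ι (φ r)) ∧ (∀ a, res (σ a) = res a ^ p ^ f) := by
  have hq0 : p ^ f ≠ 0 := pow_ne_zero _ (Fact.out : p.Prime).ne_zero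
  obtain ⟨D, _, j, redD, φD, hD1, hD2, hD3, hD4, hD5, hD6, hD7⟩ :=
    exists_perfect_base p f hf ϖ red hker φ hφ hp0 e hpe
  have hpeD : Associated (p : D) ((j ϖ) ^ e) := by
    have := hpe.map j
    rwa [map_natCast, map_pow] at this
  have hD1' : ∀ n b, j ϖ ^ n * b = 0 → b = 0 := by
    intro n
    induction n with
    | zero => intro a h; simpa using h
    | succ n ih => intro a h; rw [pow_succ, mul_assoc] at h; exact hD1 a (ih _ h)
  have hpD : ∀ b, (p : D) * b = 0 → b = 0 := by
    intro b hb
    obtain ⟨v, hv⟩ := hpeD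
    apply hD1' e
    rw [← hv, mul_right_comm, hb, zero_mul]
  have hϖp : j ϖ ∣ (p : D) := by
    rw [← Ideal.mem_span_singleton, ← hD2, RingHom.mem_ker, map_natCast, CharP.cast_eq_zero]
  obtain ⟨C, _, ι, resC, hC1, hC2, hC3, hC4, hC5, hC6⟩ :=
    exists_adic_completion (p : D) (j ϖ) hpD hϖp redD hD2
  obtain ⟨σC, hσC⟩ := hC6 φD (by rw [map_natCast])
  have hC3' : ∀ d, resC (ι d) = redD d := fun d => congrArg (fun g => g d) hC3
  have hσC' : ∀ d, σC (ι d) = ι (φD d) := fun d => congrArg (fun g => g d) hσC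
  rw [map_natCast] at hC1 hC5
  have hresp : resC (p : C) = 0 := by rw [map_natCast, CharP.cast_eq_zero]
  have hdecC : ∀ c, ∃ d, resC c = redD d ∧ resC (σC c) = redD d ^ p ^ f := by
    intro c
    obtain ⟨d, c', rfl⟩ := hC5 c
    refine ⟨d, ?_, ?_⟩
    · rw [map_add, map_mul, hresp, zero_mul, add_zero, hC3']
    · rw [map_add, map_mul, map_natCast, map_add, map_mul, hresp, zero_mul, add_zero, hσC', hC3',
        hD5]
  have hσCres : ∀ c, resC (σC c) = resC c ^ p ^ f := by
    intro c
    obtain ⟨d, h1, h2⟩ := hdecC c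
    rw [h1, h2]
  have hpeC : (p : C) ∣ (ι (j ϖ)) ^ e := by
    have := map_dvd ι hpeD.dvd
    rwa [map_natCast, map_pow] at this
  obtain ⟨κ, _, _, _, θ, ψ, hθ1, hθ2, hθ3⟩ := exists_theta p f resC (ι (j ϖ)) hC4 e hpeC
    (by
      intro c
      obtain ⟨d, h1, -⟩ := hdecC c
      obtain ⟨d', hd'⟩ := hD6 d
      exact ⟨ι d', by rw [hC3', hd', h1]⟩)
    (by
      intro c hc
      obtain ⟨d, h1, -⟩ := hdecC c
      rw [h1] at hc
      obtain ⟨d', hd'⟩ := hD7 d hc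
      exact ⟨ι d', by rw [hC3', h1, hd']⟩) σC hσCres
  obtain ⟨B, _, ιB, resB, σB, hB1, hB2, hB3, hB4, hB5, hB6⟩ :=
    exists_unramified_base_change p f θ ψ resC (ι (j ϖ)) hC2 hC4 hθ1 hθ2 σC hσCres hθ3
  obtain ⟨A, _, ιA, resA, hA1, hA2, hA3, hA4, hA5, hA6⟩ :=
    exists_adic_completion (ιB (ι (j ϖ))) (ιB (ι (j ϖ))) hB1 dvd_rfl resB hB2
  have hσϖ : ιB (ι (j ϖ)) ∣ σB (ιB (ι (j ϖ))) := by
    rw [← Ideal.mem_span_singleton, ← hB2, RingHom.mem_ker, hB6]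
    have h : resB (ιB (ι (j ϖ))) = 0 := by
      rw [← RingHom.mem_ker, hB2]; exact Ideal.mem_span_singleton_self _
    rw [h, zero_pow hq0]
  obtain ⟨σA, hσA⟩ := hA6 σB hσϖ
  have hB4' : ∀ c, resB (ιB c) = resC c := fun c => congrArg (fun g => g c) hB4
  have hB5' : ∀ c, σB (ιB c) = ιB (σC c) := fun c => congrArg (fun g => g c) hB5
  have hA3' : ∀ b, resA (ιA b) = resB b := fun b => congrArg (fun g => g b) hA3
  have hσA' : ∀ b, σA (ιA b) = ιA (σB b) := fun b => congrArg (fun g => g b) hσA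
  have hD3' : ∀ r, redD (j r) = red r := fun r => congrArg (fun g => g r) hD3
  have hD4' : ∀ r, φD (j r) = j (φ r) := fun r => congrArg (fun g => g r) hD4
  have hresA0 : resA (ιA (ιB (ι (j ϖ)))) = 0 := by
    rw [← RingHom.mem_ker, hA4]; exact Ideal.mem_span_singleton_self _
  have hAsurj : Function.Surjective resA := by
    intro z
    obtain ⟨b, hb⟩ := hB3 z
    exact ⟨ιA b, by rw [hA3', hb]⟩
  obtain ⟨hdom, hdvr, hirr⟩ := isDiscreteValuationRing_of_complete _ hA2 resA hA4 hAsurj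
  refine ⟨A, inferInstance, hdom, ((ιA.comp ιB).comp ι).comp j, resA, σA, hdvr, hirr, hA1, hAsurj,
    hA4, ?_, ?_, ?_⟩
  · intro r
    simp only [RingHom.comp_apply, hA3', hB4', hC3', hD3']
  · intro r
    simp only [RingHom.comp_apply, hσA', hB5', hσC', hD4']
  · intro a
    obtain ⟨b, a', rfl⟩ := hA5 a
    have hB0 : resB (ιB (ι (j ϖ))) = 0 := by
      rw [← RingHom.mem_ker, hB2]; exact Ideal.mem_span_singleton_self _
    have h1 : resA (σA (ιA (ιB (ι (j ϖ))))) = 0 := by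
      rw [hσA', hA3', hB6, hB0, zero_pow hq0]
    rw [map_add, map_mul, map_add, map_mul, map_add, map_mul, h1, hresA0, zero_mul, zero_mul,
      add_zero, add_zero, hσA', hA3', hA3', hB6]

end Construction

/-! ## The set-up -/

/-- The data of a complete discrete valuation ring `O = O_K` of mixed characteristic `(0, p)` (the
conditions on `O` itself are type classes, given where they are needed): a uniformizer, an exponent
`f > 0` with `q = p ^ f`, a `q`-Frobenius `sigma` on `O`, and an extension `sigmaX` of it to
`O⟦x⟧` with `sigmaX x ≡ x ^ q` modulo the maximal ideal of `O`. -/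
structure FrobDatum (p : ℕ) (O : Type u) [CommRing O] [IsDomain O]
    [IsDiscreteValuationRing O] where
  unif : O
  unif_irreducible : Irreducible unif
  f : ℕ
  f_pos : 0 < f
  sigma : O →+* O
  sigma_spec : ∀ a, unif ∣ sigma a - a ^ p ^ f
  sigmaX : PowerSeries O →+* PowerSeries O
  sigmaX_C : ∀ a, sigmaX (PowerSeries.C a) = PowerSeries.C (sigma a)
  sigmaX_X : PowerSeries.C unif ∣ sigmaX PowerSeries.X - PowerSeries.X ^ p ^ f

/-- The residue field `k` of `O`. -/
abbrev ResField (O : Type u) [CommRing O] [IsLocalRing O] : Type u := IsLocalRing.ResidueField O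

/-- The algebraic closure of the field of Laurent series `k((x))`. -/
abbrev LaurentAlg (O : Type u) [CommRing O] [IsLocalRing O] : Type u :=
  AlgebraicClosure (LaurentSeries (ResField O))

/-- Reduction modulo the maximal ideal of `O`, as a map `O⟦x⟧ → k⟦x⟧ ⊆ k((x)) ⊆ k((x))^alg`. -/
noncomputable def reduction (O : Type u) [CommRing O] [IsLocalRing O] :
    PowerSeries O →+* LaurentAlg O :=
  (algebraMap (LaurentSeries (ResField O)) (LaurentAlg O)).comp
    ((HahnSeries.ofPowerSeries ℤ (ResField O)).comp (PowerSeries.map (IsLocalRing.residue O)))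

open Classical in
/-- The valuation on `k((x))^alg` with `v(x) = 1`, the unique extension of the `x`-adic one: if the
minimal polynomial of `z ≠ 0` over `k((x))` has degree `d` and constant term `c`, then
`v(z) = ord(c) / d`. -/
noncomputable def laurentVal {O : Type u} [CommRing O] [IsLocalRing O] (z : LaurentAlg O) : EReal :=
  if z = 0 then ⊤ else
    (((((minpoly (LaurentSeries (ResField O)) z).coeff 0).order : ℝ) /
      ((minpoly (LaurentSeries (ResField O)) z).natDegree : ℝ) : ℝ) : EReal)

/-- A presentation of the ring `Γ^alg` attached to the set-up: a complete discrete valuation ring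
with residue field `k((x))^alg` which is unramified over `O⟦x⟧[1/x]` (so that the uniformizer of `O`
is a uniformizer), together with a `q`-Frobenius extending the one of `O⟦x⟧`. These properties
determine it up to a unique isomorphism, compatible with all the data. -/
structure AlgLift {p : ℕ} {O : Type u} [CommRing O] [IsDomain O] [IsDiscreteValuationRing O]
    (S : FrobDatum p O) where
  carrier : Type u
  [commRing : CommRing carrier]
  [isDomain : IsDomain carrier]
  [isDVR : IsDiscreteValuationRing carrier]
  incl : PowerSeries O →+* carrier
  red : carrier →+* LaurentAlg O
  frob : carrier →+* carrier
  irreducible_unif : Irreducible (incl (PowerSeries.C S.unif))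
  complete : IsAdicComplete (Ideal.span {incl (PowerSeries.C S.unif)}) carrier
  red_surjective : Function.Surjective red
  ker_red : RingHom.ker red = Ideal.span {incl (PowerSeries.C S.unif)}
  red_incl : ∀ g, red (incl g) = reduction O g
  frob_incl : ∀ g, frob (incl g) = incl (S.sigmaX g)
  red_frob : ∀ a, red (frob a) = red a ^ p ^ S.f

attribute [instance] AlgLift.commRing AlgLift.isDomain AlgLift.isDVR

section Existence

variable {p : ℕ} [Fact p.Prime] {O : Type u} [CommRing O] [IsDomain O] [IsDiscreteValuationRing O]

theorem FrobDatum.maximalIdeal_eq (S : FrobDatum p O) :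
    IsLocalRing.maximalIdeal O = Ideal.span {S.unif} :=
  S.unif_irreducible.maximalIdeal_eq

theorem FrobDatum.residue_unif (S : FrobDatum p O) : IsLocalRing.residue O S.unif = 0 := by
  rw [IsLocalRing.residue_eq_zero_iff, S.maximalIdeal_eq]
  exact Ideal.mem_span_singleton_self _

theorem FrobDatum.map_residue_eq_zero (S : FrobDatum p O) (g : PowerSeries O) :
    PowerSeries.map (IsLocalRing.residue O) g = 0 ↔ PowerSeries.C S.unif ∣ g := by
  constructor
  · intro h
    have h1 : ∀ n, ∃ c, PowerSeries.coeff n g = S.unif * c := by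
      intro n
      have h2 := congrArg (PowerSeries.coeff n) h
      rw [PowerSeries.coeff_map, map_zero, IsLocalRing.residue_eq_zero_iff, S.maximalIdeal_eq,
        Ideal.mem_span_singleton] at h2
      exact h2
    choose c hc using h1
    refine ⟨PowerSeries.mk c, ?_⟩
    ext n
    rw [PowerSeries.coeff_C_mul, PowerSeries.coeff_mk, hc]
  · rintro ⟨c, rfl⟩
    rw [map_mul, PowerSeries.map_C, S.residue_unif, map_zero, zero_mul]

theorem FrobDatum.ker_reduction (S : FrobDatum p O) :
    RingHom.ker (reduction O) = Ideal.span {PowerSeries.C S.unif} := by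
  ext g
  rw [RingHom.mem_ker, Ideal.mem_span_singleton, ← S.map_residue_eq_zero, reduction,
    RingHom.comp_apply, RingHom.comp_apply, map_eq_zero,
    map_eq_zero_iff _ HahnSeries.ofPowerSeries_injective]

theorem FrobDatum.map_residue_sigmaX [CharP (ResField O) p] (S : FrobDatum p O)
    (g : PowerSeries O) :
    PowerSeries.map (IsLocalRing.residue O) (S.sigmaX g) =
      PowerSeries.map (IsLocalRing.residue O) g ^ p ^ S.f := by
  have hp : CharP (PowerSeries (ResField O)) p :=
    charP_of_injective_ringHom (PowerSeries.C_injective (R := ResField O)) p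
  let ρ := PowerSeries.map (IsLocalRing.residue O)
  have hX : ρ (S.sigmaX PowerSeries.X) = PowerSeries.X ^ p ^ S.f := by
    have h := (S.map_residue_eq_zero _).2 S.sigmaX_X
    rw [map_sub, sub_eq_zero] at h
    rw [h, map_pow, PowerSeries.map_X]
  have hC : ∀ a, ρ (S.sigmaX (PowerSeries.C a)) = ρ (PowerSeries.C a) ^ p ^ S.f := by
    intro a
    have h : IsLocalRing.residue O (S.sigma a) = IsLocalRing.residue O a ^ p ^ S.f := by
      rw [← sub_eq_zero, ← map_pow, ← map_sub, IsLocalRing.residue_eq_zero_iff, S.maximalIdeal_eq,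
        Ideal.mem_span_singleton]
      exact S.sigma_spec a
    change PowerSeries.map _ _ = PowerSeries.map _ _ ^ _
    rw [S.sigmaX_C, PowerSeries.map_C, PowerSeries.map_C, h, map_pow]
  have key : ∀ n, ∀ g, PowerSeries.X ^ n ∣ ρ (S.sigmaX g) - ρ g ^ p ^ S.f := by
    intro n
    induction n with
    | zero => intro g; rw [pow_zero]; exact one_dvd _
    | succ n ih =>
      intro g
      obtain ⟨h, hh⟩ : PowerSeries.X ∣ g - PowerSeries.C (PowerSeries.constantCoeff g) := by
        rw [PowerSeries.X_dvd_iff, map_sub, PowerSeries.constantCoeff_C, sub_self]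
      have hg : g = PowerSeries.C (PowerSeries.constantCoeff g) + PowerSeries.X * h := by
        rw [← hh]; ring
      obtain ⟨d, hd⟩ := ih h
      have hq : 0 < p ^ S.f := pow_pos (Fact.out : p.Prime).pos _
      have h1 : ρ (S.sigmaX g) - ρ g ^ p ^ S.f
          = PowerSeries.X ^ p ^ S.f * (ρ (S.sigmaX h) - ρ h ^ p ^ S.f) := by
        rw [hg]
        simp only [map_add, map_mul, hC, hX]
        rw [add_pow_char_pow, mul_pow, show ρ PowerSeries.X = PowerSeries.X from PowerSeries.map_X _]
        ring
      rw [h1, hd, ← mul_assoc]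
      refine Dvd.dvd.mul_right ?_ _
      rw [pow_succ']
      exact mul_dvd_mul (dvd_pow_self _ hq.ne') dvd_rfl
  rw [← sub_eq_zero]
  ext n
  rw [map_zero]
  exact PowerSeries.X_pow_dvd_iff.1 (key (n + 1) g) n (Nat.lt_succ_self n)

theorem exists_algLift [CharZero O] [CharP (ResField O) p] (S : FrobDatum p O) :
    Nonempty (AlgLift S) := by
  have h1 : CharP (LaurentSeries (ResField O)) p :=
    charP_of_injective_ringHom (HahnSeries.C_injective (Γ := ℤ) (R := ResField O)) p
  have h2 : CharP (LaurentAlg O) p :=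
    charP_of_injective_algebraMap
      (algebraMap (LaurentSeries (ResField O)) (LaurentAlg O)).injective p
  have hp0 : (p : O) ≠ 0 := Nat.cast_ne_zero.2 (Fact.out : p.Prime).ne_zero
  obtain ⟨e, he⟩ := IsDiscreteValuationRing.associated_pow_irreducible hp0 S.unif_irreducible
  obtain ⟨A, _, _, ι, res, σ, hA1, hA2, hA3, hA4, hA5, hA6, hA7, hA8⟩ :=
    exists_unramified_lift p S.f S.f_pos (PowerSeries.C S.unif) (reduction O) S.ker_reduction
      S.sigmaX (fun g => by
        rw [reduction, RingHom.comp_apply, RingHom.comp_apply, RingHom.comp_apply,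
          RingHom.comp_apply, S.map_residue_sigmaX, map_pow, map_pow])
      (by
        rw [← map_natCast (PowerSeries.C (R := O))]
        exact fun h => hp0 (PowerSeries.C_injective (h.trans (map_zero _).symm)))
      e (by
        have := he.map (PowerSeries.C (R := O))
        rwa [map_natCast, map_pow] at this)
  exact ⟨{ carrier := A, incl := ι, red := res, frob := σ, irreducible_unif := hA2, complete := hA3,
           red_surjective := hA4, ker_red := hA5, red_incl := hA6, frob_incl := hA7,
           red_frob := hA8 }⟩

/-- The ring `Γ^alg`: the completed maximal unramified extension of the `sigmaX`-perfection of the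
completion of `O⟦x⟧[1/x]`. It is the presentation constructed in the existence proof, by a direct
limit along `sigmaX`, localization, completion, and base change from the Witt vectors of the residue
field to those of `k((x))^alg`; any other choice is uniquely isomorphic to it. -/
noncomputable def gammaAlg [CharZero O] [CharP (ResField O) p] (S : FrobDatum p O) : AlgLift S :=
  Classical.choice (exists_algLift S)

theorem AlgLift.frob_injective [CharZero O] [CharP (ResField O) p] {S : FrobDatum p O} (M : AlgLift S) :
    Function.Injective M.frob := by
  have hp0 : (p : O) ≠ 0 := Nat.cast_ne_zero.2 (Fact.out : p.Prime).ne_zero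
  obtain ⟨e, he⟩ := IsDiscreteValuationRing.associated_pow_irreducible hp0 S.unif_irreducible
  have hpA : (p : M.carrier) ≠ 0 := by
    have h := (he.map (PowerSeries.C (R := O))).map M.incl
    rw [map_natCast, map_natCast, map_pow, map_pow] at h
    exact fun h0 => pow_ne_zero e M.irreducible_unif.ne_zero
      ((associated_zero_iff_eq_zero _).1 (h0 ▸ h.symm))
  rw [injective_iff_map_eq_zero]
  intro a ha
  by_contra hne
  obtain ⟨n, u, hu⟩ := IsDiscreteValuationRing.associated_pow_irreducible hne M.irreducible_unif
  have h1 : M.frob (M.incl (PowerSeries.C S.unif)) = 0 := by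
    have h2 := congrArg M.frob hu
    rw [map_mul, ha, zero_mul, map_pow] at h2
    exact eq_zero_of_pow_eq_zero h2.symm
  have h3 := ((he.map (PowerSeries.C (R := O))).map M.incl).map M.frob
  rw [map_natCast, map_natCast, map_natCast, map_pow, map_pow, map_pow, h1] at h3
  by_cases he0 : e = 0
  · subst he0
    have h4 : IsUnit (p : O) := by
      rw [pow_zero] at he; exact associated_one_iff_isUnit.1 he
    have h5 := h4.map (IsLocalRing.residue O)
    rw [map_natCast, CharP.cast_eq_zero] at h5
    exact not_isUnit_zero h5
  · rw [zero_pow he0] at h3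
    exact hpA ((associated_zero_iff_eq_zero _).1 h3)

end Existence

section Rings

variable {p : ℕ} [Fact p.Prime] {O : Type u} [CommRing O] [IsDomain O] [IsDiscreteValuationRing O]
  [CharZero O] [CharP (ResField O) p] {S : FrobDatum p O} (M : AlgLift S)

/-- The field `Γ^alg[1/p]`. -/
abbrev AlgFrac : Type u := FractionRing M.carrier

/-- The Frobenius `σ` on `Γ^alg[1/p]`. -/
noncomputable def frobFrac : AlgFrac M →+* AlgFrac M :=
  IsFractionRing.map M.frob_injective

/-- The uniformizer `π` in `Γ^alg[1/p]`. -/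
noncomputable def unifFrac : AlgFrac M :=
  algebraMap M.carrier (AlgFrac M) (M.incl (PowerSeries.C S.unif))

/-- The variable `x` in `Γ^alg[1/p]`. -/
noncomputable def varFrac : AlgFrac M :=
  algebraMap M.carrier (AlgFrac M) (M.incl PowerSeries.X)

/-! ## Partial valuations and overconvergent rings -/

/-- `a` is a Teichmüller lift: it has a `p ^ n`-th root for every `n`. As `Γ^alg` is complete with
perfect residue field, each residue class contains exactly one such element. -/
def IsTeich (a : M.carrier) : Prop := ∀ n : ℕ, ∃ b, b ^ p ^ n = a

/-- `g = ∑ π ^ i t i`, a sum over integers `i ≫ -∞` that converges `π`-adically, in which all `t i`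
are Teichmüller lifts. Each `g` has exactly one such expansion. -/
def IsTeichExpansion (t : ℤ → M.carrier) (g : AlgFrac M) : Prop :=
  (∀ i, IsTeich M (t i)) ∧ ∃ m : ℤ, (∀ i < m, t i = 0) ∧ ∀ N : ℕ, ∃ b : M.carrier,
    g = ∑ j ∈ Finset.range N, unifFrac M ^ (m + j) * algebraMap _ (AlgFrac M) (t (m + j)) +
      unifFrac M ^ (m + N) * algebraMap _ (AlgFrac M) b

/-- The partial valuation `v_n g = min_{i ≤ n} v (x_i)` for `g = ∑ π ^ i [x_i]`; the outermost
infimum is over the one expansion of `g`. -/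
noncomputable def partialVal (n : ℤ) (g : AlgFrac M) : EReal :=
  ⨅ (t : ℤ → M.carrier) (_ : IsTeichExpansion M t g), ⨅ (i : ℤ) (_ : i ≤ n), laurentVal (M.red (t i))

open Classical in
/-- `v_{n,r} g = r v_n g + n` for `r > 0`; for `r = 0` it is `n` if `v_n g < ∞`, and `∞` if not. -/
noncomputable def partialValR (r : ℝ) (n : ℤ) (g : AlgFrac M) : EReal :=
  if r = 0 then (if partialVal M n g = ⊤ then ⊤ else ((n : ℝ) : EReal))
  else (r : EReal) * partialVal M n g + ((n : ℝ) : EReal)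

/-- `w_r g = min_n v_{n,r} g`. -/
noncomputable def wVal (r : ℝ) (g : AlgFrac M) : EReal := ⨅ n : ℤ, partialValR M r n g

/-- The elements of `Γ_r^alg[1/p]`. -/
def gammaR (r : ℝ) : Set (AlgFrac M) :=
  {g | Filter.Tendsto (fun n : ℤ => partialValR M r n g) Filter.atTop (nhds ⊤)}

/-- The elements of `Γ_con^alg[1/p]`. -/
def gammaCon : Set (AlgFrac M) := {g | ∃ r : ℝ, 0 < r ∧ g ∈ gammaR M r}

/-- `|π|` for the absolute value normalized by `|p| = 1 / p`, that is, `p ^ (-1 / e)` with the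
absolute ramification index `e`. -/
noncomputable def absUnif (S : FrobDatum p O) : ℝ :=
  (p : ℝ) ^ (-1 / (multiplicity S.unif (p : O) : ℝ))

open Classical in
/-- The norm `|g|_ρ = |π| ^ (w_r g)`, where `ρ = p ^ (-r)`. It is meaningful for `g ∈ Γ_r^alg[1/p]`.
For `ρ = 1` it is the `π`-adic absolute value. -/
noncomputable def absAt (ρ : ℝ) (g : AlgFrac M) : ℝ :=
  if wVal M (-Real.logb p ρ) g = ⊤ then 0
  else absUnif S ^ (wVal M (-Real.logb p ρ) g).toReal

/-! ## Analytic rings -/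

/-- Sequences in `Γ_r^alg[1/p]` that are Cauchy for all `w_s` with `s ∈ (0, r]`, for some
`r > 0`. -/
def IsFrechetCauchy (g : ℕ → AlgFrac M) : Prop :=
  ∃ r : ℝ, 0 < r ∧ (∀ m, g m ∈ gammaR M r) ∧ ∀ s : ℝ, 0 < s → s ≤ r → ∀ C : ℝ, ∃ N : ℕ,
    ∀ m ≥ N, ∀ n ≥ N, (C : EReal) ≤ wVal M s (g m - g n)

/-- Sequences in `Γ_r^alg[1/p]` that tend to zero for all `w_s` with `s ∈ (0, r]`, for some
`r > 0`. -/
def IsFrechetNull (g : ℕ → AlgFrac M) : Prop :=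
  ∃ r : ℝ, 0 < r ∧ (∀ m, g m ∈ gammaR M r) ∧ ∀ s : ℝ, 0 < s → s ≤ r → ∀ C : ℝ, ∃ N : ℕ,
    ∀ m ≥ N, (C : EReal) ≤ wVal M s (g m)

/-- The ring of Cauchy sequences. (These sequences are closed under the ring operations; taking the
closure adds none.) -/
def cauchyRing : Subring (ℕ → AlgFrac M) := Subring.closure {g | IsFrechetCauchy M g}

/-- The ideal of null sequences. (These sequences form an ideal; taking the span adds none.) -/
def nullIdeal : Ideal (cauchyRing M) :=
  Ideal.span {g : cauchyRing M | IsFrechetNull M (g : ℕ → AlgFrac M)}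

/-- The ring `Γ_{an,con}^alg = ⋃_{r > 0} Γ_{an,r}^alg`, where `Γ_{an,r}^alg` is the Fréchet
completion of `Γ_r^alg[1/p]` for the valuations `w_s`, `s ∈ (0, r]`: Cauchy sequences modulo null
sequences. -/
abbrev GammaAnCon : Type u := cauchyRing M ⧸ nullIdeal M

open Classical in
/-- The limit in `Γ_{an,con}^alg` of a Cauchy sequence (and `0` for other sequences). -/
noncomputable def limSeq (g : ℕ → AlgFrac M) : GammaAnCon M :=
  if h : g ∈ cauchyRing M then Ideal.Quotient.mk (nullIdeal M) ⟨g, h⟩ else 0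

/-- The inclusion of `Γ_con^alg[1/p]` into `Γ_{an,con}^alg`. -/
noncomputable def ofCon (a : AlgFrac M) : GammaAnCon M := limSeq M fun _ => a

/-- A Cauchy sequence with limit `y`. -/
noncomputable def repSeq (y : GammaAnCon M) : ℕ → AlgFrac M :=
  (Function.surjInv (Ideal.Quotient.mk_surjective (I := nullIdeal M)) y : cauchyRing M)

/-- The Frobenius `σ` on `Γ_{an,con}^alg`, extended by continuity. -/
noncomputable def frobAn (y : GammaAnCon M) : GammaAnCon M :=
  limSeq M fun m => frobFrac M (repSeq M y m)

/-- The norm `|y|_ρ` on `Γ_{an,con}^alg`, extended by continuity; it is meaningful for all `ρ < 1`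
close enough to `1`. -/
noncomputable def absAn (ρ : ℝ) (y : GammaAnCon M) : ℝ :=
  Filter.limUnder Filter.atTop fun m : ℕ => absAt M ρ (repSeq M y m)

/-- `Fil_lam Γ_{an,con}^alg`: the elements with `|y|_ρ = O((log (1 / ρ)) ^ (-lam))` as `ρ ↑ 1`. -/
def filAn (lam : ℝ) : Set (GammaAnCon M) :=
  {y | (fun ρ : ℝ => absAn M ρ y) =O[nhdsWithin 1 (Set.Iio 1)]
    fun ρ : ℝ => Real.log (1 / ρ) ^ (-lam)}

/-! ## The logarithmic extension -/

/-- `Γ_{log,an,con}^alg = Γ_{an,con}^alg[log x]`, with an indeterminate `log x`. -/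
abbrev GammaLogAnCon : Type u := Polynomial (GammaAnCon M)

/-- The series `∑_{i ≥ 1} (-1) ^ (i - 1) / i * (σ(x) / x ^ q - 1) ^ i` in `Γ_{an,con}^alg`. -/
noncomputable def logDefect : GammaAnCon M :=
  limSeq M fun m => ∑ i ∈ Finset.Icc 1 m, (-1 : AlgFrac M) ^ (i - 1) / (i : AlgFrac M) *
    (frobFrac M (varFrac M) / varFrac M ^ p ^ S.f - 1) ^ i

/-- The Frobenius on `Γ_{log,an,con}^alg`: it is `σ` on the coefficients, and sends `log x` to
`q log x + ∑_{i ≥ 1} (-1) ^ (i - 1) / i * (σ(x) / x ^ q - 1) ^ i`. -/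
noncomputable def frobLog (y : GammaLogAnCon M) : GammaLogAnCon M :=
  y.sum fun i a => Polynomial.C (frobAn M a) *
    (((p ^ S.f : ℕ) : GammaLogAnCon M) * Polynomial.X + Polynomial.C (logDefect M)) ^ i

/-- `Fil_lam Γ_{log,an,con}^alg`: for `lam ≥ 0` the direct sum of the
`Fil_{lam - i} Γ_{an,con}^alg * (log x) ^ i` over `0 ≤ i ≤ ⌊lam⌋`, and zero for `lam < 0`. -/
def filLog (lam : ℝ) : Set (GammaLogAnCon M) :=
  {y | if lam < 0 then y = 0 else
    (∀ i : ℕ, i ≤ ⌊lam⌋₊ → y.coeff i ∈ filAn M (lam - i)) ∧ ∀ i : ℕ, ⌊lam⌋₊ < i → y.coeff i = 0}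

/-- `y` is bounded, that is, it has log-growth `0`. -/
def IsBoundedLog (y : GammaLogAnCon M) : Prop := y ∈ filLog M 0

/-- `y` is exactly of log-growth `lam`, for `lam > 0`. -/
def IsExactlyOfLogGrowth (y : GammaLogAnCon M) (lam : ℝ) : Prop :=
  0 < lam ∧ y ∈ filLog M lam ∧ ∀ δ : ℝ, 0 ≤ δ → δ < lam → y ∉ filLog M δ

/-! ## Twisted polynomials and their Newton polygons -/

/-- The value `f(σ) y = ∑ a_i σ^i(y)` of the twisted polynomial `f(σ) = ∑ a_i σ^i`. -/
noncomputable def twistedEval {n : ℕ} (a : Fin (n + 1) → AlgFrac M) (y : GammaLogAnCon M) :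
    GammaLogAnCon M :=
  ∑ i : Fin (n + 1), Polynomial.C (ofCon M (a i)) * (frobLog M)^[i] y

/-- The height `-log_q |b|_1` at which a nonzero coefficient `b` is plotted. -/
noncomputable def plotHeight (b : AlgFrac M) : ℝ :=
  -Real.logb ((p ^ S.f : ℕ) : ℝ) (absAt M 1 b)

/-- The points `(i, -log_q |a_i|_1)`; a zero coefficient, plotted at height `∞`, gives none. -/
def plottedPoints {n : ℕ} (a : Fin (n + 1) → AlgFrac M) : Set (ℝ × ℝ) :=
  {P | ∃ i : Fin (n + 1), a i ≠ 0 ∧ P = ((i : ℝ), plotHeight M (a i))}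

/-- The Newton polygon of `f(σ)`, as a function: the lower boundary of the convex hull of the plotted
points. It is meaningful on the interval `[0, n]` when `a_0` and `a_n` are nonzero. -/
noncomputable def newtonPolygon {n : ℕ} (a : Fin (n + 1) → AlgFrac M) (t : ℝ) : ℝ :=
  sInf {h : ℝ | (t, h) ∈ convexHull ℝ (plottedPoints M a)}

/-- The condition `(*)`: every point `(i, -log_q |a_i|_1)`, `0 ≤ i ≤ n`, lies on the Newton
polygon. -/
def EveryPointOnNewtonPolygon {n : ℕ} (a : Fin (n + 1) → AlgFrac M) : Prop :=
  ∀ i : Fin (n + 1), a i ≠ 0 ∧ newtonPolygon M a i = plotHeight M (a i)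

/-- `μ` is a slope of `f(σ)`: the Newton polygon has slope `μ` on some nondegenerate interval in
`[0, n]`. -/
def IsNewtonSlope {n : ℕ} (a : Fin (n + 1) → AlgFrac M) (μ : ℝ) : Prop :=
  ∃ t₁ t₂ : ℝ, 0 ≤ t₁ ∧ t₁ < t₂ ∧ t₂ ≤ n ∧ ∀ t ∈ Set.Icc t₁ t₂,
    newtonPolygon M a t = newtonPolygon M a t₁ + μ * (t - t₁)

end Rings

end LogGrowth

/-!
# Log-growth of solutions of Frobenius equations

Write `ρ = p ^ (-r)`, so that `ρ ↑ 1` means `r → 0+`, and let `G(r) = max_i |y_i|_ρ r ^ (-i)` be the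
Gauss norm of `y = ∑ y_i (log x) ^ i` in which `log x` has norm `1 / r` (`gauss`). Three facts turn
the theorem into a statement about the function `G`.

* `y` lies in `Fil_lam` if and only if `G(r) = O(r ^ (-lam))` (`mem_filLog_iff`). That the degree in
  `log x` is then at most `lam` follows from the log-convexity of `r ↦ |z|_ρ`, which keeps the norms
  of a nonzero `z` away from `0` (`exists_le_normAn`).
* The Gauss norm of `σ(y)` at `r` is that of `y` at `q r` (`eventually_gauss_frobLog`): on
  coefficients because `v_n(σ(g)) = q v_n(g)`, and on `log x` because `σ(log x)` is `q log x` up to a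
  series with bounded norms, while `|q| = 1 / q`.
* An overconvergent `a ≠ 0` and its inverse satisfy `|a|_ρ ≤ |a|_1 e ^ (C r)` and
  `|a⁻¹|_ρ ≤ |a|_1⁻¹ e ^ (C r)` (`exists_normAn_ofCon_le`).

Solving `f(σ) y = 0` for its `k`-th term therefore bounds `G(q ^ k r)` by
`|a_i|_1 / |a_k|_1 e ^ (C r) G(q ^ i r)` for some `i ≠ k`. Let the `k`-th point be a vertex of the
Newton polygon, with slopes `-s'` before and `-s` after it. By convexity, each `G(x)` is at most
`q ^ (s l) G(q ^ l x)` or `q ^ (-s' l) G(q ^ (-l) x)` for some `l ≥ 1`, up to the exponential factor.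
In the second case `G` has to grow at exponent `s'` on the way from `x` to `q ^ (-l) x`; if `G`
grows at a smaller exponent, this cannot happen indefinitely, and what remains is the first case,
which gives growth of exponent at most `max s 0` (`growth_of_recursion`). So the log-growth of `y`
cannot lie strictly between the values of two adjacent edges. At the point with `k = 0` there is no
second case, which gives the initial bound; the last edge that bounds the log-growth of `y` is then
the exact one.

The properties of the partial valuations `v_n` on which the norms depend are obtained from a
description of `{g | v_n(g) ≥ γ}` as an additive group (`partialBall`, `coe_le_partialVal_iff`): it
consists, modulo `π ^ (n + 1)`, of the sums of terms `o π ^ i [z]` with `v(z) ≥ γ` and `o` in the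
`σ`-perfection of `O⟦x⟧`. The main point there is that `[z] + [w] - [z + w]` is such a sum.
-/

set_option linter.unusedSectionVars false

/-! ### The valuation on the algebraic closure of a Laurent series field -/

namespace LogGrowth

section LaurentNorm

variable (k : Type u) [Field k]

open Classical in
/-- The `x`-adic absolute value on `k((x))`, normalized by `|x| = e⁻¹`. -/
noncomputable def laurentAbs : AbsoluteValue (LaurentSeries k) ℝ where
  toFun f := if f = 0 then 0 else Real.exp (-(f.order : ℝ))
  map_mul' f g := by
    by_cases hf : f = 0
    · simp [hf]
    by_cases hg : g = 0
    · simp [hg]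
    rw [if_neg hf, if_neg hg, if_neg (mul_ne_zero hf hg), HahnSeries.order_mul hf hg,
      ← Real.exp_add]
    push_cast
    congr 1
    ring
  nonneg' f := by
    split_ifs
    · exact le_rfl
    · exact (Real.exp_pos _).le
  eq_zero' f := by
    split_ifs with h
    · simp [h]
    · simp [h, (Real.exp_pos _).ne']
  add_le' f g := by
    by_cases hf : f = 0
    · simp [hf]
    by_cases hg : g = 0
    · simp [hg]
    rw [if_neg hf, if_neg hg]
    by_cases hfg : f + g = 0
    · rw [if_pos hfg]; positivity
    rw [if_neg hfg]
    have h := HahnSeries.min_order_le_order_add hfg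
    rcases min_le_iff.1 h with h | h
    · have : Real.exp (-((f + g).order : ℝ)) ≤ Real.exp (-(f.order : ℝ)) := by
        apply Real.exp_le_exp.2
        have : (f.order : ℝ) ≤ ((f + g).order : ℝ) := by exact_mod_cast h
        linarith
      have := Real.exp_pos (-(g.order : ℝ))
      linarith
    · have : Real.exp (-((f + g).order : ℝ)) ≤ Real.exp (-(g.order : ℝ)) := by
        apply Real.exp_le_exp.2
        have : (g.order : ℝ) ≤ ((f + g).order : ℝ) := by exact_mod_cast h
        linarith
      have := Real.exp_pos (-(f.order : ℝ))
      linarith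

variable {k}

theorem laurentAbs_of_ne_zero {f : LaurentSeries k} (hf : f ≠ 0) :
    laurentAbs k f = Real.exp (-(f.order : ℝ)) := if_neg hf

theorem laurentAbs_le_iff {f : LaurentSeries k} {D : ℤ} :
    laurentAbs k f ≤ Real.exp (-(D : ℝ)) ↔ ∀ n < D, f.coeff n = 0 := by
  by_cases hf : f = 0
  · simp [hf, (Real.exp_pos _).le]
  rw [laurentAbs_of_ne_zero hf, Real.exp_le_exp, neg_le_neg_iff, Int.cast_le]
  constructor
  · intro h n hn
    exact HahnSeries.coeff_eq_zero_of_lt_order (hn.trans_le h)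
  · intro h
    by_contra hlt
    exact HahnSeries.coeff_order_eq_zero.not.2 hf (h _ (not_le.1 hlt))

theorem laurentAbs_add_le (f g : LaurentSeries k) :
    laurentAbs k (f + g) ≤ max (laurentAbs k f) (laurentAbs k g) := by
  by_cases hf : f = 0
  · simp [hf]
  by_cases hg : g = 0
  · simp [hg]
  rw [laurentAbs_of_ne_zero hf, laurentAbs_of_ne_zero hg]
  have hmax : max (Real.exp (-(f.order : ℝ))) (Real.exp (-(g.order : ℝ)))
      = Real.exp (-((min f.order g.order : ℤ) : ℝ)) := by
    rw [← Real.exp_monotone.map_max, Int.cast_min, max_neg_neg]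
  rw [hmax, laurentAbs_le_iff]
  intro n hn
  rw [HahnSeries.coeff_add, HahnSeries.coeff_eq_zero_of_lt_order (hn.trans_le (min_le_left _ _)),
    HahnSeries.coeff_eq_zero_of_lt_order (hn.trans_le (min_le_right _ _)), add_zero]

theorem exists_laurentAbs_limit (u : ℕ → LaurentSeries k)
    (hu : ∀ D : ℤ, ∃ N, ∀ m ≥ N, ∀ n ≥ N, laurentAbs k (u m - u n) ≤ Real.exp (-(D : ℝ))) :
    ∃ f, ∀ D : ℤ, ∃ N, ∀ m ≥ N, laurentAbs k (u m - f) ≤ Real.exp (-(D : ℝ)) := by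
  simp only [laurentAbs_le_iff, HahnSeries.coeff_sub, sub_eq_zero] at hu ⊢
  choose N hN using hu
  let c : ℤ → k := fun n => (u (N (n + 1))).coeff n
  -- from the `N D`-th term on, the coefficients of index below `D` do not change
  have hc : ∀ n D : ℤ, n < D → ∀ m ≥ N D, (u m).coeff n = c n := by
    intro n D hD m hm
    rw [hN D m hm (max (N D) (N (n + 1))) (le_max_left _ _) n hD,
      hN (n + 1) (max (N D) (N (n + 1))) (le_max_right _ _) (N (n + 1)) le_rfl n (by omega)]
  obtain ⟨b, hb⟩ : ∃ b : ℤ, ∀ n < b, c n = 0 := by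
    refine ⟨min 0 (u (N 0)).order, fun n hn => ?_⟩
    rw [← hc n 0 (hn.trans_le (min_le_left _ _)) (N 0) le_rfl]
    exact HahnSeries.coeff_eq_zero_of_lt_order (hn.trans_le (min_le_right _ _))
  refine ⟨HahnSeries.ofSuppBddBelow c ⟨b, fun n hn => ?_⟩, fun D => ⟨N D, fun m hm n hn => ?_⟩⟩
  · by_contra hlt
    exact hn (hb n (not_le.1 hlt))
  · exact hc n D hn m hm

theorem exists_absoluteValue_algebraicClosure (K : Type*) [NontriviallyNormedField K]
    [IsUltrametricDist K] [CompleteSpace K] : ∃ nv : AbsoluteValue (AlgebraicClosure K) ℝ,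
      (∀ z w, nv (z + w) ≤ max (nv z) (nv w)) ∧ (∀ f, nv (algebraMap K _ f) = ‖f‖) ∧
      ∀ z, nv z = ‖(minpoly K z).coeff 0‖ ^ (1 / ((minpoly K z).natDegree : ℝ)) := by
  let F := AlgebraicClosure K
  let nv : AbsoluteValue F ℝ :=
    { toFun := spectralNorm K F
      map_mul' := fun x y => spectralAlgNorm_mul x y
      nonneg' := spectralNorm_nonneg
      eq_zero' := fun x => by
        refine ⟨fun h => ?_, fun h => by rw [h, spectralNorm_zero]⟩
        by_contra hx
        exact (spectralNorm_zero_lt hx (Algebra.IsAlgebraic.isAlgebraic x)).ne' h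
      add_le' := fun x y =>
        (isNonarchimedean_spectralNorm (K := K) (L := F)).add_le spectralNorm_nonneg }
  exact ⟨nv, fun z w => isNonarchimedean_spectralNorm z w, fun f => spectralNorm_extends f,
    fun z => spectralNorm.spectralNorm_eq_norm_coeff_zero_rpow K F z⟩

theorem exists_norm_laurentAlg : ∃ nv : AbsoluteValue (AlgebraicClosure (LaurentSeries k)) ℝ,
    (∀ z w, nv (z + w) ≤ max (nv z) (nv w)) ∧
    (∀ f, nv (algebraMap (LaurentSeries k) _ f) = laurentAbs k f) ∧
    ∀ z, nv z = laurentAbs k ((minpoly (LaurentSeries k) z).coeff 0) ^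
      (1 / ((minpoly (LaurentSeries k) z).natDegree : ℝ)) := by
  let nf : NormedField (LaurentSeries k) := (laurentAbs k).toNormedField
  have hnorm : ∀ f : LaurentSeries k, ‖f‖ = laurentAbs k f := fun f => rfl
  let nnf : NontriviallyNormedField (LaurentSeries k) :=
    { nf with
      non_trivial := by
        refine ⟨HahnSeries.single (-1) 1, ?_⟩
        have h : (HahnSeries.single (-1 : ℤ) (1 : k)) ≠ 0 := by simp
        change 1 < laurentAbs k _
        rw [laurentAbs_of_ne_zero h, HahnSeries.order_single one_ne_zero]
        simp }
  have hum : IsUltrametricDist (LaurentSeries k) :=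
    IsUltrametricDist.isUltrametricDist_of_forall_norm_add_le_max_norm laurentAbs_add_le
  have hcs : @CompleteSpace (LaurentSeries k)
      nf.toMetricSpace.toPseudoMetricSpace.toUniformSpace := by
    apply Metric.complete_of_cauchySeq_tendsto
    intro u hu
    have hexp : ∀ ε : ℝ, 0 < ε → ∃ D : ℤ, Real.exp (-(D : ℝ)) < ε := by
      intro ε hε
      obtain ⟨D, hD⟩ := exists_nat_gt (-Real.log ε)
      refine ⟨D, ?_⟩
      rw [← Real.lt_log_iff_exp_lt hε]
      push_cast
      linarith
    obtain ⟨f, hf⟩ := exists_laurentAbs_limit u (fun D => by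
      obtain ⟨N, hN⟩ := Metric.cauchySeq_iff.1 hu _ (Real.exp_pos (-(D : ℝ)))
      refine ⟨N, fun m hm n hn => ?_⟩
      have := (hN m hm n hn).le
      rwa [dist_eq_norm] at this)
    refine ⟨f, Metric.tendsto_atTop.2 fun ε hε => ?_⟩
    obtain ⟨D, hD⟩ := hexp ε hε
    obtain ⟨N, hN⟩ := hf D
    refine ⟨N, fun m hm => ?_⟩
    rw [dist_eq_norm]
    exact (hN m hm).trans_lt hD
  obtain ⟨nv, h1, h2, h3⟩ := @exists_absoluteValue_algebraicClosure (LaurentSeries k) nnf hum hcs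
  exact ⟨nv, h1, h2, h3⟩

end LaurentNorm

section LaurentVal

variable {O : Type u} [CommRing O] [IsLocalRing O]

/-- The absolute value `e^{-v}` on `k((x))^alg` attached to the valuation `v` with `v(x) = 1`. -/
noncomputable def algAbs (O : Type u) [CommRing O] [IsLocalRing O] :
    AbsoluteValue (LaurentAlg O) ℝ :=
  Classical.choose (exists_norm_laurentAlg (k := ResField O))

theorem algAbs_add_le (z w : LaurentAlg O) :
    algAbs O (z + w) ≤ max (algAbs O z) (algAbs O w) :=
  (Classical.choose_spec (exists_norm_laurentAlg (k := ResField O))).1 z w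

theorem algAbs_algebraMap (f : LaurentSeries (ResField O)) :
    algAbs O (algebraMap _ _ f) = laurentAbs (ResField O) f :=
  (Classical.choose_spec (exists_norm_laurentAlg (k := ResField O))).2.1 f

/-- The defining formula of `laurentVal`, a quotient of the order of a constant coefficient, is the
formula for the spectral norm over the complete field `k((x))`. -/
theorem laurentVal_eq_neg_log {z : LaurentAlg O} (hz : z ≠ 0) :
    laurentVal z = ((-Real.log (algAbs O z) : ℝ) : EReal) := by
  have h0 : (minpoly (LaurentSeries (ResField O)) z).coeff 0 ≠ 0 :=
    minpoly.coeff_zero_ne_zero (Algebra.IsIntegral.isIntegral z) hz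
  have h := (Classical.choose_spec (exists_norm_laurentAlg (k := ResField O))).2.2 z
  change algAbs O z = _ at h
  rw [laurentVal, if_neg hz, h, laurentAbs_of_ne_zero h0, ← Real.exp_mul, Real.log_exp]
  congr 1
  ring

theorem coe_le_laurentVal_iff {z : LaurentAlg O} {c : ℝ} :
    (c : EReal) ≤ laurentVal z ↔ algAbs O z ≤ Real.exp (-c) := by
  by_cases hz : z = 0
  · simp [hz, laurentVal, (Real.exp_pos _).le]
  rw [laurentVal_eq_neg_log hz, EReal.coe_le_coe_iff, ← Real.log_le_iff_le_exp
    ((algAbs O).pos hz), le_neg]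

theorem algAbs_ofPowerSeries_le (f : PowerSeries (ResField O)) :
    algAbs O (algebraMap _ _ (HahnSeries.ofPowerSeries ℤ (ResField O) f)) ≤ 1 := by
  rw [algAbs_algebraMap]
  have := (laurentAbs_le_iff (f := HahnSeries.ofPowerSeries ℤ (ResField O) f) (D := 0)).2
    (fun n hn => by
      obtain ⟨m, rfl⟩ : ∃ m : ℕ, n = -((m + 1 : ℕ) : ℤ) := ⟨(-n - 1).toNat, by omega⟩
      have := PowerSeries.coeff_coe f (-((m + 1 : ℕ) : ℤ))
      rw [if_pos (by omega)] at this
      exact this)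
  simpa using this

theorem algAbs_reduction_le (g : PowerSeries O) : algAbs O (reduction O g) ≤ 1 :=
  algAbs_ofPowerSeries_le _

theorem algAbs_reduction_X : algAbs O (reduction O PowerSeries.X) = Real.exp (-1) := by
  rw [reduction, RingHom.comp_apply, RingHom.comp_apply, PowerSeries.map_X, algAbs_algebraMap,
    HahnSeries.ofPowerSeries_X, laurentAbs_of_ne_zero (by simp), HahnSeries.order_single one_ne_zero]
  simp

end LaurentVal

end LogGrowth

/-! ### Teichmüller lifts and the Frobenius of `Γ^alg` -/

namespace LogGrowth

section Teich

instance instCharPLaurentAlg {p : ℕ} {O : Type u} [CommRing O] [IsLocalRing O]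
    [CharP (ResField O) p] : CharP (LaurentAlg O) p :=
  have : CharP (LaurentSeries (ResField O)) p :=
    charP_of_injective_ringHom (HahnSeries.C_injective (Γ := ℤ) (R := ResField O)) p
  charP_of_injective_algebraMap
    (algebraMap (LaurentSeries (ResField O)) (LaurentAlg O)).injective p

variable {p : ℕ} [Fact p.Prime] {O : Type u} [CommRing O] [IsDomain O] [IsDiscreteValuationRing O]
  [CharP (ResField O) p] {S : FrobDatum p O} (M : AlgLift S)

/-- The uniformizer `π` in `Γ^alg`. -/
noncomputable def AlgLift.unif : M.carrier := M.incl (PowerSeries.C S.unif)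

theorem AlgLift.irreducible : Irreducible M.unif := M.irreducible_unif

theorem AlgLift.unif_ne_zero : M.unif ≠ 0 := M.irreducible.ne_zero

theorem AlgLift.red_eq_zero_iff {a : M.carrier} : M.red a = 0 ↔ M.unif ∣ a := by
  rw [← RingHom.mem_ker, M.ker_red, Ideal.mem_span_singleton, AlgLift.unif]

theorem AlgLift.red_eq_iff {a b : M.carrier} : M.red a = M.red b ↔ M.unif ∣ a - b := by
  rw [← M.red_eq_zero_iff, map_sub, sub_eq_zero]

theorem AlgLift.unif_dvd_p : M.unif ∣ (p : M.carrier) := by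
  rw [← M.red_eq_zero_iff, map_natCast, CharP.cast_eq_zero]

theorem AlgLift.eq_of_forall_dvd {a b : M.carrier} (h : ∀ n : ℕ, M.unif ^ n ∣ a - b) : a = b := by
  have := M.complete
  rw [IsHausdorff.eq_iff_smodEq (I := Ideal.span {M.incl (PowerSeries.C S.unif)})]
  intro n
  rw [SModEq.sub_mem, smul_eq_mul, Ideal.mul_top, Ideal.span_singleton_pow,
    Ideal.mem_span_singleton]
  exact h n

theorem AlgLift.dvd_pow_sub_pow {a b : M.carrier} (h : M.unif ∣ a - b) (n : ℕ) :
    M.unif ^ (n + 1) ∣ a ^ p ^ n - b ^ p ^ n := by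
  have hp : (p : M.carrier) ∈ Ideal.span {M.unif} := Ideal.mem_span_singleton.2 M.unif_dvd_p
  have := SModEq.pow_pow_add_one hp
    ((SModEq.sub_mem).2 (Ideal.mem_span_singleton.2 h)) n
  rwa [SModEq.sub_mem, Ideal.span_singleton_pow, Ideal.mem_span_singleton] at this

theorem AlgLift.exists_teich : ∃ T : LaurentAlg O →*₀ M.carrier, ∀ z, M.red (T z) = z := by
  let I : Ideal M.carrier := Ideal.span {M.unif}
  have hI : IsAdicComplete I M.carrier := M.complete
  have hker : RingHom.ker M.red = I := M.ker_red
  let e : M.carrier ⧸ I ≃+* LaurentAlg O :=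
    (Ideal.quotEquivOfEq hker.symm).trans (RingHom.quotientKerEquivOfSurjective M.red_surjective)
  have he : ∀ a, e (Ideal.Quotient.mk I a) = M.red a := fun a => rfl
  have hc : CharP (M.carrier ⧸ I) p := charP_of_injective_ringHom
    (f := (e.symm : LaurentAlg O →+* M.carrier ⧸ I)) e.symm.injective p
  refine ⟨(Perfection.teichmuller₀ p I).comp
    (MonoidWithZeroHom.ofClass (Perfection.lift p (LaurentAlg O) (M.carrier ⧸ I)
      (e.symm : LaurentAlg O →+* M.carrier ⧸ I))), fun z => ?_⟩
  rw [← he]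
  change e (Ideal.Quotient.mk I (Perfection.teichmuller₀ p I
    (Perfection.lift p (LaurentAlg O) (M.carrier ⧸ I)
      (e.symm : LaurentAlg O →+* M.carrier ⧸ I) z))) = z
  rw [Perfection.mk_teichmuller₀]
  exact e.apply_symm_apply z

/-- The Teichmüller lift `k((x))^alg → Γ^alg`. -/
noncomputable def AlgLift.teich : LaurentAlg O →*₀ M.carrier := Classical.choose M.exists_teich

@[simp]
theorem AlgLift.red_teich (z : LaurentAlg O) : M.red (M.teich z) = z :=
  Classical.choose_spec M.exists_teich z

theorem exists_pow_eq (z : LaurentAlg O) (n : ℕ) : ∃ w, w ^ p ^ n = z :=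
  IsAlgClosed.exists_pow_nat_eq z (pow_pos (Fact.out : p.Prime).pos n)

theorem pow_char_pow_injective (n : ℕ) {z w : LaurentAlg O} (h : z ^ p ^ n = w ^ p ^ n) : z = w := by
  rw [← sub_eq_zero, ← sub_pow_char_pow] at h
  exact sub_eq_zero.1 (eq_zero_of_pow_eq_zero h)

theorem AlgLift.isTeich_teich (z : LaurentAlg O) : IsTeich M (M.teich z) := by
  intro n
  obtain ⟨w, rfl⟩ := exists_pow_eq (p := p) z n
  exact ⟨M.teich w, (map_pow _ _ _).symm⟩

theorem AlgLift.eq_of_isTeich {a b : M.carrier} (ha : IsTeich M a) (hb : IsTeich M b)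
    (h : M.red a = M.red b) : a = b := by
  apply M.eq_of_forall_dvd
  intro n
  obtain ⟨a', rfl⟩ := ha n
  obtain ⟨b', rfl⟩ := hb n
  rw [map_pow, map_pow] at h
  exact (pow_dvd_pow _ n.le_succ).trans
    (M.dvd_pow_sub_pow (M.red_eq_iff.1 (pow_char_pow_injective n h)) n)

theorem AlgLift.teich_red {a : M.carrier} (ha : IsTeich M a) : M.teich (M.red a) = a :=
  M.eq_of_isTeich (M.isTeich_teich _) ha (M.red_teich _)

theorem AlgLift.frob_teich (z : LaurentAlg O) : M.frob (M.teich z) = M.teich (z ^ p ^ S.f) := by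
  refine M.eq_of_isTeich (fun n => ?_) (M.isTeich_teich _) ?_
  · obtain ⟨b, hb⟩ := M.isTeich_teich z n
    exact ⟨M.frob b, by rw [← map_pow, hb]⟩
  · rw [M.red_frob, M.red_teich, M.red_teich]

/-- `σ` maps `π` to a unit multiple of `π`: it fixes `p`, an associate of a power of `π`. -/
theorem FrobDatum.associated_sigma_unif [CharZero O] (S : FrobDatum p O) :
    Associated (S.sigma S.unif) S.unif := by
  have hp0 : (p : O) ≠ 0 := Nat.cast_ne_zero.2 (Fact.out : p.Prime).ne_zero
  obtain ⟨e, he⟩ := IsDiscreteValuationRing.associated_pow_irreducible hp0 S.unif_irreducible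
  have he0 : e ≠ 0 := by
    rintro rfl
    rw [pow_zero] at he
    have h5 := (associated_one_iff_isUnit.1 he).map (IsLocalRing.residue O)
    rw [map_natCast, CharP.cast_eq_zero] at h5
    exact not_isUnit_zero h5
  obtain ⟨c, hc⟩ : S.unif ∣ S.sigma S.unif := by
    have h := S.sigma_spec S.unif
    rwa [dvd_sub_left (dvd_pow_self _ (pow_ne_zero _ (Fact.out : p.Prime).ne_zero))] at h
  have h1 : Associated (S.unif ^ e) (S.sigma S.unif ^ e) := by
    have h2 := he.map S.sigma
    rw [map_natCast, map_pow] at h2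
    exact he.symm.trans h2
  obtain ⟨w, hw⟩ := h1
  rw [hc, mul_pow] at hw
  have h3 : (w : O) = c ^ e := mul_left_cancel₀ (pow_ne_zero e S.unif_irreducible.ne_zero) hw
  have h4 : IsUnit c := by rw [← isUnit_pow_iff he0, ← h3]; exact w.isUnit
  exact Associated.symm ⟨h4.unit, hc.symm⟩

/-- `π` and `σ(π)` differ by a unit of `O`. -/
theorem AlgLift.exists_frob_unif [CharZero O] :
    ∃ w : Oˣ, M.frob M.unif = M.unif * M.incl (PowerSeries.C (w : O)) := by
  obtain ⟨w, hw⟩ := S.associated_sigma_unif.symm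
  refine ⟨w, ?_⟩
  rw [AlgLift.unif, M.frob_incl, S.sigmaX_C, ← hw, map_mul, map_mul]

theorem AlgLift.frob_surjective [CharZero O] : Function.Surjective M.frob := by
  let I : Ideal M.carrier := Ideal.span {M.unif}
  have hI : IsAdicComplete I M.carrier := M.complete
  obtain ⟨w, hw⟩ := M.exists_frob_unif
  have hu : IsUnit (M.incl (PowerSeries.C (w : O))) := (w.isUnit.map PowerSeries.C).map M.incl
  have hmap : I.map M.frob = I := by
    rw [Ideal.map_span, Set.image_singleton, hw, Ideal.span_singleton_mul_right_unit hu]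
  have hh : IsHausdorff (I.map M.frob) M.carrier := by rw [hmap]; infer_instance
  refine surjective_of_mk_map_comp_surjective (I := I) M.frob fun y => ?_
  obtain ⟨y, rfl⟩ := Ideal.Quotient.mk_surjective y
  obtain ⟨z, hz⟩ := exists_pow_eq (p := p) (M.red y) S.f
  refine ⟨M.teich z, ?_⟩
  rw [RingHom.comp_apply, Ideal.Quotient.mk_eq_mk_iff_sub_mem, hmap, Ideal.mem_span_singleton,
    ← M.red_eq_iff, M.red_frob, M.red_teich, hz]

theorem AlgLift.frob_pow_mem_range {i : ℕ} {a : M.carrier} (h : (M.frob ^ i) a ∈ M.incl.range)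
    (j : ℕ) : (M.frob ^ (j + i)) a ∈ M.incl.range := by
  induction j with
  | zero => rwa [zero_add]
  | succ j ih =>
    obtain ⟨g, hg⟩ := ih
    refine ⟨S.sigmaX g, ?_⟩
    rw [show j + 1 + i = (j + i) + 1 by omega, pow_succ', RingHom.mul_def, RingHom.comp_apply,
      ← hg, M.frob_incl]

/-- The `σ`-perfection of the image of `O⟦x⟧` in `Γ^alg`: the elements that some power of `σ` maps
into that image. -/
noncomputable def AlgLift.perf : Subring M.carrier where
  carrier := {a | ∃ j : ℕ, (M.frob ^ j) a ∈ M.incl.range}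
  mul_mem' := by
    rintro a b ⟨i, hi⟩ ⟨j, hj⟩
    refine ⟨i + j, ?_⟩
    rw [map_mul]
    exact mul_mem (add_comm i j ▸ M.frob_pow_mem_range hi j) (M.frob_pow_mem_range hj i)
  one_mem' := ⟨0, by rw [map_one]; exact one_mem _⟩
  zero_mem' := ⟨0, by rw [map_zero]; exact zero_mem _⟩
  add_mem' := by
    rintro a b ⟨i, hi⟩ ⟨j, hj⟩
    refine ⟨i + j, ?_⟩
    rw [map_add]
    exact add_mem (add_comm i j ▸ M.frob_pow_mem_range hi j) (M.frob_pow_mem_range hj i)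
  neg_mem' := by
    rintro a ⟨i, hi⟩
    exact ⟨i, by rw [map_neg]; exact neg_mem hi⟩

theorem AlgLift.incl_mem_perf (g : PowerSeries O) : M.incl g ∈ M.perf := ⟨0, g, rfl⟩

theorem AlgLift.frob_mem_perf_iff {a : M.carrier} : M.frob a ∈ M.perf ↔ a ∈ M.perf := by
  constructor
  · rintro ⟨j, hj⟩
    exact ⟨j + 1, by rwa [pow_succ]⟩
  · rintro ⟨j, g, hg⟩
    refine ⟨j, S.sigmaX g, ?_⟩
    rw [← M.frob_incl, hg]
    have : M.frob * M.frob ^ j = M.frob ^ j * M.frob := (Commute.refl M.frob).pow_right j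
    exact congrArg (fun t : M.carrier →+* M.carrier => t a) this

theorem AlgLift.algAbs_red_le_of_mem_perf {a : M.carrier} (ha : a ∈ M.perf) :
    algAbs O (M.red a) ≤ 1 := by
  obtain ⟨j, g, hg⟩ := ha
  have hred : ∀ j : ℕ, M.red ((M.frob ^ j) a) = M.red a ^ (p ^ S.f) ^ j := by
    intro j
    induction j with
    | zero => simp
    | succ j ih =>
      rw [pow_succ', RingHom.mul_def, RingHom.comp_apply, M.red_frob, ih, ← pow_mul, ← pow_succ]
  have h := algAbs_reduction_le g
  rw [← M.red_incl, hg, hred, map_pow] at h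
  by_contra hlt
  have hq : (p ^ S.f) ^ j ≠ 0 := pow_ne_zero _ (pow_ne_zero _ (Fact.out : p.Prime).ne_zero)
  exact absurd h (not_le.2 (one_lt_pow₀ (not_le.1 hlt) hq))

variable [CharZero O]

/-- Modulo `π`, `σ` is the `q`-th power map on `perf`, with quotients in `perf`. -/
theorem AlgLift.exists_frob_sub_pow {a : M.carrier} (ha : a ∈ M.perf) :
    ∃ b ∈ M.perf, M.frob a - a ^ p ^ S.f = M.unif * b := by
  obtain ⟨j, g, hg⟩ := ha
  obtain ⟨b, hb⟩ : M.unif ∣ M.frob a - a ^ p ^ S.f := by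
    rw [← M.red_eq_iff, M.red_frob, map_pow]
  refine ⟨b, ⟨j, ?_⟩, hb⟩
  obtain ⟨h, hh⟩ : PowerSeries.C S.unif ∣ S.sigmaX g - g ^ p ^ S.f := by
    rw [← S.map_residue_eq_zero, map_sub, S.map_residue_sigmaX, map_pow, sub_self]
  have hu : ∀ j : ℕ, ∃ w : Oˣ, (M.frob ^ j) M.unif = M.unif * M.incl (PowerSeries.C (w : O)) := by
    intro j
    induction j with
    | zero => exact ⟨1, by simp⟩
    | succ j ih =>
      obtain ⟨w, hw⟩ := ih
      obtain ⟨w', hw'⟩ := M.exists_frob_unif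
      refine ⟨w' * Units.map S.sigma.toMonoidHom w, ?_⟩
      rw [pow_succ', RingHom.mul_def, RingHom.comp_apply, hw, map_mul, hw', M.frob_incl, S.sigmaX_C,
        Units.val_mul, map_mul, map_mul, mul_assoc]
      rfl
  obtain ⟨w, hw⟩ := hu j
  have hcomm : (M.frob ^ j) (M.frob a) = M.frob ((M.frob ^ j) a) := by
    have : M.frob ^ j * M.frob = M.frob * M.frob ^ j := ((Commute.refl M.frob).pow_right j).symm
    exact congrArg (fun t : M.carrier →+* M.carrier => t a) this
  have h1 := congrArg (M.frob ^ j) hb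
  rw [map_sub, hcomm, ← hg, map_pow, ← hg, M.frob_incl, ← map_pow, ← map_sub, hh, map_mul,
    map_mul, hw, mul_assoc] at h1
  have h2 := mul_left_cancel₀ M.unif_ne_zero h1
  refine ⟨PowerSeries.C ((w⁻¹ : Oˣ) : O) * h, ?_⟩
  rw [map_mul, h2, ← mul_assoc, ← map_mul, ← map_mul, Units.inv_mul, map_one, map_one, one_mul]

/-- An element of `perf` is congruent modulo `π` to its Teichmüller lift, with quotients in `perf`
up to arbitrarily small errors. The reason is that `a = σ^m(a_m) ≡ a_m ^ (q ^ m)` modulo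
`π · perf`, whereas `a_m ^ (q ^ m)` tends to the Teichmüller lift. -/
theorem AlgLift.exists_sub_teich {a : M.carrier} (ha : a ∈ M.perf) (N : ℕ) :
    ∃ b ∈ M.perf, ∃ c, a - M.teich (M.red a) = M.unif * b + M.unif ^ N * c := by
  have hq : 0 < p ^ S.f := pow_pos (Fact.out : p.Prime).pos _
  have key : ∀ m : ℕ, ∀ a ∈ M.perf, ∃ a' ∈ M.perf, ∃ b ∈ M.perf,
      a = a' ^ (p ^ S.f) ^ m + M.unif * b := by
    intro m
    induction m with
    | zero => exact fun a ha => ⟨a, ha, 0, zero_mem _, by simp⟩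
    | succ m ih =>
      intro a ha
      obtain ⟨a₁, ha₁, b₁, hb₁, h₁⟩ := ih a ha
      obtain ⟨a₂, rfl⟩ := M.frob_surjective a₁
      have ha₂ := M.frob_mem_perf_iff.1 ha₁
      obtain ⟨b₂, hb₂, h₂⟩ := M.exists_frob_sub_pow ha₂
      obtain ⟨d, hd⟩ : ∃ d : M.perf, M.frob a₂ ^ (p ^ S.f) ^ m - (a₂ ^ p ^ S.f) ^ (p ^ S.f) ^ m
          = (M.frob a₂ - a₂ ^ p ^ S.f) * d := by
        have h3 := sub_dvd_pow_sub_pow (⟨M.frob a₂, ha₁⟩ : M.perf) (⟨a₂, ha₂⟩ ^ p ^ S.f)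
          ((p ^ S.f) ^ m)
        obtain ⟨d, hd⟩ := h3
        exact ⟨d, congrArg Subtype.val hd⟩
      refine ⟨a₂, ha₂, b₁ + b₂ * d, add_mem hb₁ (mul_mem hb₂ d.2), ?_⟩
      rw [h₂] at hd
      rw [h₁, pow_succ', pow_mul]
      linear_combination hd
  obtain ⟨a', ha', b, hb, h⟩ := key N a ha
  rw [← pow_mul] at h
  refine ⟨b, hb, ?_⟩
  have h1 : M.red a = M.red a' ^ p ^ (S.f * N) := by
    rw [h, map_add, map_mul, M.red_eq_zero_iff.2 dvd_rfl, zero_mul, add_zero, map_pow]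
  have h2 := M.dvd_pow_sub_pow (M.red_eq_iff.1 (M.red_teich (M.red a')).symm) (S.f * N)
  have hN : N ≤ S.f * N + 1 := (Nat.le_mul_of_pos_left N S.f_pos).trans (Nat.le_succ _)
  obtain ⟨c, hc⟩ := (pow_dvd_pow _ hN).trans h2
  refine ⟨c, ?_⟩
  rw [h1, map_pow, ← hc]
  linear_combination h

end Teich

end LogGrowth

/-! ### Partial valuations through sums of Teichmüller lifts -/

namespace LogGrowth

section Partial

variable {p : ℕ} [Fact p.Prime] {O : Type u} [CommRing O] [IsDomain O] [IsDiscreteValuationRing O]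
  [CharZero O] [CharP (ResField O) p] {S : FrobDatum p O} (M : AlgLift S)

/-- The finite sums of products `o [z]` with `o` in `perf` and `|z| ≤ c`. -/
noncomputable def AlgLift.teichSums (c : ℝ) : AddSubgroup M.carrier :=
  AddSubgroup.closure {a | ∃ o ∈ M.perf, ∃ z, algAbs O z ≤ c ∧ a = o * M.teich z}

variable {M} {c d : ℝ}

theorem AlgLift.mul_teich_mem {o : M.carrier} (ho : o ∈ M.perf) {z : LaurentAlg O}
    (hz : algAbs O z ≤ c) : o * M.teich z ∈ M.teichSums c :=
  AddSubgroup.subset_closure ⟨o, ho, z, hz, rfl⟩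

theorem AlgLift.teich_mem {z : LaurentAlg O} (hz : algAbs O z ≤ c) : M.teich z ∈ M.teichSums c := by
  have := M.mul_teich_mem (one_mem M.perf) hz
  rwa [one_mul] at this

theorem AlgLift.teichSums_mono (h : c ≤ d) : M.teichSums c ≤ M.teichSums d :=
  AddSubgroup.closure_mono fun _ ⟨o, ho, z, hz, e⟩ => ⟨o, ho, z, hz.trans h, e⟩

theorem AlgLift.mul_mem_teichSums {o : M.carrier} (ho : o ∈ M.perf) {w : LaurentAlg O}
    (hw : algAbs O w ≤ d) {b : M.carrier} (hb : b ∈ M.teichSums c) :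
    o * M.teich w * b ∈ M.teichSums (d * c) := by
  induction hb using AddSubgroup.closure_induction with
  | mem a ha =>
    obtain ⟨o', ho', z, hz, rfl⟩ := ha
    have h : algAbs O (w * z) ≤ d * c := by
      rw [map_mul]
      exact mul_le_mul hw hz ((algAbs O).nonneg _) (((algAbs O).nonneg _).trans hw)
    have := M.mul_teich_mem (mul_mem ho ho') h
    rw [map_mul] at this
    convert this using 1
    ring
  | zero => rw [mul_zero]; exact zero_mem _
  | add x y _ _ hx hy => rw [mul_add]; exact add_mem hx hy
  | neg x _ hx => rw [mul_neg]; exact neg_mem hx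

theorem AlgLift.perf_mul_mem_teichSums {o : M.carrier} (ho : o ∈ M.perf) {b : M.carrier}
    (hb : b ∈ M.teichSums c) : o * b ∈ M.teichSums c := by
  have := M.mul_mem_teichSums ho (w := 1) (d := 1) (by rw [map_one]) hb
  rwa [map_one, mul_one, one_mul] at this

theorem AlgLift.unif_mem_perf : M.unif ∈ M.perf := M.incl_mem_perf _

theorem AlgLift.unif_pow_mul_mem (n : ℕ) {b : M.carrier} (hb : b ∈ M.teichSums c) :
    M.unif ^ n * b ∈ M.teichSums c :=
  M.perf_mul_mem_teichSums (pow_mem M.unif_mem_perf n) hb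

theorem AlgLift.algAbs_red_le {b : M.carrier} (hc : 0 ≤ c) (hb : b ∈ M.teichSums c) :
    algAbs O (M.red b) ≤ c := by
  induction hb using AddSubgroup.closure_induction with
  | mem a ha =>
    obtain ⟨o, ho, z, hz, rfl⟩ := ha
    rw [map_mul, M.red_teich, map_mul]
    have := mul_le_mul (M.algAbs_red_le_of_mem_perf ho) hz ((algAbs O).nonneg _) zero_le_one
    rwa [one_mul] at this
  | zero => rwa [map_zero, map_zero]
  | add x y _ _ hx hy =>
    rw [map_add]
    exact (algAbs_add_le _ _).trans (max_le hx hy)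
  | neg x _ hx =>
    rw [map_neg, AbsoluteValue.map_neg]
    exact hx

variable (M) in
/-- Teichmüller lifts are additive modulo `π`, with a defect of the same size: the lift of `a + b`
is the limit of `([a^{1/p^N}] + [b^{1/p^N}]) ^ (p^N)`, in which all mixed binomial coefficients are
divisible by `p`. -/
theorem AlgLift.exists_teich_add {a b : LaurentAlg O} (ha : algAbs O a ≤ c) (hb : algAbs O b ≤ c)
    (N : ℕ) : ∃ x ∈ M.teichSums c, ∃ y,
      M.teich a + M.teich b - M.teich (a + b) = M.unif * x + M.unif ^ N * y := by
  have hp : 0 < p ^ N := pow_pos (Fact.out : p.Prime).pos N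
  obtain ⟨a', rfl⟩ := exists_pow_eq (p := p) a N
  obtain ⟨b', rfl⟩ := exists_pow_eq (p := p) b N
  have h1 : M.unif ^ N ∣ M.teich (a' ^ p ^ N + b' ^ p ^ N) - (M.teich a' + M.teich b') ^ p ^ N := by
    rw [← add_pow_char_pow, map_pow]
    refine (pow_dvd_pow _ N.le_succ).trans (M.dvd_pow_sub_pow (M.red_eq_iff.1 ?_) N)
    rw [M.red_teich, map_add M.red, M.red_teich, M.red_teich]
  obtain ⟨y, hy⟩ := h1
  have hc : 0 ≤ c := ((algAbs O).nonneg _).trans ha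
  have hmono : ∀ i ≤ p ^ N, algAbs O (a' ^ i * b' ^ (p ^ N - i)) ≤ c := by
    intro i hi
    rw [map_mul, map_pow, map_pow]
    rw [map_pow] at ha hb
    have hm : max (algAbs O a') (algAbs O b') ^ p ^ N ≤ c := by
      rcases max_cases (algAbs O a') (algAbs O b') with h | h <;> rw [h.1] <;> assumption
    refine le_trans ?_ hm
    calc algAbs O a' ^ i * algAbs O b' ^ (p ^ N - i)
        ≤ max (algAbs O a') (algAbs O b') ^ i * max (algAbs O a') (algAbs O b') ^ (p ^ N - i) := by
          have h := (algAbs O).nonneg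
          exact mul_le_mul (pow_le_pow_left₀ (h _) (le_max_left _ _) _)
            (pow_le_pow_left₀ (h _) (le_max_right _ _) _) (pow_nonneg (h _) _)
            (pow_nonneg (le_max_of_le_left (h _)) _)
      _ = _ := by rw [← pow_add, Nat.add_sub_cancel' hi]
  -- the mixed terms of the binomial expansion
  have h2 : ∃ x ∈ M.teichSums c, (M.teich a' + M.teich b') ^ p ^ N
      = M.teich (a' ^ p ^ N) + M.teich (b' ^ p ^ N) - M.unif * x := by
    obtain ⟨v, hv⟩ := M.unif_dvd_p (p := p)
    obtain ⟨e, he⟩ : S.unif ∣ (p : O) := by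
      rw [← Ideal.mem_span_singleton, ← S.maximalIdeal_eq, ← IsLocalRing.residue_eq_zero_iff,
        map_natCast, CharP.cast_eq_zero]
    have hpe : (p : M.carrier) = M.unif * M.incl (PowerSeries.C e) := by
      rw [AlgLift.unif, ← map_mul, ← map_mul, ← he, map_natCast, map_natCast]
    obtain ⟨m, hm⟩ : ∃ m, p ^ N = m + 1 := ⟨p ^ N - 1, by omega⟩
    have hch : ∀ i ∈ Finset.range m, ∃ x ∈ M.teichSums c,
        M.teich a' ^ (i + 1) * M.teich b' ^ (m + 1 - (i + 1)) * ((m + 1).choose (i + 1) : M.carrier)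
          = M.unif * x := by
      intro i hi
      rw [Finset.mem_range] at hi
      obtain ⟨l, hl⟩ := (Fact.out : p.Prime).dvd_choose_pow (n := N) (k := i + 1) (by omega)
        (by omega)
      rw [hm] at hl
      refine ⟨(l * M.incl (PowerSeries.C e)) * M.teich (a' ^ (i + 1) * b' ^ (m + 1 - (i + 1))),
        M.mul_teich_mem (mul_mem (natCast_mem _ _) (M.incl_mem_perf _)) ?_, ?_⟩
      · have := hmono (i + 1) (by omega)
        rwa [hm] at this
      · rw [hl, Nat.cast_mul, hpe, map_mul, map_pow, map_pow]
        ring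
    choose! x hx hxe using hch
    refine ⟨-∑ i ∈ Finset.range m, x i, neg_mem (sum_mem hx), ?_⟩
    rw [hm, add_pow, Finset.sum_range_succ, Finset.sum_range_succ', Finset.sum_congr rfl hxe,
      ← Finset.mul_sum]
    simp only [map_pow, pow_zero, Nat.choose_zero_right, Nat.choose_self, Nat.sub_self, Nat.sub_zero,
      Nat.cast_one]
    ring
  obtain ⟨x, hx, hxe⟩ := h2
  refine ⟨x, hx, -y, ?_⟩
  rw [hxe] at hy
  linear_combination -hy

variable (M) in
/-- The division step: an element of `teichSums c` is the Teichmüller lift of its reduction, up to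
`π` times an element of `teichSums c`. -/
theorem AlgLift.exists_sub_teich_red {b : M.carrier} (hc : 0 ≤ c) (hb : b ∈ M.teichSums c) (N : ℕ) :
    ∃ x ∈ M.teichSums c, ∃ y, b - M.teich (M.red b) = M.unif * x + M.unif ^ N * y := by
  have hb' := hb
  induction hb using AddSubgroup.closure_induction with
  | mem a ha =>
    obtain ⟨o, ho, z, hz, rfl⟩ := ha
    obtain ⟨b, hb, y, h⟩ := M.exists_sub_teich ho N
    refine ⟨b * M.teich z, M.mul_teich_mem hb hz, y * M.teich z, ?_⟩
    rw [map_mul, M.red_teich, map_mul]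
    linear_combination M.teich z * h
  | zero => exact ⟨0, zero_mem _, 0, by simp⟩
  | add x y hx hy ihx ihy =>
    obtain ⟨x₁, hx₁, x₂, h₁⟩ := ihx hx
    obtain ⟨y₁, hy₁, y₂, h₂⟩ := ihy hy
    obtain ⟨z₁, hz₁, z₂, h₃⟩ := M.exists_teich_add (M.algAbs_red_le hc hx) (M.algAbs_red_le hc hy) N
    refine ⟨x₁ + y₁ + z₁, add_mem (add_mem hx₁ hy₁) hz₁, x₂ + y₂ + z₂, ?_⟩
    rw [map_add]
    linear_combination h₁ + h₂ + h₃
  | neg x hx ih =>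
    obtain ⟨x₁, hx₁, x₂, h₁⟩ := ih hx
    have hr := M.algAbs_red_le hc hx
    obtain ⟨z₁, hz₁, z₂, h₃⟩ := M.exists_teich_add hr (b := -M.red x)
      (by rwa [AbsoluteValue.map_neg]) N
    rw [add_neg_cancel, map_zero, sub_zero] at h₃
    refine ⟨-x₁ - z₁, sub_mem (neg_mem hx₁) hz₁, -x₂ - z₂, ?_⟩
    rw [map_neg]
    linear_combination -h₁ - h₃

theorem AlgLift.frob_mem_teichSums {b : M.carrier} (hb : b ∈ M.teichSums c) :
    M.frob b ∈ M.teichSums (c ^ p ^ S.f) := by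
  induction hb using AddSubgroup.closure_induction with
  | mem a ha =>
    obtain ⟨o, ho, z, hz, rfl⟩ := ha
    rw [map_mul, M.frob_teich]
    refine M.mul_teich_mem (M.frob_mem_perf_iff.2 ho) ?_
    rw [map_pow]
    exact pow_le_pow_left₀ ((algAbs O).nonneg _) hz _
  | zero => rw [map_zero]; exact zero_mem _
  | add x y _ _ hx hy => rw [map_add]; exact add_mem hx hy
  | neg x _ hx => rw [map_neg]; exact neg_mem hx

theorem AlgLift.exists_frob_eq_of_mem_teichSums (hc : 0 ≤ c) {b : M.carrier}
    (hb : b ∈ M.teichSums (c ^ p ^ S.f)) : ∃ b' ∈ M.teichSums c, M.frob b' = b := by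
  induction hb using AddSubgroup.closure_induction with
  | mem a ha =>
    obtain ⟨o, ho, z, hz, rfl⟩ := ha
    obtain ⟨o, rfl⟩ := M.frob_surjective o
    obtain ⟨z, rfl⟩ := exists_pow_eq (p := p) z S.f
    rw [map_pow] at hz
    refine ⟨o * M.teich z, M.mul_teich_mem (M.frob_mem_perf_iff.1 ho) ?_, ?_⟩
    · exact (pow_le_pow_iff_left₀ ((algAbs O).nonneg _) hc
        (pow_ne_zero _ (Fact.out : p.Prime).ne_zero)).1 hz
    · rw [map_mul, M.frob_teich]
  | zero => exact ⟨0, zero_mem _, map_zero _⟩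
  | add x y _ _ hx hy =>
    obtain ⟨x', hx', rfl⟩ := hx
    obtain ⟨y', hy', rfl⟩ := hy
    exact ⟨x' + y', add_mem hx' hy', map_add _ _ _⟩
  | neg x _ hx =>
    obtain ⟨x', hx', rfl⟩ := hx
    exact ⟨-x', neg_mem hx', map_neg _ _⟩

variable (M)

/-- The inclusion of `Γ^alg` into `Γ^alg[1/p]`. -/
noncomputable abbrev AlgLift.toFrac : M.carrier →+* AlgFrac M := algebraMap M.carrier (AlgFrac M)

theorem unifFrac_eq : unifFrac M = M.toFrac M.unif := rfl

theorem unifFrac_ne_zero : unifFrac M ≠ 0 := by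
  rw [unifFrac_eq, Ne, FaithfulSMul.algebraMap_eq_zero_iff]
  exact M.unif_ne_zero

theorem AlgLift.toFrac_injective : Function.Injective M.toFrac :=
  IsFractionRing.injective M.carrier (AlgFrac M)

theorem unifFrac_zpow_natCast (n : ℕ) : unifFrac M ^ (n : ℤ) = M.toFrac (M.unif ^ n) := by
  rw [zpow_natCast, unifFrac_eq, map_pow]

theorem unifFrac_zpow_of_le {i j : ℤ} (h : i ≤ j) :
    unifFrac M ^ j = unifFrac M ^ i * M.toFrac (M.unif ^ (j - i).toNat) := by
  rw [← unifFrac_zpow_natCast, ← zpow_add₀ (unifFrac_ne_zero M)]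
  congr 1
  omega

theorem exists_eq_zpow_mul (g : AlgFrac M) : ∃ (m : ℤ) (a : M.carrier),
    g = unifFrac M ^ m * M.toFrac a := by
  obtain ⟨a, b, hb, rfl⟩ := IsFractionRing.div_surjective (A := M.carrier) g
  have hb0 : b ≠ 0 := nonZeroDivisors.ne_zero hb
  obtain ⟨n, u, hu⟩ := IsDiscreteValuationRing.eq_unit_mul_pow_irreducible hb0 M.irreducible
  refine ⟨-n, a * u⁻¹.1, ?_⟩
  have hu0 : M.toFrac (u : M.carrier) ≠ 0 := by
    rw [Ne, FaithfulSMul.algebraMap_eq_zero_iff]; exact u.ne_zero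
  have h1 : M.toFrac u⁻¹.1 = (M.toFrac u)⁻¹ := by
    refine eq_inv_of_mul_eq_one_left ?_
    rw [← map_mul, Units.inv_mul, map_one]
  rw [hu, map_mul, map_mul, h1, zpow_neg, unifFrac_zpow_natCast]
  field_simp

/-- The elements `g` with `v_n(g) ≥ -log c`, described as the finite sums of terms `o π^i [z]` with
`o` in `perf` and `|z| ≤ c`, up to elements of `π^{n+1} Γ^alg`. -/
noncomputable def partialBall (n : ℤ) (c : ℝ) : AddSubgroup (AlgFrac M) where
  carrier := {g | ∃ k : ℕ, ∃ b ∈ M.teichSums c, ∃ a,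
    g = unifFrac M ^ (-(k : ℤ)) * M.toFrac b + unifFrac M ^ (n + 1) * M.toFrac a}
  zero_mem' := ⟨0, 0, zero_mem _, 0, by simp⟩
  neg_mem' := by
    rintro _ ⟨k, b, hb, a, rfl⟩
    exact ⟨k, -b, neg_mem hb, -a, by rw [map_neg, map_neg]; ring⟩
  add_mem' := by
    rintro _ _ ⟨k, b, hb, a, rfl⟩ ⟨k', b', hb', a', rfl⟩
    refine ⟨k + k', M.unif ^ k' * b + M.unif ^ k * b',
      add_mem (M.unif_pow_mul_mem _ hb) (M.unif_pow_mul_mem _ hb'), a + a', ?_⟩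
    have h1 : unifFrac M ^ (-(k : ℤ))
        = unifFrac M ^ (-((k + k' : ℕ) : ℤ)) * M.toFrac (M.unif ^ k') := by
      rw [← unifFrac_zpow_natCast, ← zpow_add₀ (unifFrac_ne_zero M)]
      congr 1; push_cast; ring
    have h2 : unifFrac M ^ (-(k' : ℤ))
        = unifFrac M ^ (-((k + k' : ℕ) : ℤ)) * M.toFrac (M.unif ^ k) := by
      rw [← unifFrac_zpow_natCast, ← zpow_add₀ (unifFrac_ne_zero M)]
      congr 1; push_cast; ring
    rw [h1, h2, map_add, map_add, map_mul, map_mul]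
    ring

variable {M}

theorem zpow_mul_mem_partialBall {n : ℤ} (i : ℤ) {b : M.carrier} (hb : b ∈ M.teichSums c) :
    unifFrac M ^ i * M.toFrac b ∈ partialBall M n c := by
  refine ⟨(-i).toNat, M.unif ^ i.toNat * b, M.unif_pow_mul_mem _ hb, 0, ?_⟩
  rw [map_zero, mul_zero, add_zero, map_mul, ← mul_assoc, ← unifFrac_zpow_natCast,
    ← zpow_add₀ (unifFrac_ne_zero M)]
  congr 2
  omega

theorem zpow_mul_mem_partialBall_of_lt {n i : ℤ} (h : n < i) (a : M.carrier) :
    unifFrac M ^ i * M.toFrac a ∈ partialBall M n c := by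
  refine ⟨0, 0, zero_mem _, M.unif ^ (i - (n + 1)).toNat * a, ?_⟩
  rw [map_zero, mul_zero, zero_add, map_mul, ← mul_assoc,
    ← unifFrac_zpow_of_le M (show n + 1 ≤ i from h)]

theorem partialBall_mono {n : ℤ} (h : c ≤ d) : partialBall M n c ≤ partialBall M n d :=
  fun _ ⟨k, b, hb, a, e⟩ => ⟨k, b, M.teichSums_mono h hb, a, e⟩

theorem partialBall_anti {m n : ℤ} (h : m ≤ n) : partialBall M n c ≤ partialBall M m c := by
  rintro _ ⟨k, b, hb, a, rfl⟩
  exact add_mem (zpow_mul_mem_partialBall _ hb) (zpow_mul_mem_partialBall_of_lt (by omega) a)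

/-- The leading terms of an element of `partialBall` that cancel can be removed. -/
theorem exists_eq_of_mem_partialBall (hc : 0 ≤ c) {n i : ℤ} (hi : i ≤ n + 1) {a₀ : M.carrier}
    (h : unifFrac M ^ i * M.toFrac a₀ ∈ partialBall M n c) :
    ∃ b ∈ M.teichSums c, ∃ a, a₀ = b + M.unif ^ (n + 1 - i).toNat * a := by
  have hϖ := unifFrac_ne_zero M
  have key : ∀ d : ℕ, ∀ b ∈ M.teichSums c, ∀ a,
      M.unif ^ d * a₀ = b + M.unif ^ (d + (n + 1 - i).toNat) * a →
      ∃ b ∈ M.teichSums c, ∃ a, a₀ = b + M.unif ^ (n + 1 - i).toNat * a := by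
    intro d
    induction d with
    | zero =>
      intro b hb a h
      exact ⟨b, hb, a, by simpa using h⟩
    | succ d ih =>
      intro b hb a h
      have hb0 : M.red b = 0 := by
        rw [M.red_eq_zero_iff]
        have h1 : M.unif ∣ M.unif ^ (d + 1) * a₀ := (dvd_pow_self _ (by omega)).mul_right _
        rw [h] at h1
        exact (dvd_add_left ((dvd_pow_self _ (by omega)).mul_right _)).1 h1
      obtain ⟨x, hx, y, hxy⟩ := M.exists_sub_teich_red hc hb (d + 1 + (n + 1 - i).toNat)
      rw [hb0, map_zero, sub_zero] at hxy
      refine ih x hx (y + a) (mul_left_cancel₀ M.unif_ne_zero ?_)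
      rw [hxy] at h
      rw [show d + 1 + (n + 1 - i).toNat = (d + (n + 1 - i).toNat) + 1 by omega, pow_succ',
        pow_succ'] at h
      linear_combination h
  obtain ⟨k, b, hb, a, h⟩ := h
  -- multiply by a power of `π` that clears all denominators
  obtain ⟨e, he⟩ : ∃ e : ℕ, (e : ℤ) = i + (i.natAbs + k : ℕ) := ⟨(i + (i.natAbs + k : ℕ)).toNat, by omega⟩
  refine key e (M.unif ^ i.natAbs * b) (M.unif_pow_mul_mem _ hb) a (M.toFrac_injective ?_)
  have h1 := congrArg (fun g => unifFrac M ^ ((i.natAbs + k : ℕ) : ℤ) * g) h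
  simp only [mul_add, ← mul_assoc, ← zpow_add₀ hϖ] at h1
  rw [map_mul, map_add, map_mul, map_mul, ← unifFrac_zpow_natCast, ← unifFrac_zpow_natCast,
    ← unifFrac_zpow_natCast]
  convert h1 using 4 <;> omega

variable (M) in
theorem AlgLift.exists_teich_series (a : M.carrier) : ∃ (t : ℕ → M.carrier) (b : ℕ → M.carrier),
    (∀ j, IsTeich M (t j)) ∧
      ∀ N, a = ∑ j ∈ Finset.range N, M.unif ^ j * t j + M.unif ^ N * b N := by
  have hstep : ∀ a : M.carrier, ∃ a', a = M.teich (M.red a) + M.unif * a' := by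
    intro a
    obtain ⟨a', h⟩ := M.red_eq_iff.1 (M.red_teich (M.red a)).symm
    exact ⟨a', by rw [← h]; ring⟩
  choose next hnext using hstep
  let b : ℕ → M.carrier := fun n => next^[n] a
  refine ⟨fun j => M.teich (M.red (b j)), b, fun j => M.isTeich_teich _, fun N => ?_⟩
  induction N with
  | zero => simp [b]
  | succ N ih =>
    have h2 : b (N + 1) = next (b N) := Function.iterate_succ_apply' next N a
    rw [Finset.sum_range_succ, h2]
    have h1 := hnext (b N)
    rw [pow_succ]
    linear_combination ih + M.unif ^ N * h1

theorem exists_isTeichExpansion (g : AlgFrac M) : ∃ t, IsTeichExpansion M t g := by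
  obtain ⟨m, a, rfl⟩ := exists_eq_zpow_mul M g
  obtain ⟨t, b, ht, h⟩ := M.exists_teich_series a
  refine ⟨fun i => if i < m then 0 else t (i - m).toNat, fun i => ?_, m, fun i hi => if_pos hi,
    fun N => ⟨b N, ?_⟩⟩
  · dsimp only
    split_ifs
    · intro n
      exact ⟨0, zero_pow (pow_ne_zero _ (Fact.out : p.Prime).ne_zero)⟩
    · exact ht _
  · nth_rewrite 1 [h N]
    rw [map_add, mul_add, map_sum, Finset.mul_sum]
    congr 1
    · refine Finset.sum_congr rfl fun j _ => ?_
      dsimp only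
      rw [if_neg (by omega), show (m + j - m).toNat = j by omega, zpow_add₀ (unifFrac_ne_zero M),
        unifFrac_zpow_natCast, map_mul]
      ring
    · rw [zpow_add₀ (unifFrac_ne_zero M), unifFrac_zpow_natCast, map_mul]
      ring

theorem algAbs_red_le_of_mem_partialBall (hc : 0 ≤ c) {n : ℤ} {g : AlgFrac M}
    (hg : g ∈ partialBall M n c) {t : ℤ → M.carrier} (ht : IsTeichExpansion M t g) {i : ℤ}
    (hi : i ≤ n) : algAbs O (M.red (t i)) ≤ c := by
  obtain ⟨hT, m, h0, hN⟩ := ht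
  by_cases him : i < m
  · rwa [h0 i him, map_zero, map_zero]
  obtain ⟨j, rfl⟩ : ∃ j : ℕ, i = m + j := ⟨(i - m).toNat, by omega⟩
  clear him
  induction j using Nat.strong_induction_on with
  | _ j ih =>
    obtain ⟨b, hb⟩ := hN (j + 1)
    rw [Finset.sum_range_succ] at hb
    have h1 : unifFrac M ^ (m + j) * M.toFrac (t (m + j) + M.unif * b) ∈ partialBall M n c := by
      have h2 : unifFrac M ^ (m + j) * M.toFrac (t (m + j) + M.unif * b) =
          g - ∑ j ∈ Finset.range j, unifFrac M ^ (m + j) * M.toFrac (t (m + j)) := by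
        rw [hb, map_add, map_mul, ← unifFrac_eq, Nat.cast_succ, ← add_assoc, zpow_add_one₀
          (unifFrac_ne_zero M)]
        ring
      rw [h2]
      refine sub_mem hg (sum_mem fun l hl => zpow_mul_mem_partialBall _ ?_)
      rw [Finset.mem_range] at hl
      rw [← M.teich_red (hT (m + l))]
      exact M.teich_mem (ih l hl (by omega))
    obtain ⟨x, hx, y, hxy⟩ := exists_eq_of_mem_partialBall hc (by omega) h1
    have h3 : M.red (t (m + j)) = M.red x := by
      have h4 := congrArg M.red hxy
      rw [map_add, map_add, map_mul, map_mul, map_pow, M.red_eq_zero_iff.2 dvd_rfl, zero_mul,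
        zero_pow (by omega), zero_mul, add_zero, add_zero] at h4
      exact h4
    rw [h3]
    exact M.algAbs_red_le hc hx

/-- The description of `v_n` in terms of sums of Teichmüller lifts, from which all its properties
follow. -/
theorem coe_le_partialVal_iff {n : ℤ} {γ : ℝ} {g : AlgFrac M} :
    (γ : EReal) ≤ partialVal M n g ↔ g ∈ partialBall M n (Real.exp (-γ)) := by
  constructor
  · intro h
    obtain ⟨t, ht⟩ := exists_isTeichExpansion g
    have h1 : ∀ i ≤ n, algAbs O (M.red (t i)) ≤ Real.exp (-γ) := fun i hi =>
      coe_le_laurentVal_iff.1 (h.trans ((iInf₂_le t ht).trans (iInf₂_le i hi)))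
    obtain ⟨hT, m, h0, hN⟩ := ht
    obtain ⟨b, rfl⟩ := hN (n + 1 - m).toNat
    refine add_mem (sum_mem fun l hl => zpow_mul_mem_partialBall _ ?_)
      (zpow_mul_mem_partialBall_of_lt (by omega) b)
    rw [Finset.mem_range] at hl
    rw [← M.teich_red (hT (m + l))]
    exact M.teich_mem (h1 _ (by omega))
  · intro h
    exact le_iInf₂ fun t ht => le_iInf₂ fun i hi => coe_le_laurentVal_iff.2
      (algAbs_red_le_of_mem_partialBall (Real.exp_pos _).le h ht hi)

end Partial

end LogGrowth

/-! ### The valuations `w_r` -/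

namespace LogGrowth

theorem EReal.le_of_forall_coe_le {x y : EReal} (h : ∀ c : ℝ, (c : EReal) ≤ x → (c : EReal) ≤ y) :
    x ≤ y := by
  induction x with
  | bot => exact bot_le
  | coe c => exact h c le_rfl
  | top =>
    refine le_of_forall_lt fun z hz => ?_
    obtain ⟨c, hc, -⟩ := EReal.lt_iff_exists_real_btwn.1 hz
    exact hc.trans_le (h c le_top)

section WVal

variable {p : ℕ} [Fact p.Prime] {O : Type u} [CommRing O] [IsDomain O] [IsDiscreteValuationRing O]
  [CharZero O] [CharP (ResField O) p] {S : FrobDatum p O} (M : AlgLift S)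

/-- The elements `g` with `w_r(g) ≥ c`. -/
noncomputable def wBall (r c : ℝ) : AddSubgroup (AlgFrac M) :=
  ⨅ n : ℤ, partialBall M n (Real.exp (((n : ℝ) - c) / r))

variable {M} {r s c d : ℝ} {g h : AlgFrac M}

theorem mem_wBall : g ∈ wBall M r c ↔ ∀ n : ℤ, g ∈ partialBall M n (Real.exp (((n : ℝ) - c) / r)) :=
  AddSubgroup.mem_iInf

theorem coe_le_mul_add_iff (hr : 0 < r) {c n : ℝ} {v : EReal} (hv : v ≠ ⊥) :
    (c : EReal) ≤ (r : EReal) * v + (n : EReal) ↔ (((c - n) / r : ℝ) : EReal) ≤ v := by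
  induction v with
  | bot => exact absurd rfl hv
  | coe x =>
    rw [← EReal.coe_mul, ← EReal.coe_add, EReal.coe_le_coe_iff, EReal.coe_le_coe_iff, div_le_iff₀ hr]
    constructor <;> intro h <;> linarith
  | top =>
    rw [EReal.coe_mul_top_of_pos hr, EReal.top_add_coe]
    simp

theorem exists_mem_partialBall (n : ℤ) (g : AlgFrac M) : ∃ γ : ℝ,
    g ∈ partialBall M n (Real.exp (-γ)) := by
  obtain ⟨t, hT, m, h0, hN⟩ := exists_isTeichExpansion g
  obtain ⟨b, hb⟩ := hN (n + 1 - m).toNat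
  obtain ⟨K, hK⟩ := ((Finset.range (n + 1 - m).toNat).image
    fun j : ℕ => algAbs O (M.red (t (m + j)))).bddAbove
  refine ⟨-Real.log (max K 1), ?_⟩
  rw [neg_neg, Real.exp_log (by positivity), hb]
  refine add_mem (sum_mem fun l hl => zpow_mul_mem_partialBall _ ?_)
    (zpow_mul_mem_partialBall_of_lt (by omega) b)
  rw [← M.teich_red (hT (m + l))]
  refine M.teich_mem (le_max_of_le_left (hK ?_))
  exact Finset.mem_coe.2 (Finset.mem_image_of_mem _ hl)

theorem partialVal_ne_bot (n : ℤ) (g : AlgFrac M) : partialVal M n g ≠ ⊥ := by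
  obtain ⟨γ, hγ⟩ := exists_mem_partialBall n g
  exact ne_bot_of_le_ne_bot (EReal.coe_ne_bot γ) (coe_le_partialVal_iff.2 hγ)

theorem coe_le_partialValR_iff (hr : 0 < r) {n : ℤ} :
    (c : EReal) ≤ partialValR M r n g ↔ g ∈ partialBall M n (Real.exp (((n : ℝ) - c) / r)) := by
  rw [partialValR, if_neg hr.ne', coe_le_mul_add_iff hr (partialVal_ne_bot n g),
    coe_le_partialVal_iff, ← neg_div, neg_sub]

theorem coe_le_wVal_iff (hr : 0 < r) : (c : EReal) ≤ wVal M r g ↔ g ∈ wBall M r c := by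
  rw [wVal, le_iInf_iff, mem_wBall]
  exact forall_congr' fun n => coe_le_partialValR_iff hr

theorem wBall_anti (hr : 0 < r) (h : c ≤ d) : wBall M r d ≤ wBall M r c := by
  intro g hg
  rw [mem_wBall] at hg ⊢
  exact fun n => partialBall_mono (Real.exp_le_exp.2 (by gcongr)) (hg n)

theorem zpow_mul_mem_wBall (hr : 0 < r) (i : ℤ) {b : M.carrier}
    (hb : b ∈ M.teichSums (Real.exp ((i - c) / r))) :
    unifFrac M ^ i * M.toFrac b ∈ wBall M r c := by
  rw [mem_wBall]
  intro n
  by_cases hn : n < i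
  · exact zpow_mul_mem_partialBall_of_lt hn b
  · refine zpow_mul_mem_partialBall i (M.teichSums_mono (Real.exp_le_exp.2 ?_) hb)
    have : (i : ℝ) ≤ n := by exact_mod_cast not_lt.1 hn
    gcongr

/-- `wBall` is closed for the `π`-adic topology. -/
theorem mem_wBall_of_forall_exists (h : ∀ N : ℤ, ∃ g' ∈ wBall M r c, ∃ a,
    g - g' = unifFrac M ^ N * M.toFrac a) : g ∈ wBall M r c := by
  rw [mem_wBall]
  intro n
  obtain ⟨g', hg', a, ha⟩ := h (n + 1)
  rw [← sub_add_cancel g g', ha]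
  exact add_mem (zpow_mul_mem_partialBall_of_lt (by omega) a) (mem_wBall.1 hg' n)

theorem zpow_teich_mul_mem_partialBall {n i : ℤ} {c d : ℝ} {z : LaurentAlg O}
    (hz : algAbs O z ≤ d) (hg : g ∈ partialBall M n c) :
    unifFrac M ^ i * M.toFrac (M.teich z) * g ∈ partialBall M (n + i) (d * c) := by
  obtain ⟨k, b, hb, a, rfl⟩ := hg
  have h1 : M.teich z * b ∈ M.teichSums (d * c) := by
    have := M.mul_mem_teichSums (one_mem _) hz hb
    rwa [one_mul] at this
  have h2 := add_mem (zpow_mul_mem_partialBall (n := n + i) (-k + i) h1)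
    (zpow_mul_mem_partialBall_of_lt (n := n + i) (i := n + 1 + i) (by omega) (M.teich z * a))
  rw [zpow_add₀ (unifFrac_ne_zero M), zpow_add₀ (unifFrac_ne_zero M), map_mul, map_mul] at h2
  convert h2 using 1
  ring

theorem mul_mem_wBall (hg : g ∈ wBall M r c) (hh : h ∈ wBall M r d) :
    g * h ∈ wBall M r (c + d) := by
  obtain ⟨t, ht⟩ := exists_isTeichExpansion g
  have h1 : ∀ i, algAbs O (M.red (t i)) ≤ Real.exp ((i - c) / r) := fun i =>
    algAbs_red_le_of_mem_partialBall (Real.exp_pos _).le (mem_wBall.1 hg i) ht le_rfl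
  obtain ⟨hT, m, h0, hN⟩ := ht
  obtain ⟨m', b', hb'⟩ := exists_eq_zpow_mul M h
  refine mem_wBall_of_forall_exists fun N => ?_
  obtain ⟨b, hb⟩ := hN (N - m - m').toNat
  refine ⟨∑ j ∈ Finset.range (N - m - m').toNat,
    unifFrac M ^ (m + j) * M.toFrac (t (m + j)) * h, sum_mem fun j hj => ?_,
    M.unif ^ (m + (N - m - m').toNat + m' - N).toNat * (b * b'), ?_⟩
  · rw [mem_wBall] at hh ⊢
    intro n
    have h2 := zpow_teich_mul_mem_partialBall (i := m + j) (h1 (m + j)) (hh (n - (m + j)))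
    rw [M.teich_red (hT _), sub_add_cancel, ← Real.exp_add] at h2
    convert h2 using 2
    push_cast
    ring_nf
  · rw [← Finset.sum_mul, ← sub_mul]
    have h3 : g - ∑ j ∈ Finset.range (N - m - m').toNat,
        unifFrac M ^ (m + j) * M.toFrac (t (m + j))
        = unifFrac M ^ (m + (N - m - m').toNat) * M.toFrac b := by
      rw [sub_eq_iff_eq_add']
      exact hb
    rw [h3, map_mul, ← mul_assoc, ← unifFrac_zpow_of_le M (by omega), hb', map_mul,
      zpow_add₀ (unifFrac_ne_zero M) _ m']
    ring

theorem perf_mem_wBall (hr : 0 < r) {b : M.carrier} (hb : b ∈ M.perf) :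
    M.toFrac b ∈ wBall M r 0 := by
  have h1 : b ∈ M.teichSums (Real.exp (((0 : ℤ) - 0) / r)) := by
    have := M.mul_teich_mem hb (z := 1) (c := 1) (by rw [map_one])
    rw [map_one, mul_one] at this
    simpa using this
  have := zpow_mul_mem_wBall hr 0 h1
  rwa [zpow_zero, one_mul] at this

theorem one_mem_wBall (hr : 0 < r) : (1 : AlgFrac M) ∈ wBall M r 0 := by
  have := perf_mem_wBall hr (one_mem M.perf)
  rwa [map_one] at this

theorem unifFrac_zpow_mem_wBall (hr : 0 < r) (i : ℤ) : unifFrac M ^ i ∈ wBall M r i := by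
  have h1 : (1 : M.carrier) ∈ M.teichSums (Real.exp (((i : ℝ) - i) / r)) := by
    have := M.teich_mem (z := 1) (c := 1) (by rw [map_one])
    rw [map_one] at this
    simpa using this
  have := zpow_mul_mem_wBall hr i h1
  rwa [map_one, mul_one] at this

theorem pow_mem_wBall (hr : 0 < r) (hg : g ∈ wBall M r c) (n : ℕ) : g ^ n ∈ wBall M r (n * c) := by
  induction n with
  | zero => simpa using one_mem_wBall hr
  | succ n ih =>
    rw [pow_succ, Nat.cast_succ, add_mul, one_mul]
    exact mul_mem_wBall ih hg

/-! ### Frobenius and the valuations `w_r` -/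

theorem exists_frobFrac_zpow (i : ℤ) : ∃ o ∈ M.perf, ∃ o' ∈ M.perf,
    frobFrac M (unifFrac M ^ i) = unifFrac M ^ i * M.toFrac o ∧
      unifFrac M ^ i = frobFrac M (unifFrac M ^ i) * M.toFrac o' := by
  obtain ⟨w, hw⟩ := M.exists_frob_unif
  have h1 : frobFrac M (unifFrac M) = unifFrac M * M.toFrac (M.incl (PowerSeries.C (w : O))) := by
    rw [unifFrac_eq, frobFrac, IsFractionRing.map, IsLocalization.map_eq, hw, map_mul]
  have h2 : ∀ w : Oˣ, M.toFrac (M.incl (PowerSeries.C (w : O)))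
      * M.toFrac (M.incl (PowerSeries.C ((w⁻¹ : Oˣ) : O))) = 1 := by
    intro w
    rw [← map_mul, ← map_mul, ← map_mul, Units.mul_inv, map_one, map_one, map_one]
  have h3 : ∀ i : ℤ, M.toFrac (M.incl (PowerSeries.C (w : O))) ^ i
      = M.toFrac (M.incl (PowerSeries.C ((w ^ i : Oˣ) : O))) := by
    intro i
    induction i with
    | zero => simp
    | succ i ih =>
      rw [zpow_add_one₀ (left_ne_zero_of_mul_eq_one (h2 w)), ih, zpow_add_one, Units.val_mul,
        map_mul, map_mul, map_mul]
    | pred i ih =>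
      rw [zpow_sub_one₀ (left_ne_zero_of_mul_eq_one (h2 w)), ih, zpow_sub_one, Units.val_mul,
        map_mul, map_mul, map_mul, eq_comm, eq_inv_of_mul_eq_one_right (h2 w)]
  refine ⟨_, M.incl_mem_perf (PowerSeries.C ((w ^ i : Oˣ) : O)), _,
    M.incl_mem_perf (PowerSeries.C (((w ^ i)⁻¹ : Oˣ) : O)), ?_, ?_⟩
  · rw [map_zpow₀, h1, mul_zpow, h3]
  · rw [map_zpow₀, h1, mul_zpow, h3, mul_assoc, h2, mul_one]

theorem frobFrac_toFrac (a : M.carrier) : frobFrac M (M.toFrac a) = M.toFrac (M.frob a) := by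
  rw [frobFrac, IsFractionRing.map, IsLocalization.map_eq]

theorem frobFrac_mem_partialBall_iff {n : ℤ} (hc : 0 ≤ c) :
    frobFrac M g ∈ partialBall M n (c ^ p ^ S.f) ↔ g ∈ partialBall M n c := by
  constructor
  · rintro ⟨k, b, hb, a, hab⟩
    obtain ⟨o, ho, o₁, ho₁, h₁, h₂⟩ := exists_frobFrac_zpow (M := M) (-(k : ℤ))
    obtain ⟨o', ho', o₂, ho₂, h₃, h₄⟩ := exists_frobFrac_zpow (M := M) (n + 1)
    obtain ⟨b', hb', hbe⟩ := M.exists_frob_eq_of_mem_teichSums hc (M.perf_mul_mem_teichSums ho₁ hb)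
    obtain ⟨a', ha'⟩ := M.frob_surjective (o₂ * a)
    refine ⟨k, b', hb', a', (frobFrac M).injective ?_⟩
    rw [hab, map_add, map_mul, map_mul, frobFrac_toFrac, frobFrac_toFrac, hbe, ha', map_mul,
      map_mul, ← mul_assoc, ← mul_assoc, ← h₂, ← h₄]
  · rintro ⟨k, b, hb, a, rfl⟩
    obtain ⟨o, ho, -, -, h₁, -⟩ := exists_frobFrac_zpow (M := M) (-(k : ℤ))
    obtain ⟨o', ho', -, -, h₃, -⟩ := exists_frobFrac_zpow (M := M) (n + 1)
    refine ⟨k, o * M.frob b, M.perf_mul_mem_teichSums ho (M.frob_mem_teichSums hb),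
      o' * M.frob a, ?_⟩
    rw [map_add, map_mul, map_mul, frobFrac_toFrac, frobFrac_toFrac, h₁, h₃, map_mul, map_mul]
    ring

theorem frobFrac_mem_wBall_iff :
    frobFrac M g ∈ wBall M r c ↔ g ∈ wBall M ((p ^ S.f : ℕ) * r) c := by
  rw [mem_wBall, mem_wBall]
  refine forall_congr' fun n => ?_
  have hq : ((p ^ S.f : ℕ) : ℝ) ≠ 0 :=
    Nat.cast_ne_zero.2 (pow_ne_zero _ (Fact.out : p.Prime).ne_zero)
  have h : Real.exp (((n : ℝ) - c) / r)
      = Real.exp (((n : ℝ) - c) / ((p ^ S.f : ℕ) * r)) ^ p ^ S.f := by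
    rw [← Real.exp_nat_mul, ← mul_div_assoc, mul_div_mul_left _ _ hq]
  rw [h]
  exact frobFrac_mem_partialBall_iff (Real.exp_pos _).le

theorem wVal_frobFrac (hr : 0 < r) : wVal M r (frobFrac M g) = wVal M ((p ^ S.f : ℕ) * r) g := by
  have hq : (0 : ℝ) < (p ^ S.f : ℕ) := Nat.cast_pos.2 (pow_pos (Fact.out : p.Prime).pos _)
  have h : ∀ c : ℝ, (c : EReal) ≤ wVal M r (frobFrac M g) ↔
      (c : EReal) ≤ wVal M ((p ^ S.f : ℕ) * r) g := by
    intro c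
    rw [coe_le_wVal_iff hr, coe_le_wVal_iff (mul_pos hq hr), frobFrac_mem_wBall_iff]
  exact le_antisymm (EReal.le_of_forall_coe_le fun c => (h c).1)
    (EReal.le_of_forall_coe_le fun c => (h c).2)

/-! ### Dependence of `w_r` on `r`, and inverses -/

theorem mem_wBall_of_mem_of_mem {a b : ℝ} (ha : 0 < a) (har : a ≤ r) (hrb : r ≤ b)
    (hga : g ∈ wBall M a c) (hgb : g ∈ wBall M b c) : g ∈ wBall M r c := by
  rw [mem_wBall] at hga hgb ⊢
  intro n
  rcases le_total (n : ℝ) c with h | h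
  · refine partialBall_mono (Real.exp_le_exp.2 ?_) (hga n)
    rw [div_le_div_iff₀ ha (ha.trans_le har)]
    nlinarith
  · refine partialBall_mono (Real.exp_le_exp.2 ?_) (hgb n)
    rw [div_le_div_iff₀ (by linarith) (ha.trans_le har)]
    nlinarith

theorem midpoint_mem_wBall {a b : ℝ} (ha : 0 < a) (hb : 0 < b) (hga : g ∈ wBall M a c)
    (hgb : g ∈ wBall M b d) : g ∈ wBall M ((a + b) / 2) ((c + d) / 2) := by
  rw [mem_wBall] at hga hgb ⊢
  intro n
  have h : ((n : ℝ) - (c + d) / 2) / ((a + b) / 2)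
      = ((n - c) + (n - d)) / (a + b) := by
    field_simp
    ring
  rw [h]
  rcases le_total (((n : ℝ) - c) / a) ((n - d) / b) with h1 | h1
  · refine partialBall_mono (Real.exp_le_exp.2 ?_) (hga n)
    rw [div_le_div_iff₀ ha hb] at h1
    rw [div_le_div_iff₀ ha (by positivity)]
    nlinarith
  · refine partialBall_mono (Real.exp_le_exp.2 ?_) (hgb n)
    rw [div_le_div_iff₀ hb ha] at h1
    rw [div_le_div_iff₀ hb (by positivity)]
    nlinarith

/-- For an element of `π^m Γ^alg[1/p]`, `w_r` is at least `m - C r` as `r → 0`. -/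
theorem exists_forall_mem_wBall {m : ℤ} {a : M.carrier} {r₀ : ℝ} (hr₀ : 0 < r₀)
    (h : unifFrac M ^ m * M.toFrac a ∈ wBall M r₀ c) : ∃ C : ℝ, ∀ r, 0 < r → r ≤ r₀ →
      unifFrac M ^ m * M.toFrac a ∈ wBall M r (m - C * r) := by
  refine ⟨(m - c) / r₀, fun r hr hrr => ?_⟩
  rw [mem_wBall] at h ⊢
  intro n
  by_cases hn : n < m
  · exact zpow_mul_mem_partialBall_of_lt hn a
  · refine partialBall_mono (Real.exp_le_exp.2 ?_) (h n)
    have hn' : (0 : ℝ) ≤ (n : ℝ) - m := by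
      have : (m : ℝ) ≤ n := by exact_mod_cast not_lt.1 hn
      linarith
    have h1 : ((n : ℝ) - m) / r₀ ≤ (n - m) / r := by gcongr
    have h2 : ((n : ℝ) - (m - (m - c) / r₀ * r)) / r = (n - m) / r + (m - c) / r₀ := by
      field_simp
      ring
    rw [h2]
    have h3 : ((n : ℝ) - c) / r₀ = (n - m) / r₀ + (m - c) / r₀ := by ring
    linarith

/-- Leading terms: a nonzero element is a power of `π` times an element with nonzero reduction. -/
theorem exists_eq_zpow_mul_unit (hg : g ≠ 0) : ∃ (m : ℤ) (a : M.carrier),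
    M.red a ≠ 0 ∧ g = unifFrac M ^ m * M.toFrac a := by
  obtain ⟨m, a, rfl⟩ := exists_eq_zpow_mul M g
  have ha : a ≠ 0 := by
    rintro rfl
    exact hg (by rw [map_zero, mul_zero])
  obtain ⟨n, u, hu⟩ := IsDiscreteValuationRing.eq_unit_mul_pow_irreducible ha M.irreducible
  refine ⟨m + n, u, (u.isUnit.map M.red).ne_zero, ?_⟩
  rw [zpow_add₀ (unifFrac_ne_zero M), unifFrac_zpow_natCast, hu, map_mul]
  ring

/-- The inverse of an overconvergent element is overconvergent: after division by the leading term
`π^m [z]` it is `1 + ε` with `ε` divisible by `π`, so `w_r(ε) ≥ 0` for small `r`, and the geometric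
series applies. -/
theorem exists_forall_inv_mem_wBall {m : ℤ} {a : M.carrier} (ha : M.red a ≠ 0) {r₀ : ℝ}
    (hr₀ : 0 < r₀) (h : unifFrac M ^ m * M.toFrac a ∈ wBall M r₀ c) :
    ∃ C r₁ : ℝ, 0 < r₁ ∧ ∀ r, 0 < r → r ≤ r₁ →
      (unifFrac M ^ m * M.toFrac a)⁻¹ ∈ wBall M r (-m - C * r) := by
  have hϖ := unifFrac_ne_zero M
  set z := M.red a with hz
  have hTz : M.teich z * M.teich z⁻¹ = 1 := by rw [← map_mul, mul_inv_cancel₀ ha, map_one]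
  obtain ⟨y, hy⟩ : M.unif ∣ M.teich z⁻¹ * a - 1 := by
    rw [← M.red_eq_iff, map_mul, M.red_teich, map_one, inv_mul_cancel₀ ha]
  set L := Real.log (algAbs O z⁻¹) with hL
  have hzL : algAbs O z⁻¹ = Real.exp L := (Real.exp_log ((algAbs O).pos (inv_ne_zero ha))).symm
  -- the inverse of the leading term
  have hτ : ∀ r, 0 < r → unifFrac M ^ (-m) * M.toFrac (M.teich z⁻¹) ∈ wBall M r (-m - L * r) := by
    intro r hr
    refine zpow_mul_mem_wBall hr _ (M.teich_mem ?_)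
    rw [hzL]
    apply Real.exp_le_exp.2
    push_cast
    rw [sub_sub_cancel, mul_div_cancel_right₀ _ hr.ne']
  have hε : unifFrac M ^ (1 : ℤ) * M.toFrac y = unifFrac M ^ (-m) * M.toFrac (M.teich z⁻¹)
      * (unifFrac M ^ m * M.toFrac a) - 1 := by
    rw [zpow_one, unifFrac_eq, ← map_mul, ← hy, map_sub, map_mul, map_one, ← unifFrac_eq]
    have : unifFrac M ^ (-m) * unifFrac M ^ m = 1 := by rw [← zpow_add₀ hϖ]; simp
    linear_combination (-M.toFrac (M.teich z⁻¹) * M.toFrac a) * this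
  obtain ⟨C, hC⟩ : ∃ C : ℝ, ∀ r, 0 < r → r ≤ r₀ →
      unifFrac M ^ (1 : ℤ) * M.toFrac y ∈ wBall M r ((1 : ℤ) - C * r) := by
    refine exists_forall_mem_wBall (c := min (-m - L * r₀ + c) 0) hr₀ ?_
    rw [hε]
    exact sub_mem (wBall_anti hr₀ (min_le_left _ _) (mul_mem_wBall (hτ r₀ hr₀) h))
      (wBall_anti hr₀ (min_le_right _ _) (one_mem_wBall hr₀))
  refine ⟨L, min r₀ (1 / (|C| + 1)), by positivity, fun r hr hrr => ?_⟩
  have hε0 : unifFrac M ^ (1 : ℤ) * M.toFrac y ∈ wBall M r 0 := by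
    refine wBall_anti hr ?_ (hC r hr (hrr.trans (min_le_left _ _)))
    have h1 := hrr.trans (min_le_right _ _)
    rw [le_div_iff₀ (by positivity)] at h1
    have := mul_le_mul_of_nonneg_right (le_abs_self C) hr.le
    push_cast
    linarith
  obtain ⟨v, hv⟩ : ∃ v : M.carrier, (1 + M.unif * y) * v = 1 := by
    have hne : M.red (1 + M.unif * y) ≠ 0 := by
      rw [map_add, map_mul, M.red_eq_zero_iff.2 dvd_rfl, map_one, zero_mul, add_zero]
      exact one_ne_zero
    have hnd : ¬ M.unif ∣ 1 + M.unif * y := fun hd => hne (M.red_eq_zero_iff.2 hd)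
    have hu : IsUnit (1 + M.unif * y) := by
      by_contra hnu
      apply hnd
      rw [← Ideal.mem_span_singleton, ← M.irreducible.maximalIdeal_eq]
      exact hnu
    exact hu.exists_right_inv
  have hvb : M.toFrac v ∈ wBall M r 0 := by
    refine mem_wBall_of_forall_exists fun N => ?_
    refine ⟨∑ i ∈ Finset.range N.toNat, (-(unifFrac M ^ (1 : ℤ) * M.toFrac y)) ^ i,
      sum_mem fun i _ => ?_, M.unif ^ ((N.toNat : ℤ) - N).toNat * ((-y) ^ N.toNat * v), ?_⟩
    · have := pow_mem_wBall hr (neg_mem hε0) i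
      rwa [mul_zero] at this
    · have h2 := geom_sum_mul_neg (-(M.unif * y)) N.toNat
      have h3 : v - ∑ i ∈ Finset.range N.toNat, (-(M.unif * y)) ^ i
          = M.unif ^ N.toNat * ((-y) ^ N.toNat * v) := by
        rw [sub_neg_eq_add] at h2
        have h4 : (-(M.unif * y)) ^ N.toNat = M.unif ^ N.toNat * (-y) ^ N.toNat := by
          rw [← mul_pow]; ring
        linear_combination (∑ i ∈ Finset.range N.toNat, (-(M.unif * y)) ^ i) * hv - v * h2
          + v * h4
      have h5 := congrArg M.toFrac h3
      rw [map_sub, map_sum, map_mul, ← unifFrac_zpow_natCast,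
        unifFrac_zpow_of_le M (show N ≤ N.toNat by omega), mul_assoc, ← map_mul] at h5
      rw [← h5]
      simp only [map_pow, map_neg, map_mul, zpow_one, unifFrac_eq]
  have hinv : (unifFrac M ^ m * M.toFrac a)⁻¹
      = unifFrac M ^ (-m) * M.toFrac (M.teich z⁻¹) * M.toFrac v := by
    refine inv_eq_of_mul_eq_one_left ?_
    have h1 := congrArg M.toFrac hv
    rw [map_mul, map_add, map_one, map_mul, ← unifFrac_eq] at h1
    rw [zpow_one] at hε
    linear_combination h1 - M.toFrac v * hε
  rw [hinv]
  have := mul_mem_wBall (hτ r hr) hvb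
  rwa [add_zero] at this

end WVal

end LogGrowth

/-! ### The norms `|·|_ρ` on overconvergent elements -/

namespace LogGrowth

section Norms

variable {p : ℕ} [Fact p.Prime] {O : Type u} [CommRing O] [IsDomain O] [IsDiscreteValuationRing O]
  [CharZero O] [CharP (ResField O) p] {S : FrobDatum p O}

theorem exists_ramification (S : FrobDatum p O) : ∃ e : ℕ, 0 < e ∧
    Associated (p : O) (S.unif ^ e) ∧ absUnif S = (p : ℝ) ^ (-1 / (e : ℝ)) := by
  have hp0 : (p : O) ≠ 0 := Nat.cast_ne_zero.2 (Fact.out : p.Prime).ne_zero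
  obtain ⟨e, he⟩ := IsDiscreteValuationRing.associated_pow_irreducible hp0 S.unif_irreducible
  refine ⟨e, ?_, he, ?_⟩
  · rw [Nat.pos_iff_ne_zero]
    rintro rfl
    rw [pow_zero] at he
    have h5 := (associated_one_iff_isUnit.1 he).map (IsLocalRing.residue O)
    rw [map_natCast, CharP.cast_eq_zero] at h5
    exact not_isUnit_zero h5
  · rw [absUnif, multiplicity_eq_of_associated_right he, multiplicity_pow_self
      S.unif_irreducible.ne_zero S.unif_irreducible.not_isUnit]

theorem absUnif_pos (S : FrobDatum p O) : 0 < absUnif S :=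
  Real.rpow_pos_of_pos (Nat.cast_pos.2 (Fact.out : p.Prime).pos) _

theorem absUnif_lt_one (S : FrobDatum p O) : absUnif S < 1 := by
  obtain ⟨e, he, -, h⟩ := exists_ramification S
  rw [h]
  refine Real.rpow_lt_one_of_one_lt_of_neg (Nat.one_lt_cast.2 (Fact.out : p.Prime).one_lt) ?_
  exact div_neg_of_neg_of_pos (by norm_num) (Nat.cast_pos.2 he)

theorem exists_rpow_eq (S : FrobDatum p O) {ε : ℝ} (hε : 0 < ε) : ∃ c : ℝ, ε = absUnif S ^ c :=
  ⟨Real.logb (absUnif S) ε,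
    (Real.rpow_logb (absUnif_pos S) (absUnif_lt_one S).ne hε).symm⟩

variable (M : AlgLift S)

/-- The norm `|g|_ρ` as a function of `r`, where `ρ = p ^ (-r)`. -/
noncomputable def nrm (r : ℝ) (g : AlgFrac M) : ℝ := absAt M ((p : ℝ) ^ (-r)) g

/-- `w_r(g) > -∞`. -/
def IsOverAt (r : ℝ) (g : AlgFrac M) : Prop := ∃ c, g ∈ wBall M r c

variable {M} {r s c d : ℝ} {g h : AlgFrac M}

theorem neg_logb_rpow (r : ℝ) : -Real.logb p ((p : ℝ) ^ (-r)) = r := by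
  rw [Real.logb_rpow (Nat.cast_pos.2 (Fact.out : p.Prime).pos)
    (Nat.one_lt_cast.2 (Fact.out : p.Prime).one_lt).ne', neg_neg]

theorem nrm_nonneg : 0 ≤ nrm M r g := by
  rw [nrm, absAt]
  split_ifs
  · exact le_rfl
  · exact (Real.rpow_pos_of_pos (absUnif_pos S) _).le

theorem nrm_le_rpow_iff (hr : 0 < r) (hg : IsOverAt M r g) :
    nrm M r g ≤ absUnif S ^ c ↔ g ∈ wBall M r c := by
  obtain ⟨d, hd⟩ := hg
  rw [← coe_le_wVal_iff hr] at hd ⊢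
  rw [nrm, absAt, neg_logb_rpow]
  split_ifs with htop
  · rw [htop]
    simp [(Real.rpow_pos_of_pos (absUnif_pos S) _).le]
  · rw [Real.rpow_le_rpow_left_iff_of_base_lt_one (absUnif_pos S) (absUnif_lt_one S),
      ← EReal.coe_le_coe_iff, EReal.coe_toReal htop (ne_bot_of_le_ne_bot (EReal.coe_ne_bot _) hd)]

theorem nrm_le_rpow (hr : 0 < r) (hg : g ∈ wBall M r c) : nrm M r g ≤ absUnif S ^ c :=
  (nrm_le_rpow_iff hr ⟨c, hg⟩).2 hg

theorem nrm_le_of_forall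
    (hyp : ∀ c : ℝ, nrm M s h < absUnif S ^ c → nrm M r g ≤ absUnif S ^ c) :
    nrm M r g ≤ nrm M s h := by
  refine le_of_forall_gt_imp_ge_of_dense fun ε hε => ?_
  obtain ⟨c, rfl⟩ := exists_rpow_eq S (nrm_nonneg.trans_lt hε)
  exact hyp c hε

theorem IsOverAt.add (hr : 0 < r) (hg : IsOverAt M r g) (hh : IsOverAt M r h) :
    IsOverAt M r (g + h) := by
  obtain ⟨c, hc⟩ := hg
  obtain ⟨d, hd⟩ := hh
  exact ⟨min c d, add_mem (wBall_anti hr (min_le_left _ _) hc) (wBall_anti hr (min_le_right _ _) hd)⟩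

theorem IsOverAt.neg (hg : IsOverAt M r g) : IsOverAt M r (-g) :=
  hg.imp fun _ hc => neg_mem hc

theorem IsOverAt.sub (hr : 0 < r) (hg : IsOverAt M r g) (hh : IsOverAt M r h) :
    IsOverAt M r (g - h) := by
  rw [sub_eq_add_neg]
  exact hg.add hr hh.neg

theorem IsOverAt.mul (hg : IsOverAt M r g) (hh : IsOverAt M r h) :
    IsOverAt M r (g * h) := by
  obtain ⟨c, hc⟩ := hg
  obtain ⟨d, hd⟩ := hh
  exact ⟨c + d, mul_mem_wBall hc hd⟩

theorem IsOverAt.mono (hs : 0 < s) (hsr : s ≤ r) (hg : IsOverAt M r g) : IsOverAt M s g := by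
  obtain ⟨c, hc⟩ := hg
  obtain ⟨m, a, rfl⟩ := exists_eq_zpow_mul M g
  obtain ⟨C, hC⟩ := exists_forall_mem_wBall (hs.trans_le hsr) hc
  exact ⟨_, hC s hs hsr⟩

theorem isOverAt_zero : IsOverAt M r 0 := ⟨0, zero_mem _⟩

theorem isOverAt_one (hr : 0 < r) : IsOverAt M r 1 := ⟨0, one_mem_wBall hr⟩

theorem q_pos (S : FrobDatum p O) : (0 : ℝ) < (p ^ S.f : ℕ) :=
  Nat.cast_pos.2 (pow_pos (Fact.out : p.Prime).pos _)

theorem isOverAt_frobFrac_iff :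
    IsOverAt M r (frobFrac M g) ↔ IsOverAt M ((p ^ S.f : ℕ) * r) g :=
  exists_congr fun _ => frobFrac_mem_wBall_iff

theorem nrm_zero (hr : 0 < r) : nrm M r 0 = 0 := by
  refine le_antisymm (le_of_forall_gt_imp_ge_of_dense fun ε hε => ?_) nrm_nonneg
  obtain ⟨c, rfl⟩ := exists_rpow_eq S hε
  exact nrm_le_rpow hr (zero_mem _)

theorem nrm_add_le (hr : 0 < r) (hg : IsOverAt M r g) (hh : IsOverAt M r h) :
    nrm M r (g + h) ≤ max (nrm M r g) (nrm M r h) := by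
  refine le_of_forall_gt_imp_ge_of_dense fun ε hε => ?_
  obtain ⟨c, rfl⟩ := exists_rpow_eq S ((nrm_nonneg.trans (le_max_left _ _)).trans_lt hε)
  rw [max_lt_iff] at hε
  exact nrm_le_rpow hr (add_mem ((nrm_le_rpow_iff hr hg).1 hε.1.le)
    ((nrm_le_rpow_iff hr hh).1 hε.2.le))

theorem nrm_neg (hr : 0 < r) (hg : IsOverAt M r g) : nrm M r (-g) = nrm M r g := by
  refine le_antisymm (nrm_le_of_forall fun c hc => ?_) (nrm_le_of_forall fun c hc => ?_)
  · exact nrm_le_rpow hr (neg_mem ((nrm_le_rpow_iff hr hg).1 hc.le))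
  · have := neg_mem ((nrm_le_rpow_iff hr hg.neg).1 hc.le)
    rw [neg_neg] at this
    exact nrm_le_rpow hr this

theorem nrm_sub_le (hr : 0 < r) (hg : IsOverAt M r g) (hh : IsOverAt M r h) :
    nrm M r (g - h) ≤ max (nrm M r g) (nrm M r h) := by
  rw [sub_eq_add_neg, ← nrm_neg hr hh]
  exact nrm_add_le hr hg hh.neg

theorem le_mul_of_forall_gt {x a b : ℝ}
    (h : ∀ a' > a, ∀ b' > b, x ≤ a' * b') : x ≤ a * b := by
  have h1 : Filter.Tendsto (fun t : ℝ => (a + t) * (b + t)) (nhdsWithin 0 (Set.Ioi 0))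
      (nhds ((a + 0) * (b + 0))) :=
    ((by fun_prop : Continuous fun t : ℝ => (a + t) * (b + t)).tendsto 0).mono_left nhdsWithin_le_nhds
  rw [add_zero, add_zero] at h1
  refine ge_of_tendsto h1 ?_
  filter_upwards [self_mem_nhdsWithin] with t (ht : 0 < t)
  exact h _ (by linarith) _ (by linarith)

theorem nrm_mul_le (hr : 0 < r) (hg : IsOverAt M r g) (hh : IsOverAt M r h) :
    nrm M r (g * h) ≤ nrm M r g * nrm M r h := by
  refine le_mul_of_forall_gt fun a ha b hb => ?_
  obtain ⟨c, rfl⟩ := exists_rpow_eq S (nrm_nonneg.trans_lt ha)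
  obtain ⟨d, rfl⟩ := exists_rpow_eq S (nrm_nonneg.trans_lt hb)
  rw [← Real.rpow_add (absUnif_pos S)]
  exact nrm_le_rpow hr (mul_mem_wBall ((nrm_le_rpow_iff hr hg).1 ha.le)
    ((nrm_le_rpow_iff hr hh).1 hb.le))

theorem nrm_frobFrac (hr : 0 < r) : nrm M r (frobFrac M g) = nrm M ((p ^ S.f : ℕ) * r) g := by
  rw [nrm, nrm, absAt, absAt, neg_logb_rpow, neg_logb_rpow, wVal_frobFrac hr]

theorem nrm_le_max {a b : ℝ} (ha : 0 < a) (har : a ≤ r) (hrb : r ≤ b) (hg : IsOverAt M b g) :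
    nrm M r g ≤ max (nrm M a g) (nrm M b g) := by
  refine le_of_forall_gt_imp_ge_of_dense fun ε hε => ?_
  obtain ⟨c, rfl⟩ := exists_rpow_eq S ((nrm_nonneg.trans (le_max_left _ _)).trans_lt hε)
  rw [max_lt_iff] at hε
  exact nrm_le_rpow (ha.trans_le har) (mem_wBall_of_mem_of_mem ha har hrb
    ((nrm_le_rpow_iff ha (hg.mono ha (har.trans hrb))).1 hε.1.le)
    ((nrm_le_rpow_iff (ha.trans_le (har.trans hrb)) hg).1 hε.2.le))

theorem nrm_midpoint_sq_le {a b : ℝ} (ha : 0 < a) (hab : a ≤ b) (hg : IsOverAt M b g) :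
    nrm M ((a + b) / 2) g ^ 2 ≤ nrm M a g * nrm M b g := by
  have hb := ha.trans_le hab
  refine le_mul_of_forall_gt fun x hx y hy => ?_
  obtain ⟨c, rfl⟩ := exists_rpow_eq S (nrm_nonneg.trans_lt hx)
  obtain ⟨d, rfl⟩ := exists_rpow_eq S (nrm_nonneg.trans_lt hy)
  have h1 := nrm_le_rpow (by linarith) (midpoint_mem_wBall ha hb
    ((nrm_le_rpow_iff ha (hg.mono ha hab)).1 hx.le) ((nrm_le_rpow_iff hb hg).1 hy.le))
  refine (pow_le_pow_left₀ nrm_nonneg h1 2).trans_eq ?_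
  rw [← Real.rpow_natCast, ← Real.rpow_mul (absUnif_pos S).le, ← Real.rpow_add (absUnif_pos S)]
  congr 1
  push_cast
  ring

theorem isOverAt_of_mem_gammaR (hr : 0 < r) (hg : g ∈ gammaR M r) : IsOverAt M r g := by
  have h1 : ∀ᶠ n : ℤ in Filter.atTop, ((0 : ℝ) : EReal) ≤ partialValR M r n g :=
    (hg.eventually (lt_mem_nhds (EReal.coe_lt_top 0))).mono fun n hn => hn.le
  obtain ⟨N, hN⟩ := Filter.eventually_atTop.1 h1
  obtain ⟨γ, hγ⟩ := exists_mem_partialBall N g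
  obtain ⟨m, a, hma⟩ := exists_eq_zpow_mul M g
  refine ⟨min 0 (r * γ + m), ?_⟩
  rw [mem_wBall]
  intro n
  by_cases hnm : n < m
  · rw [hma]
    exact zpow_mul_mem_partialBall_of_lt hnm a
  rw [not_lt] at hnm
  rcases le_total N n with h | h
  · refine partialBall_mono (Real.exp_le_exp.2 ?_) ((coe_le_partialValR_iff hr).1 (hN n h))
    gcongr
    exact min_le_left _ _
  · refine partialBall_mono (Real.exp_le_exp.2 ?_) (partialBall_anti h hγ)
    rw [le_div_iff₀ hr]
    have h1 : (m : ℝ) ≤ n := by exact_mod_cast hnm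
    have h2 := min_le_right 0 (r * γ + m)
    linarith

theorem IsOverAt.mem_gammaR (hs : 0 < s) (hsr : s < r) (hg : IsOverAt M r g) : g ∈ gammaR M s := by
  obtain ⟨c, hc⟩ := hg
  rw [mem_wBall] at hc
  rw [gammaR, Set.mem_ofPred_eq, EReal.tendsto_nhds_top_iff_real]
  intro x
  have h1 : 0 < 1 - s / r := by
    rw [sub_pos, div_lt_one (hs.trans hsr)]; exact hsr
  obtain ⟨N, hN⟩ := exists_int_gt ((x + 1 - s * c / r) / (1 - s / r))
  filter_upwards [Filter.eventually_ge_atTop N] with n hn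
  refine lt_of_lt_of_le (EReal.coe_lt_coe_iff.2 (lt_add_one x)) ?_
  rw [coe_le_partialValR_iff hs]
  refine partialBall_mono (Real.exp_le_exp.2 ?_) (hc n)
  have hn' : (N : ℝ) ≤ n := by exact_mod_cast hn
  have h2 := hN.trans_le hn'
  rw [div_lt_iff₀ h1] at h2
  have h3 : ((n : ℝ) - c) / r * s = n * (s / r) - s * c / r := by ring
  rw [le_div_iff₀ hs, h3]
  linarith

variable (M) in
/-- Cauchy sequences for all `w_s`, `0 < s ≤ r`. -/
def CauchyAt (r : ℝ) (g : ℕ → AlgFrac M) : Prop :=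
  (∀ m, IsOverAt M r (g m)) ∧ ∀ s, 0 < s → s ≤ r → ∀ ε > 0, ∃ N : ℕ, ∀ m ≥ N, ∀ n ≥ N,
    nrm M s (g m - g n) ≤ ε

variable (M) in
/-- Null sequences for all `w_s`, `0 < s ≤ r`. -/
def NullAt (r : ℝ) (g : ℕ → AlgFrac M) : Prop :=
  (∀ m, IsOverAt M r (g m)) ∧ ∀ s, 0 < s → s ≤ r → ∀ ε > 0, ∃ N : ℕ, ∀ m ≥ N, nrm M s (g m) ≤ ε

variable {u v : ℕ → AlgFrac M}

theorem CauchyAt.mono (hs : 0 < s) (hsr : s ≤ r) (hu : CauchyAt M r u) : CauchyAt M s u :=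
  ⟨fun m => (hu.1 m).mono hs hsr, fun t ht hts => hu.2 t ht (hts.trans hsr)⟩

theorem NullAt.mono (hs : 0 < s) (hsr : s ≤ r) (hu : NullAt M r u) : NullAt M s u :=
  ⟨fun m => (hu.1 m).mono hs hsr, fun t ht hts => hu.2 t ht (hts.trans hsr)⟩

theorem cauchyAt_const (hg : IsOverAt M r g) : CauchyAt M r fun _ => g :=
  ⟨fun _ => hg, fun s hs hsr ε hε => ⟨0, fun m _ n _ => by rw [sub_self, nrm_zero hs]; exact hε.le⟩⟩

theorem CauchyAt.add (hr : 0 < r) (hu : CauchyAt M r u) (hv : CauchyAt M r v) :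
    CauchyAt M r (u + v) := by
  refine ⟨fun m => (hu.1 m).add hr (hv.1 m), fun s hs hsr ε hε => ?_⟩
  obtain ⟨N₁, h₁⟩ := hu.2 s hs hsr ε hε
  obtain ⟨N₂, h₂⟩ := hv.2 s hs hsr ε hε
  refine ⟨max N₁ N₂, fun m hm n hn => ?_⟩
  rw [ge_iff_le, max_le_iff] at hm hn
  rw [Pi.add_apply, Pi.add_apply, add_sub_add_comm]
  refine (nrm_add_le hs ?_ ?_).trans (max_le (h₁ m hm.1 n hn.1) (h₂ m hm.2 n hn.2))
  · exact ((hu.1 m).mono hs hsr).sub hs ((hu.1 n).mono hs hsr)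
  · exact ((hv.1 m).mono hs hsr).sub hs ((hv.1 n).mono hs hsr)

theorem CauchyAt.neg (hu : CauchyAt M r u) : CauchyAt M r (-u) := by
  refine ⟨fun m => (hu.1 m).neg, fun s hs hsr ε hε => ?_⟩
  obtain ⟨N, h⟩ := hu.2 s hs hsr ε hε
  refine ⟨N, fun m hm n hn => ?_⟩
  rw [Pi.neg_apply, Pi.neg_apply, neg_sub_neg]
  exact h n hn m hm

theorem abs_nrm_sub_nrm_le (hr : 0 < r) (hg : IsOverAt M r g) (hh : IsOverAt M r h) :
    |nrm M r g - nrm M r h| ≤ nrm M r (g - h) := by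
  have h1 := nrm_add_le hr (hg.sub hr hh) hh
  rw [sub_add_cancel] at h1
  have h2 := nrm_sub_le hr hg (hg.sub hr hh)
  rw [sub_sub_cancel] at h2
  have h3 : 0 ≤ nrm M r (g - h) := nrm_nonneg
  have h4 : 0 ≤ nrm M r g := nrm_nonneg
  have h5 : 0 ≤ nrm M r h := nrm_nonneg
  have h6 := max_le_add_of_nonneg h3 h5
  have h7 := max_le_add_of_nonneg h4 h3
  rw [abs_le]
  constructor <;> linarith

theorem CauchyAt.exists_tendsto (hu : CauchyAt M r u) (hs : 0 < s) (hsr : s ≤ r) :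
    ∃ L, Filter.Tendsto (fun m => nrm M s (u m)) Filter.atTop (nhds L) := by
  apply cauchySeq_tendsto_of_complete
  rw [Metric.cauchySeq_iff]
  intro ε hε
  obtain ⟨N, hN⟩ := hu.2 s hs hsr (ε / 2) (by positivity)
  refine ⟨N, fun m hm n hn => ?_⟩
  rw [Real.dist_eq]
  refine ((abs_nrm_sub_nrm_le hs ((hu.1 m).mono hs hsr) ((hu.1 n).mono hs hsr)).trans
    (hN m hm n hn)).trans_lt (by linarith)

theorem CauchyAt.exists_bound (hu : CauchyAt M r u) (hs : 0 < s) (hsr : s ≤ r) :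
    ∃ K > 0, ∀ m, nrm M s (u m) ≤ K := by
  obtain ⟨L, hL⟩ := hu.exists_tendsto hs hsr
  obtain ⟨K, hK⟩ := hL.bddAbove_range
  exact ⟨max K 1, by positivity, fun m => le_max_of_le_left (hK ⟨m, rfl⟩)⟩

theorem CauchyAt.mul (hu : CauchyAt M r u) (hv : CauchyAt M r v) :
    CauchyAt M r (u * v) := by
  refine ⟨fun m => (hu.1 m).mul (hv.1 m), fun s hs hsr ε hε => ?_⟩
  obtain ⟨K₁, hK₁, h₁⟩ := hu.exists_bound hs hsr
  obtain ⟨K₂, hK₂, h₂⟩ := hv.exists_bound hs hsr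
  obtain ⟨N₁, h₃⟩ := hu.2 s hs hsr (ε / K₂) (by positivity)
  obtain ⟨N₂, h₄⟩ := hv.2 s hs hsr (ε / K₁) (by positivity)
  refine ⟨max N₁ N₂, fun m hm n hn => ?_⟩
  rw [ge_iff_le, max_le_iff] at hm hn
  have hu' := fun m => (hu.1 m).mono hs hsr
  have hv' := fun m => (hv.1 m).mono hs hsr
  have h5 : (u * v) m - (u * v) n = u m * (v m - v n) + (u m - u n) * v n := by
    simp only [Pi.mul_apply]; ring
  rw [h5]
  refine (nrm_add_le hs ((hu' m).mul ((hv' m).sub hs (hv' n)))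
    (((hu' m).sub hs (hu' n)).mul (hv' n))).trans (max_le ?_ ?_)
  · refine (nrm_mul_le hs (hu' m) ((hv' m).sub hs (hv' n))).trans
      ((mul_le_mul (h₁ m) (h₄ m hm.2 n hn.2) nrm_nonneg hK₁.le).trans_eq ?_)
    field_simp
  · refine (nrm_mul_le hs ((hu' m).sub hs (hu' n)) (hv' n)).trans
      ((mul_le_mul (h₃ m hm.1 n hn.1) (h₂ n) nrm_nonneg (by positivity)).trans_eq ?_)
    field_simp

theorem CauchyAt.frob (hu : CauchyAt M r u) :
    CauchyAt M (r / (p ^ S.f : ℕ)) fun m => frobFrac M (u m) := by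
  have hq := q_pos S
  refine ⟨fun m => ?_, fun s hs hsr ε hε => ?_⟩
  · rw [isOverAt_frobFrac_iff, mul_div_cancel₀ _ hq.ne']
    exact hu.1 m
  · rw [le_div_iff₀' hq] at hsr
    obtain ⟨N, hN⟩ := hu.2 _ (mul_pos hq hs) hsr ε hε
    refine ⟨N, fun m hm n hn => ?_⟩
    rw [← map_sub, nrm_frobFrac hs]
    exact hN m hm n hn

theorem NullAt.add (hr : 0 < r) (hu : NullAt M r u) (hv : NullAt M r v) : NullAt M r (u + v) := by
  refine ⟨fun m => (hu.1 m).add hr (hv.1 m), fun s hs hsr ε hε => ?_⟩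
  obtain ⟨N₁, h₁⟩ := hu.2 s hs hsr ε hε
  obtain ⟨N₂, h₂⟩ := hv.2 s hs hsr ε hε
  refine ⟨max N₁ N₂, fun m hm => ?_⟩
  rw [ge_iff_le, max_le_iff] at hm
  exact (nrm_add_le hs ((hu.1 m).mono hs hsr) ((hv.1 m).mono hs hsr)).trans
    (max_le (h₁ m hm.1) (h₂ m hm.2))

theorem CauchyAt.mul_null (hu : CauchyAt M r u) (hv : NullAt M r v) :
    NullAt M r (u * v) := by
  refine ⟨fun m => (hu.1 m).mul (hv.1 m), fun s hs hsr ε hε => ?_⟩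
  obtain ⟨K₁, hK₁, h₁⟩ := hu.exists_bound hs hsr
  obtain ⟨N₂, h₄⟩ := hv.2 s hs hsr (ε / K₁) (by positivity)
  refine ⟨N₂, fun m hm => ?_⟩
  refine (nrm_mul_le hs ((hu.1 m).mono hs hsr) ((hv.1 m).mono hs hsr)).trans
      ((mul_le_mul (h₁ m) (h₄ m hm) nrm_nonneg hK₁.le).trans_eq ?_)
  field_simp

theorem isFrechetCauchy_iff : IsFrechetCauchy M u ↔ ∃ r, 0 < r ∧ CauchyAt M r u := by
  constructor
  · rintro ⟨r, hr, h1, h2⟩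
    have h3 := fun m => isOverAt_of_mem_gammaR hr (h1 m)
    refine ⟨r, hr, h3, fun s hs hsr ε hε => ?_⟩
    obtain ⟨c, rfl⟩ := exists_rpow_eq S hε
    obtain ⟨N, hN⟩ := h2 s hs hsr c
    exact ⟨N, fun m hm n hn => nrm_le_rpow hs ((coe_le_wVal_iff hs).1 (hN m hm n hn))⟩
  · rintro ⟨r, hr, h1, h2⟩
    refine ⟨r / 2, by positivity, fun m => (h1 m).mem_gammaR (by positivity) (by linarith), ?_⟩
    intro s hs hsr C
    obtain ⟨N, hN⟩ := h2 s hs (by linarith) _ (Real.rpow_pos_of_pos (absUnif_pos S) C)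
    refine ⟨N, fun m hm n hn => (coe_le_wVal_iff hs).2 ((nrm_le_rpow_iff hs ?_).1 (hN m hm n hn))⟩
    exact ((h1 m).mono hs (by linarith)).sub hs ((h1 n).mono hs (by linarith))

theorem isFrechetNull_iff : IsFrechetNull M u ↔ ∃ r, 0 < r ∧ NullAt M r u := by
  constructor
  · rintro ⟨r, hr, h1, h2⟩
    have h3 := fun m => isOverAt_of_mem_gammaR hr (h1 m)
    refine ⟨r, hr, h3, fun s hs hsr ε hε => ?_⟩
    obtain ⟨c, rfl⟩ := exists_rpow_eq S hε
    obtain ⟨N, hN⟩ := h2 s hs hsr c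
    exact ⟨N, fun m hm => nrm_le_rpow hs ((coe_le_wVal_iff hs).1 (hN m hm))⟩
  · rintro ⟨r, hr, h1, h2⟩
    refine ⟨r / 2, by positivity, fun m => (h1 m).mem_gammaR (by positivity) (by linarith), ?_⟩
    intro s hs hsr C
    obtain ⟨N, hN⟩ := h2 s hs (by linarith) _ (Real.rpow_pos_of_pos (absUnif_pos S) C)
    exact ⟨N, fun m hm => (coe_le_wVal_iff hs).2
      ((nrm_le_rpow_iff hs ((h1 m).mono hs (by linarith))).1 (hN m hm))⟩

theorem mem_cauchyRing_iff : u ∈ cauchyRing M ↔ ∃ r, 0 < r ∧ CauchyAt M r u := by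
  constructor
  · intro h
    induction h using Subring.closure_induction with
    | mem x hx => exact isFrechetCauchy_iff.1 hx
    | zero => exact ⟨1, one_pos, cauchyAt_const isOverAt_zero⟩
    | one => exact ⟨1, one_pos, cauchyAt_const (isOverAt_one one_pos)⟩
    | add x y _ _ hx hy =>
      obtain ⟨r, hr, hx⟩ := hx
      obtain ⟨s, hs, hy⟩ := hy
      have hm := lt_min hr hs
      exact ⟨min r s, hm, (hx.mono hm (min_le_left _ _)).add hm (hy.mono hm (min_le_right _ _))⟩
    | neg x _ hx =>
      obtain ⟨r, hr, hx⟩ := hx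
      exact ⟨r, hr, hx.neg⟩
    | mul x y _ _ hx hy =>
      obtain ⟨r, hr, hx⟩ := hx
      obtain ⟨s, hs, hy⟩ := hy
      have hm := lt_min hr hs
      exact ⟨min r s, hm, (hx.mono hm (min_le_left _ _)).mul (hy.mono hm (min_le_right _ _))⟩
  · exact fun h => Subring.subset_closure (isFrechetCauchy_iff.2 h)

theorem mem_nullIdeal_iff {u : cauchyRing M} :
    u ∈ nullIdeal M ↔ ∃ r, 0 < r ∧ NullAt M r (u : ℕ → AlgFrac M) := by
  constructor
  · intro h
    induction h using Submodule.span_induction with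
    | mem x hx => exact isFrechetNull_iff.1 hx
    | zero => exact ⟨1, one_pos, fun _ => isOverAt_zero, fun s hs _ ε hε => ⟨0, fun m _ => by
        change nrm M s 0 ≤ ε
        rw [nrm_zero hs]; exact hε.le⟩⟩
    | add x y _ _ hx hy =>
      obtain ⟨r, hr, hx⟩ := hx
      obtain ⟨s, hs, hy⟩ := hy
      have hm := lt_min hr hs
      exact ⟨min r s, hm, (hx.mono hm (min_le_left _ _)).add hm (hy.mono hm (min_le_right _ _))⟩
    | smul a x _ hx =>
      obtain ⟨r, hr, hx⟩ := hx
      obtain ⟨s, hs, ha⟩ := mem_cauchyRing_iff.1 a.2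
      have hm := lt_min hr hs
      exact ⟨min r s, hm, (ha.mono hm (min_le_right _ _)).mul_null (hx.mono hm (min_le_left _ _))⟩
  · exact fun h => Ideal.subset_span (isFrechetNull_iff.2 h)

end Norms

end LogGrowth

/-! ### The norms `|·|_ρ` on the analytic ring -/

namespace LogGrowth

section AnalyticNorms

open Filter Topology

theorem eventually_pos_iff {P : ℝ → Prop} :
    (∀ᶠ r in 𝓝[>] (0 : ℝ), P r) ↔ ∃ r₀ > 0, ∀ r, 0 < r → r ≤ r₀ → P r := by
  rw [eventually_iff, mem_nhdsGT_iff_exists_Ioc_subset]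
  exact ⟨fun ⟨r₀, h0, h⟩ => ⟨r₀, h0, fun r hr hrr => h ⟨hr, hrr⟩⟩,
    fun ⟨r₀, h0, h⟩ => ⟨r₀, h0, fun r hr => h r hr.1 hr.2⟩⟩

theorem tendsto_mul_pos {c : ℝ} (hc : 0 < c) :
    Tendsto (fun r : ℝ => c * r) (𝓝[>] (0 : ℝ)) (𝓝[>] (0 : ℝ)) := by
  refine tendsto_nhdsWithin_iff.2 ⟨?_, ?_⟩
  · have : Tendsto (fun r : ℝ => c * r) (𝓝 0) (𝓝 (c * 0)) := (continuous_const_mul c).tendsto 0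
    rw [mul_zero] at this
    exact this.mono_left nhdsWithin_le_nhds
  · filter_upwards [self_mem_nhdsWithin] with r hr using mul_pos hc hr

variable {p : ℕ} [Fact p.Prime] {O : Type u} [CommRing O] [IsDomain O] [IsDiscreteValuationRing O]
  [CharZero O] [CharP (ResField O) p] {S : FrobDatum p O} {M : AlgLift S}

variable {r s c d : ℝ} {g h : AlgFrac M} {u v : ℕ → AlgFrac M} {y z : GammaAnCon M}

theorem repSeq_mem (y : GammaAnCon M) : repSeq M y ∈ cauchyRing M :=
  (Function.surjInv (Ideal.Quotient.mk_surjective (I := nullIdeal M)) y).2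

theorem limSeq_eq_mk (hu : u ∈ cauchyRing M) :
    limSeq M u = Ideal.Quotient.mk (nullIdeal M) ⟨u, hu⟩ := dif_pos hu

theorem limSeq_repSeq (y : GammaAnCon M) : limSeq M (repSeq M y) = y := by
  rw [limSeq_eq_mk (repSeq_mem y)]
  exact Function.surjInv_eq _ y

theorem limSeq_add (hu : u ∈ cauchyRing M) (hv : v ∈ cauchyRing M) :
    limSeq M (u + v) = limSeq M u + limSeq M v := by
  rw [limSeq_eq_mk hu, limSeq_eq_mk hv, limSeq_eq_mk (add_mem hu hv)]
  rfl

theorem limSeq_mul (hu : u ∈ cauchyRing M) (hv : v ∈ cauchyRing M) :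
    limSeq M (u * v) = limSeq M u * limSeq M v := by
  rw [limSeq_eq_mk hu, limSeq_eq_mk hv, limSeq_eq_mk (mul_mem hu hv)]
  rfl

theorem limSeq_one : limSeq M 1 = 1 := by
  rw [limSeq_eq_mk (one_mem _)]
  rfl

theorem limSeq_eq_iff (hu : u ∈ cauchyRing M) (hv : v ∈ cauchyRing M) :
    limSeq M u = limSeq M v ↔ ∃ r, 0 < r ∧ NullAt M r (u - v) := by
  rw [limSeq_eq_mk hu, limSeq_eq_mk hv, Ideal.Quotient.mk_eq_mk_iff_sub_mem, mem_nullIdeal_iff]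
  rfl

theorem eventually_cauchyAt (hu : u ∈ cauchyRing M) : ∀ᶠ r in 𝓝[>] (0 : ℝ), CauchyAt M r u := by
  obtain ⟨r₀, hr₀, h⟩ := mem_cauchyRing_iff.1 hu
  exact eventually_pos_iff.2 ⟨r₀, hr₀, fun r hr hrr => h.mono hr hrr⟩

theorem frobFrac_mem_cauchyRing (hu : u ∈ cauchyRing M) :
    (fun m => frobFrac M (u m)) ∈ cauchyRing M := by
  obtain ⟨r₀, hr₀, h⟩ := mem_cauchyRing_iff.1 hu
  exact mem_cauchyRing_iff.2 ⟨_, div_pos hr₀ (q_pos S), h.frob⟩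

variable (M) in
/-- The norm `|y|_ρ` on the analytic ring as a function of `r`, where `ρ = p ^ (-r)`. -/
noncomputable def normAn (r : ℝ) (y : GammaAnCon M) : ℝ := absAn M ((p : ℝ) ^ (-r)) y

/-- For `ρ` close to `1`, the norm `|y|_ρ` is the limit of the norms along any sequence with
limit `y`, not only along the chosen one. -/
theorem eventually_tendsto_nrm (hu : u ∈ cauchyRing M) (hy : limSeq M u = y) :
    ∀ᶠ r in 𝓝[>] (0 : ℝ), Tendsto (fun m => nrm M r (u m)) atTop (𝓝 (normAn M r y)) := by
  have hrep := repSeq_mem y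
  obtain ⟨r₁, hr₁, h₁⟩ := (limSeq_eq_iff hu hrep).1 (hy.trans (limSeq_repSeq y).symm)
  filter_upwards [eventually_cauchyAt hu, eventually_cauchyAt hrep, self_mem_nhdsWithin,
    eventually_pos_iff.2 ⟨r₁, hr₁, fun r _ h => h⟩] with r hu hrep (hr : 0 < r) hrr
  obtain ⟨L, hL⟩ := hrep.exists_tendsto hr le_rfl
  have h2 : normAn M r y = L := hL.limUnder_eq
  rw [h2]
  have h3 : Tendsto (fun m => nrm M r (u m) - nrm M r (repSeq M y m)) atTop (𝓝 0) := by
    rw [Metric.tendsto_atTop]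
    intro ε hε
    obtain ⟨N, hN⟩ := h₁.2 r hr hrr (ε / 2) (by positivity)
    refine ⟨N, fun m hm => ?_⟩
    rw [Real.dist_eq, sub_zero]
    exact ((abs_nrm_sub_nrm_le hr (hu.1 m) (hrep.1 m)).trans (hN m hm)).trans_lt (by linarith)
  have h4 := h3.add hL
  simpa using h4

theorem eventually_tendsto_repSeq (y : GammaAnCon M) : ∀ᶠ r in 𝓝[>] (0 : ℝ),
    Tendsto (fun m => nrm M r (repSeq M y m)) atTop (𝓝 (normAn M r y)) :=
  eventually_tendsto_nrm (repSeq_mem y) (limSeq_repSeq y)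

theorem eventually_normAn_nonneg (y : GammaAnCon M) : ∀ᶠ r in 𝓝[>] (0 : ℝ), 0 ≤ normAn M r y := by
  filter_upwards [eventually_tendsto_repSeq y] with r h
  exact ge_of_tendsto' h fun _ => nrm_nonneg

theorem eventually_normAn_zero : ∀ᶠ r in 𝓝[>] (0 : ℝ), normAn M r 0 = 0 := by
  have h0 : limSeq M (0 : ℕ → AlgFrac M) = 0 := by
    rw [limSeq_eq_mk (zero_mem _)]
    exact map_zero _
  filter_upwards [eventually_tendsto_nrm (zero_mem _) h0, self_mem_nhdsWithin] with r h (hr : 0 < r)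
  refine tendsto_nhds_unique h ?_
  simp [nrm_zero hr]

theorem eventually_normAn_add_le (y z : GammaAnCon M) :
    ∀ᶠ r in 𝓝[>] (0 : ℝ), normAn M r (y + z) ≤ max (normAn M r y) (normAn M r z) := by
  have hy := repSeq_mem y
  have hz := repSeq_mem z
  filter_upwards [eventually_tendsto_nrm (add_mem hy hz) (by
      rw [limSeq_add hy hz, limSeq_repSeq, limSeq_repSeq]), eventually_tendsto_repSeq y,
    eventually_tendsto_repSeq z, eventually_cauchyAt hy, eventually_cauchyAt hz,
    self_mem_nhdsWithin] with r h1 h2 h3 h4 h5 (hr : 0 < r)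
  exact le_of_tendsto_of_tendsto' h1 (h2.max h3) fun m => nrm_add_le hr (h4.1 m) (h5.1 m)

theorem eventually_normAn_mul_le (y z : GammaAnCon M) :
    ∀ᶠ r in 𝓝[>] (0 : ℝ), normAn M r (y * z) ≤ normAn M r y * normAn M r z := by
  have hy := repSeq_mem y
  have hz := repSeq_mem z
  filter_upwards [eventually_tendsto_nrm (mul_mem hy hz) (by
      rw [limSeq_mul hy hz, limSeq_repSeq, limSeq_repSeq]), eventually_tendsto_repSeq y,
    eventually_tendsto_repSeq z, eventually_cauchyAt hy, eventually_cauchyAt hz,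
    self_mem_nhdsWithin] with r h1 h2 h3 h4 h5 (hr : 0 < r)
  exact le_of_tendsto_of_tendsto' h1 (h2.mul h3) fun m => nrm_mul_le hr (h4.1 m) (h5.1 m)

theorem eventually_normAn_frobAn (y : GammaAnCon M) :
    ∀ᶠ r in 𝓝[>] (0 : ℝ), normAn M r (frobAn M y) = normAn M ((p ^ S.f : ℕ) * r) y := by
  filter_upwards [eventually_tendsto_nrm (frobFrac_mem_cauchyRing (repSeq_mem y)) rfl,
    (tendsto_mul_pos (q_pos S)).eventually (eventually_tendsto_repSeq y),
    self_mem_nhdsWithin] with r h1 h2 (hr : 0 < r)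
  simp only [nrm_frobFrac hr] at h1
  exact tendsto_nhds_unique h1 h2

theorem eventually_normAn_neg (y : GammaAnCon M) :
    ∀ᶠ r in 𝓝[>] (0 : ℝ), normAn M r (-y) = normAn M r y := by
  have hy := repSeq_mem y
  have h1 : limSeq M (-repSeq M y) = -y := by
    conv_rhs => rw [← limSeq_repSeq y]
    rw [limSeq_eq_mk hy, limSeq_eq_mk (neg_mem hy)]
    rfl
  filter_upwards [eventually_tendsto_nrm (neg_mem hy) h1, eventually_tendsto_repSeq y,
    eventually_cauchyAt hy, self_mem_nhdsWithin] with r h1 h2 h3 (hr : 0 < r)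
  refine tendsto_nhds_unique h1 (h2.congr fun m => ?_)
  rw [Pi.neg_apply, nrm_neg hr (h3.1 m)]

theorem exists_normAn_le_max (y : GammaAnCon M) : ∃ r₀ > 0, ∀ a r b, 0 < a → a ≤ r → r ≤ b →
    b ≤ r₀ → normAn M r y ≤ max (normAn M a y) (normAn M b y) := by
  obtain ⟨r₀, hr₀, h⟩ := eventually_pos_iff.1
    ((eventually_tendsto_repSeq y).and (eventually_cauchyAt (repSeq_mem y)))
  refine ⟨r₀, hr₀, fun a r b ha har hrb hb => ?_⟩
  have hr := ha.trans_le har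
  have hb' := hr.trans_le hrb
  exact le_of_tendsto_of_tendsto' (h r hr (hrb.trans hb)).1
    ((h a ha (har.trans (hrb.trans hb))).1.max (h b hb' hb).1)
    fun m => nrm_le_max ha har hrb ((h b hb' hb).2.1 m)

theorem eq_zero_of_eventually_normAn (hy : ∀ᶠ r in 𝓝[>] (0 : ℝ), normAn M r y = 0) : y = 0 := by
  obtain ⟨r₀, hr₀, h⟩ := eventually_pos_iff.1
    (((eventually_tendsto_repSeq y).and (eventually_cauchyAt (repSeq_mem y))).and hy)
  have h0 : limSeq M (0 : ℕ → AlgFrac M) = 0 := by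
    rw [limSeq_eq_mk (zero_mem _)]
    exact map_zero _
  rw [← h0, ← limSeq_repSeq y, limSeq_eq_iff (repSeq_mem y) (zero_mem _)]
  refine ⟨r₀, hr₀, fun m => ?_, fun s hs hsr ε hε => ?_⟩
  · rw [sub_zero]
    exact (h r₀ hr₀ le_rfl).1.2.1 m
  · have h1 := (h s hs hsr).1.1
    rw [(h s hs hsr).2] at h1
    obtain ⟨N, hN⟩ := eventually_atTop.1 (h1.eventually (ge_mem_nhds hε))
    exact ⟨N, fun m hm => by rw [sub_zero]; exact hN m hm⟩

/-- By log-convexity of `r ↦ |y|_ρ`, the norms of a nonzero element do not tend to zero as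
`ρ ↑ 1`. -/
theorem exists_le_normAn (hy : y ≠ 0) : ∃ c > 0, ∀ᶠ r in 𝓝[>] (0 : ℝ), c ≤ normAn M r y := by
  obtain ⟨r₀, hr₀, h⟩ := eventually_pos_iff.1 (((eventually_tendsto_repSeq y).and
    (eventually_cauchyAt (repSeq_mem y))).and (eventually_normAn_nonneg y))
  obtain ⟨b, hb, hbr, hb0⟩ : ∃ b, 0 < b ∧ b ≤ r₀ / 2 ∧ normAn M b y ≠ 0 := by
    by_contra! hcon
    exact hy (eq_zero_of_eventually_normAn
      (eventually_pos_iff.2 ⟨r₀ / 2, by positivity, fun r hr hrr => hcon r hr hrr⟩))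
  have hbpos : 0 < normAn M b y := lt_of_le_of_ne (h b hb (by linarith)).2 hb0.symm
  set K := max (normAn M b y) (normAn M (2 * b) y) with hK
  have hKpos : 0 < K := lt_max_of_lt_left hbpos
  refine ⟨normAn M b y ^ 2 / K, by positivity, eventually_pos_iff.2 ⟨b, hb, fun a ha hab => ?_⟩⟩
  have hx : 0 < 2 * b - a := by linarith
  have hxr : 2 * b - a ≤ r₀ := by linarith
  have h2 : normAn M b y ^ 2 ≤ normAn M a y * normAn M (2 * b - a) y := by
    refine le_of_tendsto_of_tendsto' ((h b hb (by linarith)).1.1.pow 2)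
      ((h a ha (by linarith)).1.1.mul (h _ hx hxr).1.1) fun m => ?_
    have := nrm_midpoint_sq_le ha (show a ≤ 2 * b - a by linarith) ((h _ hx hxr).1.2.1 m)
    rwa [add_sub_cancel, mul_div_cancel_left₀ b two_ne_zero] at this
  have h3 : normAn M (2 * b - a) y ≤ K := by
    refine le_of_tendsto_of_tendsto' (h _ hx hxr).1.1
      ((h b hb (by linarith)).1.1.max (h (2 * b) (by linarith) (by linarith)).1.1) fun m => ?_
    exact nrm_le_max hb (by linarith) (by linarith)
      ((h (2 * b) (by linarith) (by linarith)).1.2.1 m)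
  rw [div_le_iff₀ hKpos]
  exact h2.trans (mul_le_mul_of_nonneg_left h3 (h a ha (by linarith)).2)

theorem eventually_normAn_sum_le {ι : Type*} (t : Finset ι) {y : ι → GammaAnCon M} {B : ℝ → ℝ}
    (hB : ∀ᶠ r in 𝓝[>] (0 : ℝ), 0 ≤ B r)
    (h : ∀ i ∈ t, ∀ᶠ r in 𝓝[>] (0 : ℝ), normAn M r (y i) ≤ B r) :
    ∀ᶠ r in 𝓝[>] (0 : ℝ), normAn M r (∑ i ∈ t, y i) ≤ B r := by
  classical
  induction t using Finset.induction_on with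
  | empty =>
    filter_upwards [hB, eventually_normAn_zero (M := M)] with r h1 h2
    rwa [Finset.sum_empty, h2]
  | insert i t hi ih =>
    rw [Finset.sum_insert hi]
    filter_upwards [eventually_normAn_add_le (y i) (∑ i ∈ t, y i), h i (Finset.mem_insert_self i t),
      ih fun j hj => h j (Finset.mem_insert_of_mem hj)] with r h1 h2 h3
    exact h1.trans (max_le h2 h3)

end AnalyticNorms

end LogGrowth

/-! ### Overconvergent constants and the series `σ(log x) - q log x` -/

namespace LogGrowth

section Constants

open Filter Topology

variable {p : ℕ} [Fact p.Prime] {O : Type u} [CommRing O] [IsDomain O] [IsDiscreteValuationRing O]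
  [CharZero O] [CharP (ResField O) p] {S : FrobDatum p O} {M : AlgLift S}

variable {r s c d : ℝ} {g h a : AlgFrac M}

theorem const_mem_cauchyRing (ha : a ∈ gammaCon M) : (fun _ => a) ∈ cauchyRing M := by
  obtain ⟨r, hr, ha⟩ := ha
  exact mem_cauchyRing_iff.2 ⟨r, hr, cauchyAt_const (isOverAt_of_mem_gammaR hr ha)⟩

theorem mem_gammaCon_of_forall_mem_wBall {r₁ : ℝ} (hr₁ : 0 < r₁)
    (h : ∀ r, 0 < r → r ≤ r₁ → ∃ c, g ∈ wBall M r c) : g ∈ gammaCon M :=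
  ⟨r₁ / 2, by positivity, IsOverAt.mem_gammaR (by positivity) (by linarith) (h r₁ hr₁ le_rfl)⟩

theorem eventually_normAn_ofCon (ha : a ∈ gammaCon M) :
    ∀ᶠ r in 𝓝[>] (0 : ℝ), normAn M r (ofCon M a) = nrm M r a := by
  filter_upwards [eventually_tendsto_nrm (const_mem_cauchyRing ha) rfl] with r h
  exact tendsto_nhds_unique h tendsto_const_nhds

theorem ofCon_mul (hg : g ∈ gammaCon M) (hh : h ∈ gammaCon M) :
    ofCon M (g * h) = ofCon M g * ofCon M h :=
  limSeq_mul (const_mem_cauchyRing hg) (const_mem_cauchyRing hh)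

theorem ofCon_one : ofCon M 1 = 1 := limSeq_one

theorem ofCon_natCast (n : ℕ) : ofCon M (n : AlgFrac M) = (n : GammaAnCon M) := by
  have h : (n : ℕ → AlgFrac M) ∈ cauchyRing M := natCast_mem _ n
  exact (limSeq_eq_mk h).trans (map_natCast (Ideal.Quotient.mk (nullIdeal M)) n)

theorem absAt_one_zpow_mul {m : ℤ} {b : M.carrier} (hb : M.red b ≠ 0) :
    absAt M 1 (unifFrac M ^ m * M.toFrac b) = absUnif S ^ (m : ℝ) := by
  have h0 : -Real.logb (p : ℝ) 1 = 0 := by rw [Real.logb_one, neg_zero]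
  have hw : wVal M 0 (unifFrac M ^ m * M.toFrac b) = ((m : ℝ) : EReal) := by
    have htop : ∀ n < m, partialVal M n (unifFrac M ^ m * M.toFrac b) = ⊤ := fun n hn =>
      top_le_iff.1 (EReal.le_of_forall_coe_le fun γ _ =>
        coe_le_partialVal_iff.2 (zpow_mul_mem_partialBall_of_lt hn b))
    have hne : partialVal M m (unifFrac M ^ m * M.toFrac b) ≠ ⊤ := by
      intro ht
      refine hb ((algAbs O).eq_zero.1 (le_antisymm ?_ ((algAbs O).nonneg _)))
      refine le_of_forall_gt_imp_ge_of_dense fun ε hε => ?_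
      have h1 : ((-Real.log ε : ℝ) : EReal) ≤ partialVal M m (unifFrac M ^ m * M.toFrac b) :=
        ht ▸ le_top
      rw [coe_le_partialVal_iff, neg_neg, Real.exp_log hε] at h1
      obtain ⟨b', hb', a, rfl⟩ := exists_eq_of_mem_partialBall hε.le (Int.le_add_one le_rfl) h1
      have h2 : M.red (M.unif ^ (m + 1 - m).toNat * a) = 0 := by
        rw [M.red_eq_zero_iff]
        exact Dvd.dvd.mul_right (dvd_pow_self _ (by omega)) _
      rw [map_add, h2, add_zero]
      exact AlgLift.algAbs_red_le hε.le hb'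
    refine le_antisymm ((iInf_le _ m).trans_eq ?_) (le_iInf fun n => ?_)
    · rw [partialValR, if_pos rfl, if_neg hne]
    · rw [partialValR, if_pos rfl]
      rcases lt_or_ge n m with h | h
      · rw [if_pos (htop n h)]
        exact le_top
      · split_ifs
        · exact le_top
        · exact EReal.coe_le_coe_iff.2 (by exact_mod_cast h)
  rw [absAt, h0, hw, if_neg (EReal.coe_ne_top _), EReal.toReal_coe]

theorem absUnif_rpow_sub_mul (x C r : ℝ) :
    absUnif S ^ (x - C * r) = absUnif S ^ x * Real.exp (-C * Real.log (absUnif S) * r) := by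
  rw [Real.rpow_sub (absUnif_pos S), div_eq_mul_inv, ← Real.rpow_neg (absUnif_pos S).le,
    Real.rpow_def_of_pos (absUnif_pos S) (-(C * r))]
  congr 2
  ring

/-- For small `r`, the norms `|·|_ρ` of an overconvergent element and of its inverse exceed the
`π`-adic absolute values at most by a factor `e ^ (C r)`. -/
theorem exists_normAn_ofCon_le (ha : a ∈ gammaCon M) (ha0 : a ≠ 0) : 0 < absAt M 1 a ∧
    ofCon M a⁻¹ * ofCon M a = 1 ∧ ∃ C : ℝ, ∀ᶠ r in 𝓝[>] (0 : ℝ),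
      normAn M r (ofCon M a) ≤ absAt M 1 a * Real.exp (C * r) ∧
      normAn M r (ofCon M a⁻¹) ≤ (absAt M 1 a)⁻¹ * Real.exp (C * r) := by
  have hθ := absUnif_pos S
  have hae := ha
  obtain ⟨r₀, hr₀, hao⟩ := ha
  obtain ⟨c, hc⟩ := isOverAt_of_mem_gammaR hr₀ hao
  obtain ⟨m, b, hb, hab⟩ := exists_eq_zpow_mul_unit ha0
  have habs : absAt M 1 a = absUnif S ^ (m : ℝ) := hab ▸ absAt_one_zpow_mul hb
  rw [hab] at hc
  obtain ⟨C₁, h₁⟩ := exists_forall_mem_wBall hr₀ hc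
  obtain ⟨C₂, r₁, hr₁, h₂⟩ := exists_forall_inv_mem_wBall hb hr₀ hc
  rw [← hab] at h₁ h₂
  have hinv : a⁻¹ ∈ gammaCon M :=
    mem_gammaCon_of_forall_mem_wBall hr₁ fun r hr hrr => ⟨_, h₂ r hr hrr⟩
  refine ⟨habs ▸ Real.rpow_pos_of_pos hθ _, ?_, ?_⟩
  · rw [← ofCon_mul hinv hae, inv_mul_cancel₀ ha0, ofCon_one]
  refine ⟨max (-C₁ * Real.log (absUnif S)) (-C₂ * Real.log (absUnif S)), ?_⟩
  filter_upwards [eventually_normAn_ofCon hae, eventually_normAn_ofCon hinv,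
    eventually_pos_iff.2 ⟨_, lt_min hr₀ hr₁, fun r hr hrr => And.intro hr (le_min_iff.1 hrr)⟩]
    with r h3 h4 ⟨hr, hr0, hr1⟩
  rw [h3, h4, habs, ← Real.rpow_neg hθ.le]
  constructor
  · refine (nrm_le_rpow hr (h₁ r hr hr0)).trans ?_
    rw [absUnif_rpow_sub_mul]
    gcongr
    exact le_max_left _ _
  · refine (nrm_le_rpow hr (h₂ r hr hr1)).trans ?_
    rw [absUnif_rpow_sub_mul]
    gcongr
    exact le_max_right _ _

/-- A positive integer `i` is `π ^ (e v_p(i))` times a unit of `O`, so that `w_r(1 / i) ≥ -e v_p(i)`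
for all `r`. -/
theorem exists_natCast_inv_mem_wBall (M : AlgLift S) : ∃ e : ℕ,
    absUnif S ^ (e : ℝ) = (p : ℝ)⁻¹ ∧ (p : AlgFrac M) ≠ 0 ∧ ∀ r, 0 < r →
      ((p : AlgFrac M) ∈ wBall M r e ∧
      ∀ i : ℕ, i ≠ 0 → (i : AlgFrac M)⁻¹ ∈ wBall M r (-(e * padicValNat p i))) := by
  obtain ⟨e, he0, he, habs⟩ := exists_ramification S
  have hp : p.Prime := Fact.out
  refine ⟨e, ?_, ?_⟩
  · rw [habs, ← Real.rpow_mul (Nat.cast_nonneg p), div_mul_cancel₀ _ (by positivity),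
      Real.rpow_neg_one]
  have hC : ∀ r, 0 < r → ∀ o : O, M.toFrac (M.incl (PowerSeries.C o)) ∈ wBall M r 0 :=
    fun r hr o => perf_mem_wBall hr (M.incl_mem_perf _)
  obtain ⟨w, hw⟩ := he
  -- `p` is a power of `π` up to units
  have hp1 : (p : AlgFrac M) * M.toFrac (M.incl (PowerSeries.C (w : O))) = unifFrac M ^ (e : ℤ) := by
    rw [zpow_natCast, unifFrac, ← map_pow, ← map_pow, ← map_pow, ← hw]
    simp only [map_mul, map_natCast]
  have hp2 : (p : AlgFrac M) =
      unifFrac M ^ (e : ℤ) * M.toFrac (M.incl (PowerSeries.C ((w⁻¹ : Oˣ) : O))) := by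
    rw [← hp1, mul_assoc, ← map_mul, ← map_mul, ← map_mul, Units.mul_inv, map_one, map_one, map_one,
      mul_one]
  have hp0 : (p : AlgFrac M) ≠ 0 := by
    intro h
    rw [h, zero_mul] at hp1
    exact zpow_ne_zero _ (unifFrac_ne_zero M) hp1.symm
  have hp3 : (p : AlgFrac M)⁻¹ =
      unifFrac M ^ (-(e : ℤ)) * M.toFrac (M.incl (PowerSeries.C (w : O))) := by
    refine inv_eq_of_mul_eq_one_right ?_
    rw [mul_left_comm, hp1, ← zpow_add₀ (unifFrac_ne_zero M), neg_add_cancel, zpow_zero]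
  refine ⟨hp0, fun r hr => ?_⟩
  have hpinv : (p : AlgFrac M)⁻¹ ∈ wBall M r (-e) := by
    have := mul_mem_wBall (unifFrac_zpow_mem_wBall hr (-(e : ℤ))) (hC r hr w)
    rw [← hp3] at this
    simpa using this
  constructor
  · have := mul_mem_wBall (unifFrac_zpow_mem_wBall hr (e : ℤ)) (hC r hr (w⁻¹ : Oˣ))
    rw [← hp2] at this
    simpa using this
  · intro i hi
    obtain ⟨k, hk⟩ : p ^ padicValNat p i ∣ i := pow_padicValNat_dvd
    have hkp : ¬ p ∣ k := by
      rintro ⟨l, rfl⟩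
      exact pow_succ_padicValNat_not_dvd hi ⟨l, by rw [pow_succ, mul_assoc]; exact hk⟩
    -- the prime-to-`p` part of `i` is a unit of `O`
    have hku : IsUnit (k : O) := by
      rw [← IsLocalRing.residue_ne_zero_iff_isUnit, map_natCast]
      exact fun h => hkp ((CharP.cast_eq_zero_iff (ResField O) p k).1 h)
    obtain ⟨κ, hκ⟩ := hku
    have hkinv : (k : AlgFrac M)⁻¹ = M.toFrac (M.incl (PowerSeries.C ((κ⁻¹ : Oˣ) : O))) := by
      have h1 : (k : AlgFrac M) = M.toFrac (M.incl (PowerSeries.C (κ : O))) := by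
        rw [hκ]; simp only [map_natCast]
      refine inv_eq_of_mul_eq_one_right ?_
      rw [h1, ← map_mul, ← map_mul, ← map_mul, Units.mul_inv, map_one, map_one, map_one]
    have h2 : (i : AlgFrac M)⁻¹ = ((p : AlgFrac M)⁻¹) ^ padicValNat p i * (k : AlgFrac M)⁻¹ := by
      conv_lhs => rw [hk]
      rw [Nat.cast_mul, Nat.cast_pow, mul_inv, inv_pow]
    have h3 := mul_mem_wBall (pow_mem_wBall hr hpinv (padicValNat p i)) (hkinv ▸ hC r hr (κ⁻¹ : Oˣ))
    rw [← h2] at h3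
    convert h3 using 2
    ring

theorem eventually_normAn_q_le :
    ∀ᶠ r in 𝓝[>] (0 : ℝ), normAn M r ((p ^ S.f : ℕ) : GammaAnCon M) ≤ ((p ^ S.f : ℕ) : ℝ)⁻¹ := by
  obtain ⟨e, he, -, h⟩ := exists_natCast_inv_mem_wBall M
  have hmem : ∀ r, 0 < r → ((p ^ S.f : ℕ) : AlgFrac M) ∈ wBall M r (S.f * e) := fun r hr => by
    rw [Nat.cast_pow]
    exact pow_mem_wBall hr (h r hr).1 _
  have hcon : ((p ^ S.f : ℕ) : AlgFrac M) ∈ gammaCon M :=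
    mem_gammaCon_of_forall_mem_wBall one_pos fun r hr _ => ⟨_, hmem r hr⟩
  filter_upwards [eventually_normAn_ofCon hcon, self_mem_nhdsWithin] with r h1 (hr : 0 < r)
  rw [← ofCon_natCast, h1]
  refine (nrm_le_rpow hr (hmem r hr)).trans_eq ?_
  rw [mul_comm, Real.rpow_mul (absUnif_pos S).le, he, Real.rpow_natCast, Nat.cast_pow, inv_pow]

theorem exists_q_inverse (M : AlgLift S) : ∃ κ : GammaAnCon M,
    κ * ((p ^ S.f : ℕ) : GammaAnCon M) = 1 ∧
    ∀ᶠ r in 𝓝[>] (0 : ℝ), normAn M r κ ≤ ((p ^ S.f : ℕ) : ℝ) := by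
  obtain ⟨e, he, hpne, h⟩ := exists_natCast_inv_mem_wBall M
  have hp0 : p ≠ 0 := (Fact.out : p.Prime).ne_zero
  have hmem : ∀ r, 0 < r → ((p ^ S.f : ℕ) : AlgFrac M)⁻¹ ∈ wBall M r (-(e * S.f)) := fun r hr => by
    have := (h r hr).2 (p ^ S.f) (pow_ne_zero _ hp0)
    rwa [padicValNat.prime_pow] at this
  have hmem' : ∀ r, 0 < r → ((p ^ S.f : ℕ) : AlgFrac M) ∈ wBall M r (S.f * e) := fun r hr => by
    rw [Nat.cast_pow]
    exact pow_mem_wBall hr (h r hr).1 _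
  have hcon : ((p ^ S.f : ℕ) : AlgFrac M)⁻¹ ∈ gammaCon M :=
    mem_gammaCon_of_forall_mem_wBall one_pos fun r hr _ => ⟨_, hmem r hr⟩
  have hcon' : ((p ^ S.f : ℕ) : AlgFrac M) ∈ gammaCon M :=
    mem_gammaCon_of_forall_mem_wBall one_pos fun r hr _ => ⟨_, hmem' r hr⟩
  have hq0 : ((p ^ S.f : ℕ) : AlgFrac M) ≠ 0 := by
    rw [Nat.cast_pow]
    exact pow_ne_zero _ hpne
  refine ⟨ofCon M ((p ^ S.f : ℕ) : AlgFrac M)⁻¹, ?_, ?_⟩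
  · rw [← ofCon_natCast, ← ofCon_mul hcon hcon', inv_mul_cancel₀ hq0, ofCon_one]
  filter_upwards [eventually_normAn_ofCon hcon, self_mem_nhdsWithin] with r h1 (hr : 0 < r)
  rw [h1]
  refine (nrm_le_rpow hr (hmem r hr)).trans_eq ?_
  rw [Real.rpow_neg (absUnif_pos S).le, Real.rpow_mul (absUnif_pos S).le, he, Real.rpow_natCast,
    Nat.cast_pow, inv_pow, inv_inv]

/-- The element `σ(x) / x ^ q - 1` is divisible by `π`, so that its `w_r` tends to at least `1` as
`r` tends to `0`. -/
theorem exists_frob_var_mem_wBall (M : AlgLift S) : ∃ r₀ > 0, ∀ r, 0 < r → r ≤ r₀ →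
    frobFrac M (varFrac M) / varFrac M ^ p ^ S.f - 1 ∈ wBall M r (1 / 2) := by
  obtain ⟨h, hh⟩ := S.sigmaX_X
  have hred : M.red (M.incl PowerSeries.X) ≠ 0 := by
    rw [M.red_incl]
    intro h0
    have h1 := algAbs_reduction_X (O := O)
    rw [h0, map_zero] at h1
    exact (Real.exp_pos _).ne h1
  have hx : unifFrac M ^ (0 : ℤ) * M.toFrac (M.incl PowerSeries.X) = varFrac M := by
    rw [zpow_zero, one_mul]; rfl
  have hx1 : varFrac M ∈ wBall M 1 0 := perf_mem_wBall one_pos (M.incl_mem_perf _)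
  have hx0 : varFrac M ≠ 0 := by
    intro h0
    have h1 : M.incl PowerSeries.X = 0 :=
      M.toFrac_injective (h0.trans (map_zero _).symm)
    exact hred (by rw [h1, map_zero])
  obtain ⟨C, r₁, hr₁, hC⟩ := exists_forall_inv_mem_wBall hred one_pos (hx.symm ▸ hx1)
  rw [hx] at hC
  have hε : frobFrac M (varFrac M) / varFrac M ^ p ^ S.f - 1 =
      unifFrac M ^ (1 : ℤ) * M.toFrac (M.incl h) * (varFrac M)⁻¹ ^ p ^ S.f := by
    have h1 : frobFrac M (varFrac M) - varFrac M ^ p ^ S.f =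
        unifFrac M ^ (1 : ℤ) * M.toFrac (M.incl h) := by
      have h2 := congrArg (fun t => M.toFrac (M.incl t)) hh
      simp only [map_sub, map_mul, map_pow] at h2
      rw [zpow_one]
      refine Eq.trans ?_ h2
      change frobFrac M (M.toFrac (M.incl PowerSeries.X)) - _ = _
      rw [frobFrac_toFrac, M.frob_incl]
      rfl
    rw [← h1, inv_pow, ← div_eq_mul_inv, sub_div, div_self (pow_ne_zero _ hx0)]
  set q : ℝ := ((p ^ S.f : ℕ) : ℝ)
  have hq0 : 0 < q := q_pos S
  refine ⟨min r₁ (1 / (2 * q * (|C| + 1))), by positivity, fun r hr hrr => ?_⟩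
  obtain ⟨hrr₁, hr₂⟩ := le_min_iff.1 hrr
  have h3 := mul_mem_wBall (mul_mem_wBall (unifFrac_zpow_mem_wBall hr 1)
    (perf_mem_wBall hr (M.incl_mem_perf h))) (pow_mem_wBall hr (hC r hr hrr₁) (p ^ S.f))
  rw [← hε] at h3
  refine wBall_anti hr ?_ h3
  rw [le_div_iff₀ (by positivity)] at hr₂
  have h4 : q * C * r ≤ q * |C| * r := by
    gcongr
    exact le_abs_self C
  have h5 : 0 < r * q := mul_pos hr hq0
  simp only [Int.cast_one, Int.cast_zero]
  nlinarith

/-- The terms of the series for `σ(log x) - q log x`: the powers of `σ(x) / x ^ q - 1` outweigh the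
denominators `i`, since `v_p(i)` grows only logarithmically. -/
theorem exists_term_mem_wBall (M : AlgLift S) : ∃ D : ℝ, ∃ r₀ > 0, ∀ r, 0 < r → r ≤ r₀ →
    ∀ i : ℕ, 1 ≤ i → (-1 : AlgFrac M) ^ (i - 1) / (i : AlgFrac M) *
      (frobFrac M (varFrac M) / varFrac M ^ p ^ S.f - 1) ^ i ∈ wBall M r (i / 4 - D) := by
  obtain ⟨e, he, -, h⟩ := exists_natCast_inv_mem_wBall M
  obtain ⟨r₀, hr₀, hε⟩ := exists_frob_var_mem_wBall M
  refine ⟨4 * e ^ 2, r₀, hr₀, fun r hr hrr i hi => ?_⟩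
  have h1 := mul_mem_wBall (mul_mem_wBall (pow_mem_wBall hr (neg_mem (one_mem_wBall hr))
    (i - 1)) ((h r hr).2 i (by omega))) (pow_mem_wBall hr (hε r hr hrr) i)
  rw [← div_eq_mul_inv] at h1
  refine wBall_anti hr ?_ h1
  set v := padicValNat p i
  -- `v ^ 2 ≤ 4 * 2 ^ v ≤ 4 * i`
  have h2 : 2 ^ v ≤ i := (Nat.pow_le_pow_left (Fact.out : p.Prime).two_le v).trans
    (Nat.le_of_dvd (by omega) pow_padicValNat_dvd)
  have h3 : ∀ n : ℕ, n ^ 2 ≤ 4 * 2 ^ n := by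
    intro n
    induction n with
    | zero => norm_num
    | succ n ih =>
      rcases lt_or_ge n 3 with h | h
      · interval_cases n <;> norm_num
      · rw [pow_succ 2 n]; nlinarith
  have h4 : (v : ℝ) ^ 2 ≤ 4 * i := by exact_mod_cast (h3 v).trans (Nat.mul_le_mul_left 4 h2)
  have h5 := sq_nonneg ((v : ℝ) / 4 - 2 * e)
  nlinarith

/-- The series defining `σ(log x) - q log x` converges, and its norms stay bounded as `ρ ↑ 1`. -/
theorem exists_normAn_logDefect_le (M : AlgLift S) : ∃ K > 0, ∀ᶠ r in 𝓝[>] (0 : ℝ),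
    normAn M r (logDefect M) ≤ K := by
  obtain ⟨D, r₀, hr₀, hterm⟩ := exists_term_mem_wBall M
  set t : ℕ → AlgFrac M := fun i => (-1 : AlgFrac M) ^ (i - 1) / (i : AlgFrac M) *
      (frobFrac M (varFrac M) / varFrac M ^ p ^ S.f - 1) ^ i with ht
  set u : ℕ → AlgFrac M := fun m => ∑ i ∈ Finset.Icc 1 m, t i with hu
  have hub : ∀ r, 0 < r → r ≤ r₀ → ∀ m, u m ∈ wBall M r (-D) := fun r hr hrr m =>
    sum_mem fun i hi => wBall_anti hr (by linarith [(Nat.cast_nonneg i : (0 : ℝ) ≤ i)])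
      (hterm r hr hrr i (Finset.mem_Icc.1 hi).1)
  have hud : ∀ r, 0 < r → r ≤ r₀ → ∀ N m n : ℕ, N ≤ m → m ≤ n →
      u n - u m ∈ wBall M r (N / 4 - D) := by
    intro r hr hrr N m n hN hmn
    have h1 : u n - u m = ∑ i ∈ Finset.Ioc m n, t i := by
      rw [sub_eq_iff_eq_add', hu]
      exact (Finset.sum_Ioc_consecutive t (Nat.zero_le m) hmn).symm
    rw [h1]
    refine sum_mem fun i hi => ?_
    have hi' := Finset.mem_Ioc.1 hi
    refine wBall_anti hr ?_ (hterm r hr hrr i (by omega))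
    have : (N : ℝ) ≤ i := by exact_mod_cast (by omega : N ≤ i)
    linarith
  have hcau : CauchyAt M r₀ u := by
    refine ⟨fun m => ⟨_, hub r₀ hr₀ le_rfl m⟩, fun s hs hsr ε hε => ?_⟩
    obtain ⟨c, rfl⟩ := exists_rpow_eq S hε
    obtain ⟨N, hN⟩ := exists_nat_gt (4 * (c + D))
    refine ⟨N, fun m hm n hn => nrm_le_rpow hs (wBall_anti hs (d := N / 4 - D) (by linarith) ?_)⟩
    rcases le_total m n with hmn | hmn
    · have := neg_mem (hud s hs hsr N m n hm hmn)
      rwa [neg_sub (u n)] at this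
    · exact hud s hs hsr N n m hn hmn
  refine ⟨absUnif S ^ (-D), Real.rpow_pos_of_pos (absUnif_pos S) _, ?_⟩
  filter_upwards [eventually_tendsto_nrm (mem_cauchyRing_iff.2 ⟨r₀, hr₀, hcau⟩)
    (rfl : _ = logDefect M), eventually_pos_iff.2 ⟨r₀, hr₀, fun r hr hrr => And.intro hr hrr⟩]
    with r h1 ⟨hr, hrr⟩
  exact le_of_tendsto' h1 fun m => nrm_le_rpow hr (hub r hr hrr m)

end Constants

end LogGrowth

/-! ### Gauss norms on the logarithmic extension -/

namespace LogGrowth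

section Gauss

open Filter Topology Polynomial

variable {p : ℕ} [Fact p.Prime] {O : Type u} [CommRing O] [IsDomain O] [IsDiscreteValuationRing O]
  [CharZero O] [CharP (ResField O) p] {S : FrobDatum p O} {M : AlgLift S}

variable {r s : ℝ} {y z P : GammaLogAnCon M} {c d μ ν κ : ℝ → ℝ}

/-- For `r` close to `0`, the Gauss norm of `y` in which `log x` has norm `1 / μ(r)` is at most
`c(r)`, expressed coefficient by coefficient. -/
def GaussLE (c μ : ℝ → ℝ) (y : GammaLogAnCon M) : Prop :=
  ∀ i : ℕ, ∀ᶠ r in 𝓝[>] (0 : ℝ), normAn M r (y.coeff i) ≤ c r * μ r ^ i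

theorem GaussLE.mono (hμ : ∀ᶠ r in 𝓝[>] (0 : ℝ), 0 ≤ μ r) (h : GaussLE c μ y)
    (hcd : ∀ᶠ r in 𝓝[>] (0 : ℝ), c r ≤ d r) : GaussLE d μ y := by
  intro i
  filter_upwards [h i, hμ, hcd] with r h1 h2 h3
  exact h1.trans (mul_le_mul_of_nonneg_right h3 (pow_nonneg h2 i))

theorem GaussLE.neg (h : GaussLE c μ y) : GaussLE c μ (-y) := by
  intro i
  filter_upwards [h i, eventually_normAn_neg (y.coeff i)] with r h1 h2
  rwa [coeff_neg, h2]

theorem GaussLE.sum {ι : Type*} {t : Finset ι} {y : ι → GammaLogAnCon M}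
    (hμ : ∀ᶠ r in 𝓝[>] (0 : ℝ), 0 ≤ μ r) (hc : ∀ᶠ r in 𝓝[>] (0 : ℝ), 0 ≤ c r)
    (h : ∀ i ∈ t, GaussLE c μ (y i)) : GaussLE c μ (∑ i ∈ t, y i) := by
  intro k
  rw [finsetSum_coeff]
  refine eventually_normAn_sum_le t ?_ fun i hi => h i hi k
  filter_upwards [hμ, hc] with r h1 h2
  positivity

theorem GaussLE.mul (hμ : ∀ᶠ r in 𝓝[>] (0 : ℝ), 0 ≤ μ r) (hc : ∀ᶠ r in 𝓝[>] (0 : ℝ), 0 ≤ c r)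
    (hd : ∀ᶠ r in 𝓝[>] (0 : ℝ), 0 ≤ d r) (hy : GaussLE c μ y) (hz : GaussLE d μ z) :
    GaussLE (fun r => c r * d r) μ (y * z) := by
  intro k
  rw [coeff_mul]
  refine eventually_normAn_sum_le (B := fun r => c r * d r * μ r ^ k) _ ?_ fun i hi => ?_
  · filter_upwards [hμ, hc, hd] with r h1 h2 h3
    positivity
  · rw [Finset.HasAntidiagonal.mem_antidiagonal] at hi
    filter_upwards [hμ, hc, hd, hy i.1, hz i.2, eventually_normAn_mul_le (y.coeff i.1) (z.coeff i.2),
      eventually_normAn_nonneg (z.coeff i.2)] with r h1 h2 h3 h4 h5 h6 h7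
    refine h6.trans ((mul_le_mul h4 h5 h7 (by positivity)).trans_eq ?_)
    rw [← hi, pow_add]
    ring

theorem gaussLE_C (hμ : ∀ᶠ r in 𝓝[>] (0 : ℝ), 0 ≤ μ r) (hc : ∀ᶠ r in 𝓝[>] (0 : ℝ), 0 ≤ c r)
    {a : GammaAnCon M} (h : ∀ᶠ r in 𝓝[>] (0 : ℝ), normAn M r a ≤ c r) : GaussLE c μ (C a) := by
  intro i
  rw [coeff_C]
  split_ifs with hi
  · filter_upwards [h] with r h
    rwa [hi, pow_zero, mul_one]
  · filter_upwards [hμ, hc, eventually_normAn_zero (M := M)] with r h1 h2 h3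
    rw [h3]
    positivity

theorem eventually_normAn_one_le : ∀ᶠ r in 𝓝[>] (0 : ℝ), normAn M r 1 ≤ 1 := by
  have h1 : (1 : AlgFrac M) ∈ gammaCon M :=
    mem_gammaCon_of_forall_mem_wBall one_pos fun r hr _ => ⟨_, one_mem_wBall hr⟩
  filter_upwards [eventually_normAn_ofCon h1, self_mem_nhdsWithin] with r h2 (hr : 0 < r)
  rw [← ofCon_one, h2]
  exact (nrm_le_rpow hr (one_mem_wBall hr)).trans_eq (Real.rpow_zero _)

theorem GaussLE.pow (hμ : ∀ᶠ r in 𝓝[>] (0 : ℝ), 0 ≤ μ r) (hc : ∀ᶠ r in 𝓝[>] (0 : ℝ), 0 ≤ c r)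
    (hy : GaussLE c μ y) (k : ℕ) : GaussLE (fun r => c r ^ k) μ (y ^ k) := by
  have hck : ∀ k, ∀ᶠ r in 𝓝[>] (0 : ℝ), 0 ≤ c r ^ k := fun k => hc.mono fun r h => pow_nonneg h k
  induction k with
  | zero =>
    simp only [pow_zero]
    rw [← C_1]
    exact gaussLE_C hμ (Eventually.of_forall fun _ => zero_le_one) eventually_normAn_one_le
  | succ k ih =>
    simp only [pow_succ]
    exact ih.mul hμ (hck k) hc hy

/-- Substitution for the variable is bounded for the Gauss norms when the new value of the variable
has Gauss norm at most the old radius. -/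
theorem GaussLE.comp (hc : ∀ᶠ r in 𝓝[>] (0 : ℝ), 0 ≤ c r) (hμ : ∀ᶠ r in 𝓝[>] (0 : ℝ), 0 < μ r)
    (hν : ∀ᶠ r in 𝓝[>] (0 : ℝ), 0 ≤ ν r) (hz : GaussLE c μ z)
    (hP : GaussLE (fun r => (μ r)⁻¹) ν P) : GaussLE c ν (z.comp P) := by
  have hμ' : ∀ᶠ r in 𝓝[>] (0 : ℝ), 0 ≤ (μ r)⁻¹ := hμ.mono fun r h => (inv_pos.2 h).le
  rw [comp_eq_sum_left, Polynomial.sum]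
  refine GaussLE.sum hν hc fun i _ => ?_
  have h1 : ∀ᶠ r in 𝓝[>] (0 : ℝ), 0 ≤ c r * μ r ^ i := by
    filter_upwards [hc, hμ] with r h1 h2
    positivity
  refine ((gaussLE_C hν h1 (hz i)).mul hν h1 (hμ'.mono fun r h => pow_nonneg h i)
    (hP.pow hν hμ' i)).mono hν ?_
  filter_upwards [hμ] with r h
  rw [mul_assoc, inv_pow, mul_inv_cancel₀ (pow_ne_zero i h.ne'), mul_one]

theorem gaussLE_linear {a b : GammaAnCon M} (hμ : ∀ᶠ r in 𝓝[>] (0 : ℝ), 0 ≤ μ r)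
    (hc : ∀ᶠ r in 𝓝[>] (0 : ℝ), 0 ≤ c r)
    (ha : ∀ᶠ r in 𝓝[>] (0 : ℝ), normAn M r a ≤ c r * μ r)
    (hb : ∀ᶠ r in 𝓝[>] (0 : ℝ), normAn M r b ≤ c r) : GaussLE c μ (C a * X + C b) := by
  intro i
  rcases i with _ | _ | i
  · simpa using hb
  · simpa using ha
  · have : (C a * X + C b).coeff (i + 1 + 1) = 0 := by
      rw [coeff_add, coeff_C_mul, coeff_X, if_neg (by omega), coeff_C, if_neg (by omega)]
      simp
    rw [this]
    filter_upwards [hμ, hc, eventually_normAn_zero (M := M)] with r h1 h2 h3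
    rw [h3]
    positivity

variable (M) in
/-- The Gauss norm `max_i |y_i|_ρ r ^ (-i)` of `∑ y_i (log x) ^ i`, where `ρ = p ^ (-r)`: the norm
`|log x|_ρ` is taken to be `1 / r`, so that `Fil_lam` is the set of the `y` with Gauss norm
`O(r ^ (-lam))`. -/
noncomputable def gauss (r : ℝ) (y : GammaLogAnCon M) : ℝ :=
  (Finset.range (y.natDegree + 1)).sup' ⟨0, Finset.mem_range.2 (Nat.succ_pos _)⟩
    fun i => |normAn M r (y.coeff i)| * (r⁻¹) ^ i

theorem normAn_coeff_le_gauss {i : ℕ} (hi : i ≤ y.natDegree) :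
    |normAn M r (y.coeff i)| * (r⁻¹) ^ i ≤ gauss M r y :=
  Finset.le_sup' (fun i => |normAn M r (y.coeff i)| * (r⁻¹) ^ i) (Finset.mem_range_succ_iff.2 hi)

theorem gauss_nonneg : 0 ≤ gauss M r y := by
  refine le_trans ?_ (normAn_coeff_le_gauss (Nat.zero_le _))
  rw [pow_zero, mul_one]
  exact abs_nonneg _

theorem eventually_gauss_le (h : GaussLE c (fun r => r) y) :
    ∀ᶠ r in 𝓝[>] (0 : ℝ), gauss M r y ≤ c r := by
  have h1 : ∀ᶠ r in 𝓝[>] (0 : ℝ), ∀ i ∈ Finset.range (y.natDegree + 1),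
      normAn M r (y.coeff i) ≤ c r * r ^ i ∧ 0 ≤ normAn M r (y.coeff i) :=
    (eventually_all_finset _).2 fun i _ => (h i).and (eventually_normAn_nonneg _)
  filter_upwards [h1, self_mem_nhdsWithin] with r h2 (hr : 0 < r)
  refine Finset.sup'_le _ _ fun i hi => ?_
  rw [abs_of_nonneg (h2 i hi).2, inv_pow, ← div_eq_mul_inv, div_le_iff₀ (by positivity)]
  exact (h2 i hi).1

theorem gaussLE_gauss_mul {q : ℝ} (hq : 0 < q) (y : GammaLogAnCon M) (i : ℕ) :
    ∀ᶠ r in 𝓝[>] (0 : ℝ), normAn M (q * r) (y.coeff i) ≤ gauss M (q * r) y * (q * r) ^ i := by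
  by_cases hi : i ≤ y.natDegree
  · filter_upwards [self_mem_nhdsWithin] with r (hr : 0 < r)
    have h1 := normAn_coeff_le_gauss (r := q * r) hi
    rw [inv_pow, ← div_eq_mul_inv, div_le_iff₀ (by positivity)] at h1
    exact (le_abs_self _).trans h1
  · filter_upwards [(tendsto_mul_pos hq).eventually (eventually_normAn_zero (M := M)),
      self_mem_nhdsWithin] with r h1 (hr : 0 < r)
    rw [coeff_eq_zero_of_natDegree_lt (not_le.1 hi), h1]
    have := gauss_nonneg (M := M) (r := q * r) (y := y)
    positivity

theorem gaussLE_gauss (y : GammaLogAnCon M) : GaussLE (fun r => gauss M r y) (fun r => r) y := by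
  intro i
  simpa using gaussLE_gauss_mul one_pos y i

variable (M) in
/-- `σ` applied to the coefficients only. -/
noncomputable def frobCoeff (y : GammaLogAnCon M) : GammaLogAnCon M :=
  ∑ i ∈ y.support, monomial i (frobAn M (y.coeff i))

theorem eventually_normAn_frobCoeff (y : GammaLogAnCon M) (i : ℕ) : ∀ᶠ r in 𝓝[>] (0 : ℝ),
    normAn M r ((frobCoeff M y).coeff i) = normAn M ((p ^ S.f : ℕ) * r) (y.coeff i) := by
  have h0 : (frobCoeff M y).coeff i = if i ∈ y.support then frobAn M (y.coeff i) else 0 := by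
    rw [frobCoeff, finsetSum_coeff]
    simp only [coeff_monomial]
    rw [Finset.sum_ite_eq']
  rw [h0]
  split_ifs with hi
  · exact eventually_normAn_frobAn _
  · rw [notMem_support_iff.1 hi]
    filter_upwards [eventually_normAn_zero (M := M),
      (tendsto_mul_pos (q_pos S)).eventually (eventually_normAn_zero (M := M))] with r h1 h2
    rw [h1, h2]

theorem frobLog_eq_comp (y : GammaLogAnCon M) :
    frobLog M y = (frobCoeff M y).comp
      (C ((p ^ S.f : ℕ) : GammaAnCon M) * X + C (logDefect M)) := by
  rw [frobCoeff, ← coe_compRingHom_apply, map_sum, frobLog, Polynomial.sum]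
  refine Finset.sum_congr rfl fun i _ => ?_
  rw [coe_compRingHom_apply, monomial_comp, C_eq_natCast]

theorem eventually_le_inv {K : ℝ} : ∀ᶠ r in 𝓝[>] (0 : ℝ), K ≤ r⁻¹ :=
  tendsto_inv_nhdsGT_zero.eventually_ge_atTop K

/-- `σ` multiplies the parameter `r` of the Gauss norms by `q`: it does so on the coefficients, and
`σ(log x)` is `q log x`, of norm `1 / (q r)`, up to a series with bounded norms. -/
theorem eventually_gauss_frobLog (y : GammaLogAnCon M) :
    ∀ᶠ r in 𝓝[>] (0 : ℝ), gauss M r (frobLog M y) = gauss M ((p ^ S.f : ℕ) * r) y := by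
  set q : ℝ := ((p ^ S.f : ℕ) : ℝ) with hq
  have hq0 : 0 < q := q_pos S
  have hpos : ∀ᶠ r in 𝓝[>] (0 : ℝ), 0 < r := self_mem_nhdsWithin
  have hqpos : ∀ᶠ r in 𝓝[>] (0 : ℝ), 0 < q * r := hpos.mono fun r hr => mul_pos hq0 hr
  obtain ⟨K, hK, hKl⟩ := exists_normAn_logDefect_le M
  obtain ⟨ι, hι, hιq⟩ := exists_q_inverse M
  have hle : ∀ᶠ r in 𝓝[>] (0 : ℝ), gauss M r (frobLog M y) ≤ gauss M (q * r) y := by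
    refine eventually_gauss_le (c := fun r => gauss M (q * r) y) ?_
    rw [frobLog_eq_comp]
    refine GaussLE.comp (μ := fun r => q * r) (Eventually.of_forall fun r => gauss_nonneg) hqpos
      (hpos.mono fun r => le_of_lt) (fun i => ?_) (gaussLE_linear (hpos.mono fun r => le_of_lt)
        (hqpos.mono fun r h => (inv_pos.2 h).le) ?_ ?_)
    · filter_upwards [eventually_normAn_frobCoeff y i, gaussLE_gauss_mul hq0 y i] with r h1 h2
      rwa [h1]
    · filter_upwards [eventually_normAn_q_le (M := M), hpos] with r h1 hr
      refine h1.trans_eq ?_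
      rw [← hq]
      field_simp
    · filter_upwards [hKl, eventually_le_inv (K := K * q)] with r h1 h2
      refine h1.trans ?_
      rw [mul_inv, ← div_eq_inv_mul, le_div_iff₀ hq0]
      exact h2
  have hge : ∀ᶠ r in 𝓝[>] (0 : ℝ), gauss M (q * r) y ≤ gauss M r (frobLog M y) := by
    have hz : frobCoeff M y = (frobLog M y).comp (C ι * X + C (-(ι * logDefect M))) := by
      rw [frobLog_eq_comp, comp_assoc]
      have : (C ((p ^ S.f : ℕ) : GammaAnCon M) * X + C (logDefect M)).comp
          (C ι * X + C (-(ι * logDefect M))) = X := by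
        simp only [add_comp, mul_comp, C_comp, X_comp]
        rw [mul_add, ← mul_assoc, ← C_mul, ← C_mul, mul_neg, ← mul_assoc, mul_comm _ ι, hι, C_1,
          one_mul, one_mul, C_neg, neg_add_cancel_right]
      rw [this, comp_X]
    have h1 : GaussLE (fun r => gauss M r (frobLog M y)) (fun r => q * r) (frobCoeff M y) := by
      rw [hz]
      refine GaussLE.comp (μ := fun r => r) (Eventually.of_forall fun r => gauss_nonneg) hpos
        (hqpos.mono fun r => le_of_lt) (gaussLE_gauss _)
        (gaussLE_linear (hqpos.mono fun r => le_of_lt) (hpos.mono fun r h => (inv_pos.2 h).le) ?_ ?_)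
      · filter_upwards [hιq, hpos] with r h1 hr
        refine h1.trans_eq ?_
        rw [← hq]
        field_simp
      · filter_upwards [hKl, hιq, eventually_normAn_neg (ι * logDefect M),
          eventually_normAn_mul_le ι (logDefect M), eventually_le_inv (K := q * K),
          eventually_normAn_nonneg (logDefect M)] with r h1 h2 h3 h4 h5 h6
        rw [h3]
        exact h4.trans ((mul_le_mul h2 h1 h6 hq0.le).trans h5)
    have h2 : ∀ᶠ r in 𝓝[>] (0 : ℝ), ∀ i ∈ Finset.range (y.natDegree + 1),
        normAn M (q * r) (y.coeff i) ≤ gauss M r (frobLog M y) * (q * r) ^ i ∧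
          0 ≤ normAn M (q * r) (y.coeff i) := by
      refine (eventually_all_finset _).2 fun i _ => ?_
      filter_upwards [h1 i, eventually_normAn_frobCoeff y i,
        (tendsto_mul_pos hq0).eventually (eventually_normAn_nonneg (y.coeff i))] with r h3 h4 h5
      exact ⟨h4 ▸ h3, h5⟩
    filter_upwards [h2, hqpos] with r h3 hr
    refine Finset.sup'_le _ _ fun i hi => ?_
    rw [abs_of_nonneg (h3 i hi).2, inv_pow, ← div_eq_mul_inv, div_le_iff₀ (by positivity)]
    exact (h3 i hi).1
  filter_upwards [hle, hge] with r h1 h2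
  exact le_antisymm h1 h2

theorem eventually_gauss_iterate (y : GammaLogAnCon M) (k : ℕ) : ∀ᶠ r in 𝓝[>] (0 : ℝ),
    gauss M r ((frobLog M)^[k] y) = gauss M (((p ^ S.f : ℕ) : ℝ) ^ k * r) y := by
  induction k with
  | zero => simp
  | succ k ih =>
    rw [Function.iterate_succ_apply']
    filter_upwards [eventually_gauss_frobLog ((frobLog M)^[k] y),
      (tendsto_mul_pos (q_pos S)).eventually ih] with r h1 h2
    rw [h1, h2, pow_succ, mul_assoc]

/-- The equation `f(σ) y = 0`, solved for its `k`-th term and estimated. -/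
theorem exists_gauss_le_of_twistedEval {n : ℕ} (hn : 1 ≤ n) {a : Fin (n + 1) → AlgFrac M}
    (ha : ∀ i, a i ∈ gammaCon M) (ha0 : ∀ i, a i ≠ 0) (hy : twistedEval M a y = 0)
    (k : Fin (n + 1)) : ∃ C : ℝ, ∀ᶠ r in 𝓝[>] (0 : ℝ), ∃ i ≠ k,
      gauss M (((p ^ S.f : ℕ) : ℝ) ^ (k : ℕ) * r) y ≤
        absAt M 1 (a i) / absAt M 1 (a k) * Real.exp (C * r) *
          gauss M (((p ^ S.f : ℕ) : ℝ) ^ (i : ℕ) * r) y := by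
  choose hpos hinv E hE using fun i => exists_normAn_ofCon_le (ha i) (ha0 i)
  obtain ⟨E₀, hE₀⟩ := (Finset.univ.image E).bddAbove
  have hEle : ∀ i, E i ≤ E₀ := fun i =>
    hE₀ (Finset.mem_coe.2 (Finset.mem_image_of_mem _ (Finset.mem_univ i)))
  have hne : (Finset.univ.erase k).Nonempty := by
    rw [← Finset.card_pos, Finset.card_erase_of_mem (Finset.mem_univ k), Finset.card_univ,
      Fintype.card_fin]
    omega
  set B : Fin (n + 1) → ℝ → ℝ := fun i r => absAt M 1 (a i) / absAt M 1 (a k) *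
    Real.exp (2 * E₀ * r) * gauss M r ((frobLog M)^[i] y) with hB
  have hB0 : ∀ i r, 0 ≤ B i r := fun i r => by
    have h1 := hpos i
    have h2 := hpos k
    have h3 := gauss_nonneg (M := M) (r := r) (y := (frobLog M)^[i] y)
    simp only [hB]
    positivity
  set b : ℝ → ℝ := fun r => (Finset.univ.erase k).sup' hne fun i => B i r with hb
  have hb0 : ∀ r, 0 ≤ b r := fun r => by
    obtain ⟨i, hi⟩ := hne
    exact (hB0 i r).trans (Finset.le_sup' (fun i => B i r) hi)
  have hrpos : ∀ᶠ r in 𝓝[>] (0 : ℝ), 0 ≤ r := by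
    filter_upwards [self_mem_nhdsWithin] with r hr using le_of_lt hr
  have hsol : (frobLog M)^[k] y =
      -∑ i ∈ Finset.univ.erase k, C (ofCon M (a k)⁻¹ * ofCon M (a i)) * (frobLog M)^[i] y := by
    rw [twistedEval, ← Finset.add_sum_erase _ _ (Finset.mem_univ k)] at hy
    have h1 := congrArg (fun t => C (ofCon M (a k)⁻¹) * t) hy
    simp only [mul_zero, mul_add, Finset.mul_sum, ← mul_assoc, ← C_mul] at h1
    rw [hinv k, C_1, one_mul] at h1
    exact eq_neg_of_add_eq_zero_left h1
  have hLE : GaussLE b (fun r => r) ((frobLog M)^[k] y) := by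
    rw [hsol]
    refine (GaussLE.sum hrpos (Eventually.of_forall hb0) fun i hi => ?_).neg
    have hc0 : ∀ᶠ r in 𝓝[>] (0 : ℝ),
        0 ≤ absAt M 1 (a i) / absAt M 1 (a k) * Real.exp (2 * E₀ * r) := by
      refine Eventually.of_forall fun r => ?_
      have h1 := hpos i
      have h2 := hpos k
      positivity
    refine ((gaussLE_C hrpos hc0 ?_).mul hrpos hc0 (Eventually.of_forall fun r => gauss_nonneg)
      (gaussLE_gauss ((frobLog M)^[i] y))).mono hrpos
      (Eventually.of_forall fun r => Finset.le_sup' (fun i => B i r) hi)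
    filter_upwards [hE i, hE k, eventually_normAn_mul_le (ofCon M (a k)⁻¹) (ofCon M (a i)),
      eventually_normAn_nonneg (ofCon M (a i)), hrpos] with r h1 h2 h3 h4 hr
    have h5 := hpos i
    have h6 := hpos k
    have h7 : ∀ j, Real.exp (E j * r) ≤ Real.exp (E₀ * r) := fun j =>
      Real.exp_le_exp.2 (mul_le_mul_of_nonneg_right (hEle j) hr)
    calc _ ≤ _ := h3
      _ ≤ ((absAt M 1 (a k))⁻¹ * Real.exp (E₀ * r)) * (absAt M 1 (a i) * Real.exp (E₀ * r)) := by
        refine mul_le_mul (h2.2.trans ?_) (h1.1.trans ?_) h4 (by positivity)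
        · exact mul_le_mul_of_nonneg_left (h7 k) (by positivity)
        · exact mul_le_mul_of_nonneg_left (h7 i) (by positivity)
      _ = _ := by
        rw [show 2 * E₀ * r = E₀ * r + E₀ * r by ring, Real.exp_add]
        field_simp
  refine ⟨2 * E₀, ?_⟩
  have hit : ∀ᶠ r in 𝓝[>] (0 : ℝ), ∀ i : Fin (n + 1),
      gauss M r ((frobLog M)^[i] y) = gauss M (((p ^ S.f : ℕ) : ℝ) ^ (i : ℕ) * r) y :=
    eventually_all.2 fun i => eventually_gauss_iterate y i
  filter_upwards [eventually_gauss_le hLE, hit] with r h1 h2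
  obtain ⟨i, hi, h3⟩ := Finset.exists_mem_eq_sup' hne fun i => B i r
  refine ⟨i, Finset.ne_of_mem_erase hi, ?_⟩
  rw [← h2, ← h2]
  exact h1.trans h3.le

end Gauss

end LogGrowth

/-! ### The log-growth filtration in terms of Gauss norms -/

namespace LogGrowth

section Filtration

open Filter Topology Polynomial

variable {p : ℕ} [Fact p.Prime] {O : Type u} [CommRing O] [IsDomain O] [IsDiscreteValuationRing O]
  [CharZero O] [CharP (ResField O) p] {S : FrobDatum p O} {M : AlgLift S}

variable {r s lam : ℝ}

theorem mem_filAn_iff {y : GammaAnCon M} :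
    y ∈ filAn M lam ↔ ∃ K : ℝ, ∀ᶠ r in 𝓝[>] (0 : ℝ), normAn M r y ≤ K * r ^ (-lam) := by
  have hp1 : (1 : ℝ) < p := Nat.one_lt_cast.2 (Fact.out : p.Prime).one_lt
  have hp0 : (0 : ℝ) < p := one_pos.trans hp1
  have hlog : 0 < Real.log p := Real.log_pos hp1
  have ht1 : Tendsto (fun r : ℝ => (p : ℝ) ^ (-r)) (𝓝[>] 0) (𝓝[<] 1) := by
    refine tendsto_nhdsWithin_iff.2 ⟨?_, ?_⟩
    · have h1 : Continuous fun r : ℝ => (p : ℝ) ^ (-r) := by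
        have := hp0.ne'
        fun_prop (disch := assumption)
      have h2 := h1.tendsto 0
      rw [neg_zero, Real.rpow_zero] at h2
      exact h2.mono_left nhdsWithin_le_nhds
    · filter_upwards [self_mem_nhdsWithin] with r (hr : 0 < r)
      exact Real.rpow_lt_one_of_one_lt_of_neg hp1 (neg_lt_zero.2 hr)
  have hev : ∀ᶠ ρ : ℝ in 𝓝[<] 1, 0 < ρ := by
    filter_upwards [nhdsWithin_le_nhds (lt_mem_nhds (zero_lt_one (α := ℝ)))] with ρ h using h
  have ht2 : Tendsto (fun ρ : ℝ => -Real.logb p ρ) (𝓝[<] 1) (𝓝[>] 0) := by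
    refine tendsto_nhdsWithin_iff.2 ⟨?_, ?_⟩
    · have h2 : Tendsto (fun ρ : ℝ => -Real.logb p ρ) (𝓝 1) (𝓝 (-Real.logb p 1)) := by
        unfold Real.logb
        exact ((Real.continuousAt_log one_ne_zero).div_const _).neg
      rw [Real.logb_one, neg_zero] at h2
      exact h2.mono_left nhdsWithin_le_nhds
    · filter_upwards [self_mem_nhdsWithin, hev] with ρ (hρ : ρ < 1) h0
      exact neg_pos.2 (Real.logb_neg hp1 h0 hρ)
  have hl : ∀ r : ℝ, Real.log (1 / (p : ℝ) ^ (-r)) = Real.log p * r := fun r => by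
    rw [one_div, ← Real.rpow_neg hp0.le, neg_neg, Real.log_rpow hp0, mul_comm]
  constructor
  · intro h
    obtain ⟨K, hK⟩ := (h.comp_tendsto ht1).bound
    refine ⟨K * Real.log p ^ (-lam), ?_⟩
    filter_upwards [hK, self_mem_nhdsWithin] with r h1 (hr : 0 < r)
    simp only [Function.comp_apply, hl, Real.norm_eq_abs] at h1
    rw [abs_of_nonneg (Real.rpow_nonneg (mul_pos hlog hr).le _), Real.mul_rpow hlog.le hr.le,
      ← mul_assoc] at h1
    exact (le_abs_self _).trans h1
  · rintro ⟨K, hK⟩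
    have h1 : (fun r => normAn M r y) =O[𝓝[>] 0] fun r : ℝ => r ^ (-lam) := by
      refine Asymptotics.IsBigO.of_bound K ?_
      filter_upwards [hK, eventually_normAn_nonneg y, self_mem_nhdsWithin] with r h1 h2 (hr : 0 < r)
      rw [Real.norm_eq_abs, Real.norm_eq_abs, abs_of_nonneg h2,
        abs_of_nonneg (Real.rpow_nonneg hr.le _)]
      exact h1
    have h2 : (fun ρ : ℝ => absAn M ρ y) =O[𝓝[<] 1] fun ρ : ℝ => (-Real.logb p ρ) ^ (-lam) := by
      refine (h1.comp_tendsto ht2).congr' ?_ (Eventually.of_forall fun _ => rfl)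
      filter_upwards [hev] with ρ hρ
      rw [Function.comp_apply, normAn, neg_neg, Real.rpow_logb hp0 hp1.ne' hρ]
    refine h2.trans (Asymptotics.IsBigO.of_bound (Real.log p ^ lam) ?_)
    filter_upwards [self_mem_nhdsWithin, hev] with ρ (hρ : ρ < 1) h0
    have h3 : Real.log (1 / ρ) = -Real.logb p ρ * Real.log p := by
      rw [one_div, Real.log_inv, Real.logb]
      field_simp
    have h4 : 0 < -Real.logb p ρ := neg_pos.2 (Real.logb_neg hp1 h0 hρ)
    rw [h3, Real.mul_rpow h4.le hlog.le, norm_mul, Real.norm_of_nonneg (Real.rpow_nonneg hlog.le _),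
      Real.rpow_neg hlog.le]
    have := Real.rpow_pos_of_pos hlog lam
    field_simp
    exact le_rfl

theorem mem_filLog_iff {y : GammaLogAnCon M} (hlam : 0 ≤ lam) :
    y ∈ filLog M lam ↔ ∃ K : ℝ, ∀ᶠ r in 𝓝[>] (0 : ℝ), gauss M r y ≤ K * r ^ (-lam) := by
  have hpos : ∀ᶠ r in 𝓝[>] (0 : ℝ), 0 < r := self_mem_nhdsWithin
  have hpow : ∀ r : ℝ, 0 < r → ∀ i : ℕ, r ^ (-(lam - i)) = r ^ (-lam) * r ^ i := by
    intro r hr i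
    rw [← Real.rpow_natCast, ← Real.rpow_add hr]
    congr 1
    ring
  rw [filLog, Set.mem_ofPred_eq, if_neg (not_lt.2 hlam)]
  simp only [mem_filAn_iff]
  constructor
  · rintro ⟨h1, h2⟩
    have h3 : ∀ i : ℕ, ∃ K : ℝ, 0 ≤ K ∧ ∀ᶠ r in 𝓝[>] (0 : ℝ),
        normAn M r (y.coeff i) ≤ K * r ^ (-lam) * r ^ i := by
      intro i
      rcases le_or_gt i ⌊lam⌋₊ with hi | hi
      · obtain ⟨K, hK⟩ := h1 i hi
        refine ⟨max K 0, le_max_right _ _, ?_⟩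
        filter_upwards [hK, hpos] with r h4 hr
        rw [hpow r hr, ← mul_assoc] at h4
        refine h4.trans ?_
        gcongr
        exact le_max_left _ _
      · refine ⟨0, le_rfl, ?_⟩
        filter_upwards [eventually_normAn_zero (M := M)] with r h4
        rw [h2 i hi, h4, zero_mul, zero_mul]
    choose K hK0 hK using h3
    refine ⟨∑ i ∈ Finset.range (y.natDegree + 1), K i, ?_⟩
    have h4 : GaussLE (fun r => (∑ i ∈ Finset.range (y.natDegree + 1), K i) * r ^ (-lam))
        (fun r => r) y := by
      intro i
      by_cases hi : i ∈ Finset.range (y.natDegree + 1)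
      · filter_upwards [hK i, hpos] with r h5 hr
        refine h5.trans ?_
        gcongr
        exact Finset.single_le_sum (fun i _ => hK0 i) hi
      · rw [coeff_eq_zero_of_natDegree_lt (by rw [Finset.mem_range] at hi; omega)]
        filter_upwards [eventually_normAn_zero (M := M), hpos] with r h5 hr
        rw [h5]
        have := Finset.sum_nonneg fun i (_ : i ∈ Finset.range (y.natDegree + 1)) => hK0 i
        positivity
    exact eventually_gauss_le h4
  · rintro ⟨K, hK⟩
    have h1 : ∀ i, ∀ᶠ r in 𝓝[>] (0 : ℝ), normAn M r (y.coeff i) ≤ K * r ^ (-(lam - i)) := by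
      intro i
      filter_upwards [gaussLE_gauss y i, hK, hpos] with r h1 h2 hr
      rw [hpow r hr, ← mul_assoc]
      exact h1.trans (mul_le_mul_of_nonneg_right h2 (by positivity))
    refine ⟨fun i _ => ⟨K, h1 i⟩, fun i hi => ?_⟩
    -- a nonzero coefficient has norms bounded below, but here the bound tends to zero
    by_contra hne
    obtain ⟨c, hc, hcy⟩ := exists_le_normAn hne
    have hil : 0 < (i : ℝ) - lam := sub_pos.2 (Nat.lt_of_floor_lt hi)
    have h2 : Tendsto (fun r : ℝ => K * r ^ (-(lam - i))) (𝓝[>] 0) (𝓝 0) := by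
      have h3 : Tendsto (fun r : ℝ => K * r ^ ((i : ℝ) - lam)) (𝓝 0) (𝓝 (K * 0 ^ ((i : ℝ) - lam))) :=
        ((Real.continuousAt_rpow_const 0 _ (Or.inr hil.le)).tendsto).const_mul K
      rw [Real.zero_rpow hil.ne', mul_zero] at h3
      simp only [neg_sub]
      exact h3.mono_left nhdsWithin_le_nhds
    obtain ⟨r, h4, h5, h6⟩ := ((h2.eventually (gt_mem_nhds hc)).and (hcy.and (h1 i))).exists
    linarith

theorem zero_mem_filLog_zero : (0 : GammaLogAnCon M) ∈ filLog M 0 := by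
  rw [mem_filLog_iff le_rfl]
  refine ⟨0, ?_⟩
  have : GaussLE (fun _ => 0) (fun r => r) (0 : GammaLogAnCon M) := by
    intro i
    filter_upwards [eventually_normAn_zero (M := M)] with r h
    rw [coeff_zero, h, zero_mul]
  simpa using eventually_gauss_le this

theorem eventually_gauss_pos {y : GammaLogAnCon M} (hy : y ≠ 0) :
    ∀ᶠ r in 𝓝[>] (0 : ℝ), 0 < gauss M r y := by
  have h0 : y.coeff y.natDegree ≠ 0 := leadingCoeff_ne_zero.2 hy
  obtain ⟨c, hc, h⟩ := exists_le_normAn h0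
  filter_upwards [h, self_mem_nhdsWithin] with r h1 (hr : 0 < r)
  refine lt_of_lt_of_le ?_ (normAn_coeff_le_gauss le_rfl)
  have : 0 < normAn M r (y.coeff y.natDegree) := hc.trans_le h1
  positivity

/-- By quasi-convexity in `r`, the Gauss norms are bounded as long as `r` stays away from `0`. -/
theorem exists_gauss_le (y : GammaLogAnCon M) : ∃ r₀ > 0, ∀ a, 0 < a → ∃ K, ∀ r, a ≤ r → r ≤ r₀ →
    gauss M r y ≤ K := by
  have h1 : ∀ᶠ r₀ in 𝓝[>] (0 : ℝ), ∀ i ∈ Finset.range (y.natDegree + 1),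
      (∀ a r, 0 < a → a ≤ r → r ≤ r₀ →
        normAn M r (y.coeff i) ≤ max (normAn M a (y.coeff i)) (normAn M r₀ (y.coeff i))) ∧
      ∀ r, 0 < r → r ≤ r₀ → 0 ≤ normAn M r (y.coeff i) := by
    refine (eventually_all_finset _).2 fun i _ => ?_
    obtain ⟨r₁, hr₁, h⟩ := exists_normAn_le_max (y.coeff i)
    obtain ⟨r₂, hr₂, h'⟩ := eventually_pos_iff.1 (eventually_normAn_nonneg (y.coeff i))
    refine eventually_pos_iff.2 ⟨min r₁ r₂, lt_min hr₁ hr₂, fun r₀ _ hr => ⟨?_, ?_⟩⟩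
    · exact fun a r ha har hrr => h a r r₀ ha har hrr (hr.trans (min_le_left _ _))
    · exact fun r h0 hrr => h' r h0 (hrr.trans (hr.trans (min_le_right _ _)))
  obtain ⟨r₀, h2, hr₀⟩ := (h1.and self_mem_nhdsWithin).exists
  refine ⟨r₀, hr₀, fun a ha => ?_⟩
  refine ⟨∑ i ∈ Finset.range (y.natDegree + 1),
    |max (normAn M a (y.coeff i)) (normAn M r₀ (y.coeff i))| * (a⁻¹) ^ i, fun r har hr => ?_⟩
  refine Finset.sup'_le _ _ fun i hi => ?_
  have hr0 : 0 < r := ha.trans_le har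
  refine le_trans ?_ (Finset.single_le_sum (f := fun i =>
    |max (normAn M a (y.coeff i)) (normAn M r₀ (y.coeff i))| * (a⁻¹) ^ i)
    (fun i _ => by positivity) hi)
  have h3 : |normAn M r (y.coeff i)| ≤
      |max (normAn M a (y.coeff i)) (normAn M r₀ (y.coeff i))| := by
    rw [abs_of_nonneg ((h2 i hi).2 r hr0 hr)]
    exact ((h2 i hi).1 a r ha har hr).trans (le_abs_self _)
  gcongr

end Filtration

end LogGrowth

/-! ### Growth of functions satisfying a two-sided recursive estimate -/

namespace LogGrowth

open Filter Topology

/-- Let each value of `h` from the `n`-th on be either at most one of the `n` preceding values, or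
exceeded by a later value by more than `η` per step. If `h` grows at a linear rate less than `η`,
the second case does not lead beyond the bound on the first `n` values: at a value exceeding that
bound for which `h m - η m` is maximal, neither case is possible. -/
theorem le_of_forall_step {h : ℕ → ℝ} {n : ℕ} {B η : ℝ} (hη : 0 < η) (hB : ∀ m < n, h m ≤ B)
    (hstep : ∀ m ≥ n, (∃ l ≥ 1, l ≤ n ∧ h m ≤ h (m - l)) ∨ ∃ l, h m + η * l < h (m + l))
    (hgr : (∃ δ < η, ∃ D, ∀ m : ℕ, h m ≤ D + δ * m) ∨
      ∀ m ≥ n, ∃ l ≥ 1, l ≤ n ∧ h m ≤ h (m - l)) (m : ℕ) : h m ≤ B := by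
  rcases hgr with ⟨δ, hδ, D, hD⟩ | hgr
  · by_contra! hm
    set T : Set ℕ := {k | B < h k ∧ h m - η * m ≤ h k - η * k} with hT
    have hfin : T.Finite := by
      obtain ⟨N, hN⟩ := exists_nat_gt ((D - (h m - η * m)) / (η - δ))
      refine (Set.finite_lt_nat N).subset fun k hk => ?_
      have h1 := hD k
      have h2 := hk.2
      have h3 : (k : ℝ) ≤ (D - (h m - η * m)) / (η - δ) := by
        rw [le_div_iff₀ (sub_pos.2 hδ)]
        linarith
      exact Nat.cast_lt.1 (h3.trans_lt hN)
    obtain ⟨k, hkT, hk⟩ := Set.exists_max_image T (fun k => h k - η * k) hfin ⟨m, hm, le_rfl⟩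
    have hkn : n ≤ k := by
      by_contra! hlt
      exact absurd (hB k hlt) (not_le.2 hkT.1)
    rcases hstep k hkn with ⟨l, hl1, hln, hl⟩ | ⟨l, hl⟩
    · have h1 : ((k - l : ℕ) : ℝ) = k - l := Nat.cast_sub (hln.trans hkn)
      have h2 : 0 < η * l := mul_pos hη (Nat.cast_pos.2 hl1)
      have h3 := hkT.2
      have := hk (k - l) ⟨hkT.1.trans_le hl, by rw [h1]; linarith⟩
      simp only [h1] at this
      linarith
    · have h2 : 0 ≤ η * l := mul_nonneg hη.le (Nat.cast_nonneg l)
      have h3 := hkT.2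
      have h4 : ((k + l : ℕ) : ℝ) = k + l := Nat.cast_add k l
      have := hk (k + l) ⟨hkT.1.trans_le (by linarith), by rw [h4]; linarith⟩
      simp only [h4] at this
      linarith
  · induction m using Nat.strong_induction_on with
    | _ m ih =>
      rcases lt_or_ge m n with hm | hm
      · exact hB m hm
      · obtain ⟨l, hl1, hln, hl⟩ := hgr m hm
        exact hl.trans (ih _ (by omega))

/-- The analytic core of the argument. If near `0` each value `G x` is bounded by
`q ^ (s l) G (q ^ l x)` or by `q ^ (-s' l) G (q ^ (-l) x)` for some `l`, up to a factor `e ^ (C x)`,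
then growth of exponent less than `s'` implies growth of exponent at most `s`. If only the first
case occurs, nothing has to be known about the growth. -/
theorem growth_of_recursion {G : ℝ → ℝ} {q s s' C : ℝ} {n : ℕ} (hq : 1 < q) (hss : s < s')
    (hpos : ∀ᶠ x in 𝓝[>] (0 : ℝ), 0 < G x)
    (hloc : ∃ r₀ > 0, ∀ a, 0 < a → ∃ K, ∀ r, a ≤ r → r ≤ r₀ → G r ≤ K)
    (hrec : ∀ᶠ x in 𝓝[>] (0 : ℝ),
      (∃ l : ℕ, 1 ≤ l ∧ l ≤ n ∧ G x ≤ q ^ (s * l) * Real.exp (C * x) * G (q ^ l * x)) ∨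
      ∃ l : ℕ, 1 ≤ l ∧ G x ≤ q ^ (-s' * l) * Real.exp (C * x) * G (x / q ^ l))
    (hgr : (∃ δ < s', ∃ K, ∀ᶠ x in 𝓝[>] (0 : ℝ), G x ≤ K * x ^ (-δ)) ∨
      ∀ᶠ x in 𝓝[>] (0 : ℝ),
        ∃ l : ℕ, 1 ≤ l ∧ l ≤ n ∧ G x ≤ q ^ (s * l) * Real.exp (C * x) * G (q ^ l * x)) :
    ∃ K, ∀ᶠ x in 𝓝[>] (0 : ℝ), G x ≤ K * x ^ (-s) := by
  have hq0 : 0 < q := one_pos.trans hq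
  have hL : 0 < Real.log q := Real.log_pos hq
  -- `H` is chosen such that the factors `q ^ (s l)` and `e ^ (C x)` disappear
  set E : ℝ := |C| / (Real.log q * (q - 1)) with hE
  have hE0 : 0 ≤ E := div_nonneg (abs_nonneg _) (mul_pos hL (sub_pos.2 hq)).le
  set H : ℝ → ℝ := fun x => Real.logb q (G x) + s * Real.logb q x + E * x with hH
  have hlogexp : ∀ t : ℝ, Real.logb q (Real.exp t) = t / Real.log q := fun t => by
    rw [Real.logb, Real.log_exp]
  have hlogpow : ∀ (l : ℕ) (x : ℝ), 0 < x → Real.logb q (q ^ l * x) = l + Real.logb q x := by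
    intro l x hx
    rw [Real.logb_mul (by positivity) hx.ne', Real.logb_pow, Real.logb_self_eq_one hq, mul_one]
  have hlogdiv : ∀ (l : ℕ) (x : ℝ), 0 < x → Real.logb q (x / q ^ l) = Real.logb q x - l := by
    intro l x hx
    rw [Real.logb_div hx.ne' (by positivity), Real.logb_pow, Real.logb_self_eq_one hq, mul_one]
  have hCL : ∀ x, 0 < x → C * x / Real.log q ≤ |C| / Real.log q * x := by
    intro x hx
    rw [mul_div_right_comm]
    gcongr
    exact le_abs_self C
  have hback : ∀ x, 0 < x → ∀ l : ℕ, 1 ≤ l → 0 < G x → 0 < G (q ^ l * x) →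
      G x ≤ q ^ (s * l) * Real.exp (C * x) * G (q ^ l * x) → H x ≤ H (q ^ l * x) := by
    intro x hx l hl h1 h2 h3
    have h4 := Real.logb_le_logb_of_le hq h1 h3
    rw [Real.logb_mul (by positivity) h2.ne', Real.logb_mul (by positivity) (by positivity),
      Real.logb_rpow hq0 hq.ne', hlogexp] at h4
    have h5 : q ≤ q ^ l := le_self_pow₀ hq.le (by omega)
    have h6 : |C| / Real.log q * x ≤ E * (q ^ l * x) - E * x := by
      have h7 : |C| / Real.log q = E * (q - 1) := by
        rw [hE]
        have := (sub_pos.2 hq).ne'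
        field_simp
      rw [h7]
      have h8 : 0 ≤ E * x := by positivity
      nlinarith
    simp only [hH, hlogpow l x hx]
    have := hCL x hx
    linarith
  -- any `η` between the growth rate of `H` and `s' - s` will do
  obtain ⟨η, hη0, hηs, hηδ⟩ : ∃ η > 0, η < s' - s ∧
      ((∃ δ < η + s, ∃ K, ∀ᶠ x in 𝓝[>] (0 : ℝ), G x ≤ K * x ^ (-δ)) ∨
        ∀ᶠ x in 𝓝[>] (0 : ℝ),
          ∃ l : ℕ, 1 ≤ l ∧ l ≤ n ∧ G x ≤ q ^ (s * l) * Real.exp (C * x) * G (q ^ l * x)) := by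
    rcases hgr with ⟨δ, hδ, h⟩ | h
    · refine ⟨(max (δ - s) 0 + (s' - s)) / 2, ?_, ?_, Or.inl ⟨δ, ?_, h⟩⟩
      · linarith [le_max_right (δ - s) 0]
      · have : max (δ - s) 0 < s' - s := max_lt (by linarith) (by linarith)
        linarith
      · linarith [le_max_left (δ - s) 0]
    · exact ⟨(s' - s) / 2, by linarith, by linarith, Or.inr h⟩
  have hforw : ∀ᶠ x in 𝓝[>] (0 : ℝ), ∀ l : ℕ, 1 ≤ l → 0 < G (x / q ^ l) →
      G x ≤ q ^ (-s' * l) * Real.exp (C * x) * G (x / q ^ l) → H x + η * l < H (x / q ^ l) := by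
    have hsmall : ∀ᶠ x in 𝓝[>] (0 : ℝ), (|C| / Real.log q + E) * x < s' - s - η := by
      have h1 : Tendsto (fun x : ℝ => (|C| / Real.log q + E) * x) (𝓝[>] 0) (𝓝 0) := by
        have h2 := ((continuous_const_mul (|C| / Real.log q + E)).tendsto 0)
        rw [mul_zero] at h2
        exact h2.mono_left nhdsWithin_le_nhds
      exact h1.eventually (gt_mem_nhds (by linarith))
    filter_upwards [hpos, hsmall, self_mem_nhdsWithin] with x h1 hx' (hx : 0 < x) l hl h2 h3
    have h4 := Real.logb_le_logb_of_le hq h1 h3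
    rw [Real.logb_mul (by positivity) h2.ne', Real.logb_mul (by positivity) (by positivity),
      Real.logb_rpow hq0 hq.ne', hlogexp] at h4
    have h5 : (1 : ℝ) ≤ l := by exact_mod_cast hl
    have h6 : s' - s - η ≤ (s' - s - η) * l := le_mul_of_one_le_right (by linarith) h5
    have h7 : 0 ≤ E * (x / q ^ l) := by positivity
    have h8 := hCL x hx
    simp only [hH, hlogdiv l x hx]
    linarith
  obtain ⟨r₁, hr₁, hloc⟩ := hloc
  obtain ⟨r₂, hr₂, hall⟩ := eventually_pos_iff.1 (hpos.and (hrec.and hforw))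
  obtain ⟨r₃, hr₃, hQ⟩ : ∃ r₃ > 0,
      (∃ δ < η + s, ∃ K, ∀ x, 0 < x → x ≤ r₃ → G x ≤ K * x ^ (-δ)) ∨
        ∀ x, 0 < x → x ≤ r₃ →
          ∃ l : ℕ, 1 ≤ l ∧ l ≤ n ∧ G x ≤ q ^ (s * l) * Real.exp (C * x) * G (q ^ l * x) := by
    rcases hηδ with ⟨δ, hδ, K, h⟩ | h
    · obtain ⟨r₃, hr₃, h⟩ := eventually_pos_iff.1 h
      exact ⟨r₃, hr₃, Or.inl ⟨δ, hδ, K, h⟩⟩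
    · obtain ⟨r₃, hr₃, h⟩ := eventually_pos_iff.1 h
      exact ⟨r₃, hr₃, Or.inr h⟩
  obtain ⟨r₀, hr₀, h01, h02, h03⟩ : ∃ r₀ > 0, r₀ ≤ r₁ ∧ r₀ ≤ r₂ ∧ r₀ ≤ r₃ :=
    ⟨min r₁ (min r₂ r₃), by positivity, min_le_left _ _,
      (min_le_right _ _).trans (min_le_left _ _), (min_le_right _ _).trans (min_le_right _ _)⟩
  have hGpos : ∀ x, 0 < x → x ≤ r₀ → 0 < G x := fun x hx hxr => (hall x hx (hxr.trans h02)).1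
  obtain ⟨K, hK⟩ := hloc (r₀ / q ^ (n + 1)) (by positivity)
  set a := r₀ / q ^ (n + 1) with ha
  have ha0 : 0 < a := by positivity
  set B : ℝ := Real.logb q K + |s| * max |Real.logb q a| |Real.logb q r₀| + E * r₀ with hBdef
  have hB : ∀ x, a ≤ x → x ≤ r₀ → H x ≤ B := by
    intro x hax hxr
    have hx := ha0.trans_le hax
    have h1 : Real.logb q (G x) ≤ Real.logb q K :=
      Real.logb_le_logb_of_le hq (hGpos x hx hxr) (hK x hax (hxr.trans h01))
    have h2 : s * Real.logb q x ≤ |s| * max |Real.logb q a| |Real.logb q r₀| := by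
      refine (le_abs_self _).trans ?_
      rw [abs_mul]
      refine mul_le_mul_of_nonneg_left (abs_le_max_abs_abs ?_ ?_) (abs_nonneg s)
      · exact Real.logb_le_logb_of_le hq ha0 hax
      · exact Real.logb_le_logb_of_le hq hx hxr
    have h3 : E * x ≤ E * r₀ := mul_le_mul_of_nonneg_left hxr hE0
    simp only [hH, hBdef]
    linarith
  have hdiv_le : ∀ x, 0 < x → x ≤ r₀ → ∀ m : ℕ, 0 < x / q ^ m ∧ x / q ^ m ≤ r₀ := by
    intro x hx hxr m
    exact ⟨by positivity, (div_le_self hx.le (one_le_pow₀ hq.le)).trans hxr⟩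
  have hback' : ∀ x, 0 < x → x ≤ r₀ → ∀ m ≥ n,
      (∃ l : ℕ, 1 ≤ l ∧ l ≤ n ∧
        G (x / q ^ m) ≤ q ^ (s * l) * Real.exp (C * (x / q ^ m)) * G (q ^ l * (x / q ^ m))) →
      ∃ l ≥ 1, l ≤ n ∧ H (x / q ^ m) ≤ H (x / q ^ (m - l)) := by
    rintro x hx hxr m hm ⟨l, hl, hln, h⟩
    have h1 : q ^ l * (x / q ^ m) = x / q ^ (m - l) := by
      rw [pow_sub₀ _ hq0.ne' (hln.trans hm)]
      field_simp
    refine ⟨l, hl, hln, ?_⟩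
    obtain ⟨h2, h3⟩ := hdiv_le x hx hxr m
    obtain ⟨h4, h5⟩ := hdiv_le x hx hxr (m - l)
    rw [← h1]
    exact hback _ h2 l hl (hGpos _ h2 h3) (h1 ▸ hGpos _ h4 h5) h
  have hmain : ∀ x, 0 < x → r₀ < q * x → x ≤ r₀ → ∀ m : ℕ, H (x / q ^ m) ≤ B := by
    intro x hx hqx hxr
    refine le_of_forall_step (h := fun m => H (x / q ^ m)) (n := n) hη0 (fun m hm => ?_)
      (fun m hm => ?_) ?_
    · refine hB _ ?_ (hdiv_le x hx hxr m).2
      rw [ha, pow_succ', div_le_div_iff₀ (by positivity) (by positivity)]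
      have h1 : q ^ m ≤ q ^ n := pow_le_pow_right₀ hq.le hm.le
      calc r₀ * q ^ m ≤ (q * x) * q ^ n := by gcongr
        _ = x * (q * q ^ n) := by ring
    · obtain ⟨h2, h3⟩ := hdiv_le x hx hxr m
      obtain ⟨-, h4, h5⟩ := hall _ h2 (h3.trans h02)
      rcases h4 with h4 | ⟨l, hl, h4⟩
      · exact Or.inl (hback' x hx hxr m hm h4)
      · have h6 : x / q ^ m / q ^ l = x / q ^ (m + l) := by rw [div_div, pow_add]
        obtain ⟨h7, h8⟩ := hdiv_le x hx hxr (m + l)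
        refine Or.inr ⟨l, ?_⟩
        have := h5 l hl (h6 ▸ hGpos _ h7 h8) h4
        rwa [h6] at this
    · rcases hQ with ⟨δ, hδ, K', hK'⟩ | hQ
      · refine Or.inl ⟨δ - s, by linarith,
          Real.logb q K' + (s - δ) * Real.logb q x + E * r₀, fun m => ?_⟩
        obtain ⟨h2, h3⟩ := hdiv_le x hx hxr m
        have h4 := hK' _ h2 (h3.trans h03)
        have h5 := hGpos _ h2 h3
        have h6 : 0 < (x / q ^ m) ^ (-δ) := Real.rpow_pos_of_pos h2 _
        have hK0 : 0 < K' := pos_of_mul_pos_left (h5.trans_le h4) h6.le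
        have h7 := Real.logb_le_logb_of_le hq h5 h4
        rw [Real.logb_mul hK0.ne' h6.ne', Real.logb_rpow_eq_mul_logb_of_pos h2, hlogdiv m x hx] at h7
        have h8 : E * (x / q ^ m) ≤ E * r₀ := mul_le_mul_of_nonneg_left h3 hE0
        simp only [hH, hlogdiv m x hx]
        linarith
      · refine Or.inr fun m hm => ?_
        obtain ⟨h2, h3⟩ := hdiv_le x hx hxr m
        exact hback' x hx hxr m hm (hQ _ h2 (h3.trans h03))
  refine ⟨q ^ B, eventually_pos_iff.2 ⟨r₀, hr₀, fun r hr hrr => ?_⟩⟩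
  obtain ⟨m, hm1, hm2⟩ := exists_nat_pow_near (x := r₀ / r) ((one_le_div hr).2 hrr) hq
  rw [le_div_iff₀ hr] at hm1
  rw [div_lt_iff₀ hr, pow_succ'] at hm2
  have h1 := hmain (q ^ m * r) (by positivity) (by rw [← mul_assoc]; exact hm2) hm1 m
  rw [mul_div_cancel_left₀ _ (by positivity)] at h1
  have h2 : Real.logb q (G r) ≤ B - s * Real.logb q r := by
    have : 0 ≤ E * r := by positivity
    simp only [hH] at h1
    linarith
  rw [Real.logb_le_iff_le_rpow hq (hGpos r hr hrr)] at h2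
  refine h2.trans_eq ?_
  rw [sub_eq_add_neg, Real.rpow_add hq0, neg_mul_eq_neg_mul, mul_comm (-s), Real.rpow_mul hq0.le,
    Real.rpow_logb hq0 hq.ne' hr]

end LogGrowth

/-! ### Newton polygons -/

namespace LogGrowth

/-- A convex sequence lies above the lines through two consecutive points of its graph. -/
theorem line_le_of_convex {h : ℕ → ℝ} {n : ℕ}
    (hc : ∀ i, i + 2 ≤ n → 2 * h (i + 1) ≤ h i + h (i + 2)) {i j : ℕ} (hi : i < n) (hj : j ≤ n) :
    h i + (h (i + 1) - h i) * ((j : ℝ) - i) ≤ h j := by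
  have hmono : ∀ m i, i + m < n → h (i + 1) - h i ≤ h (i + m + 1) - h (i + m) := by
    intro m
    induction m with
    | zero => intro i _; exact le_rfl
    | succ m ih =>
      intro i him
      have h1 := ih i (by omega)
      have h2 := hc (i + m) (by omega)
      rw [← add_assoc i m 1]
      linarith
  rcases le_total i j with hij | hij
  · obtain ⟨m, rfl⟩ := Nat.exists_eq_add_of_le hij
    clear hij
    induction m with
    | zero => simp
    | succ m ih =>
      have h1 := ih (by omega)
      have h2 := hmono m i (by omega)
      push_cast at h1 ⊢
      rw [← add_assoc i m 1]
      linarith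
  · obtain ⟨m, rfl⟩ := Nat.exists_eq_add_of_le hij
    clear hij
    induction m with
    | zero => simp
    | succ m ih =>
      have h1 := ih (by omega)
      have h2 := hmono 1 (j + m) (by omega)
      have h3 := mul_le_mul_of_nonneg_right h2 (by positivity : (0 : ℝ) ≤ (m : ℝ) + 1)
      push_cast at h1 ⊢
      rw [← add_assoc j m 1]
      linarith

section NewtonPolygon

variable {p : ℕ} [Fact p.Prime] {O : Type u} [CommRing O] [IsDomain O] [IsDiscreteValuationRing O]
  [CharZero O] [CharP (ResField O) p] {S : FrobDatum p O} {M : AlgLift S}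

variable {n : ℕ} {a : Fin (n + 1) → AlgFrac M} {t b c d : ℝ}

theorem line_le_of_mem_convexHull (hpts : ∀ i : Fin (n + 1), c + d * (i : ℕ) ≤ plotHeight M (a i))
    (h : (t, b) ∈ convexHull ℝ (plottedPoints M a)) : c + d * t ≤ b := by
  have hlin : IsLinearMap ℝ fun P : ℝ × ℝ => P.2 - d * P.1 :=
    ⟨fun P Q => by simp only [Prod.fst_add, Prod.snd_add]; ring,
      fun x P => by simp only [Prod.smul_fst, Prod.smul_snd, smul_eq_mul]; ring⟩
  have h1 : plottedPoints M a ⊆ {P : ℝ × ℝ | c ≤ P.2 - d * P.1} := by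
    rintro _ ⟨i, -, rfl⟩
    exact le_sub_iff_add_le.2 (hpts i)
  exact le_sub_iff_add_le.1 (convexHull_min h1 (convex_halfSpace_ge hlin c) h)

theorem newtonPolygon_le (h : (t, b) ∈ convexHull ℝ (plottedPoints M a)) :
    newtonPolygon M a t ≤ b := by
  obtain ⟨m, hm⟩ := (Set.finite_range fun i => plotHeight M (a i)).bddBelow
  refine csInf_le ⟨m, fun y hy => ?_⟩ h
  have := line_le_of_mem_convexHull (c := m) (d := 0)
    (fun i => by rw [zero_mul, add_zero]; exact hm ⟨i, rfl⟩) hy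
  rwa [zero_mul, add_zero] at this

theorem mem_convexHull_of_ne_zero {i j : Fin (n + 1)} (hi : a i ≠ 0) (hj : a j ≠ 0) (ht0 : 0 ≤ t)
    (ht1 : t ≤ 1) : ((1 - t) * (i : ℕ) + t * (j : ℕ),
      (1 - t) * plotHeight M (a i) + t * plotHeight M (a j)) ∈
      convexHull ℝ (plottedPoints M a) := by
  have hsub := subset_convexHull ℝ (plottedPoints M a)
  exact convex_convexHull ℝ (plottedPoints M a) (hsub ⟨i, hi, rfl⟩) (hsub ⟨j, hj, rfl⟩)
    (sub_nonneg.2 ht1) ht0 (sub_add_cancel 1 t)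

theorem EveryPointOnNewtonPolygon.convex (hstar : EveryPointOnNewtonPolygon M a) {h : ℕ → ℝ}
    (hh : ∀ i : Fin (n + 1), h i = plotHeight M (a i)) (i : ℕ) (hi : i + 2 ≤ n) :
    2 * h (i + 1) ≤ h i + h (i + 2) := by
  have h1 := mem_convexHull_of_ne_zero (t := 1 / 2) (hstar (⟨i, by omega⟩ : Fin (n + 1))).1
    (hstar (⟨i + 2, by omega⟩ : Fin (n + 1))).1 (by norm_num) (by norm_num)
  rw [← hh, ← hh] at h1
  have h2 := (hstar ⟨i + 1, by omega⟩).2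
  rw [← hh] at h2
  have h3 : (1 - 1 / 2 : ℝ) * (i : ℝ) + 1 / 2 * ((i + 2 : ℕ) : ℝ) = ((i + 1 : ℕ) : ℝ) := by
    push_cast; ring
  simp only [h3] at h1
  have h4 := newtonPolygon_le h1
  simp only at h2
  rw [h2] at h4
  linarith

/-- When all points lie on the Newton polygon, its edges have the slopes of the segments between
neighbouring points. -/
theorem EveryPointOnNewtonPolygon.isNewtonSlope (hstar : EveryPointOnNewtonPolygon M a) {h : ℕ → ℝ}
    (hh : ∀ i : Fin (n + 1), h i = plotHeight M (a i)) {i : ℕ} (hi : i < n) :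
    IsNewtonSlope M a (h (i + 1) - h i) := by
  have key : ∀ t : ℝ, (i : ℝ) ≤ t → t ≤ (i : ℝ) + 1 →
      newtonPolygon M a t = h i + (h (i + 1) - h i) * (t - i) := by
    intro t ht0 ht1
    have h1 := mem_convexHull_of_ne_zero (t := t - i) (hstar ⟨i, by omega⟩).1
      (hstar ⟨i + 1, by omega⟩).1 (by linarith) (by linarith)
    rw [← hh, ← hh] at h1
    have h2 : (1 - (t - i)) * (i : ℝ) + (t - i) * ((i + 1 : ℕ) : ℝ) = t := by push_cast; ring
    simp only [h2] at h1
    refine le_antisymm ((newtonPolygon_le h1).trans_eq (by ring)) (le_csInf ⟨_, h1⟩ fun b hb => ?_)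
    have h3 := line_le_of_mem_convexHull (c := h i - (h (i + 1) - h i) * i) (d := h (i + 1) - h i)
      (fun j => ?_) hb
    · linarith
    · rw [← hh]
      have := line_le_of_convex (hstar.convex hh) hi (Nat.lt_succ_iff.1 j.2)
      linarith
  refine ⟨i, i + 1, Nat.cast_nonneg i, lt_add_one _, by exact_mod_cast hi, fun t ht => ?_⟩
  rw [key t ht.1 ht.2, key i le_rfl (by linarith)]
  ring

end NewtonPolygon

/-! ### Log-growth of solutions -/

section Solutions

open Filter Topology

variable {p : ℕ} [Fact p.Prime] {O : Type u} [CommRing O] [IsDomain O] [IsDiscreteValuationRing O]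
  [CharZero O] [CharP (ResField O) p] {S : FrobDatum p O} {M : AlgLift S}

variable {n : ℕ} {a : Fin (n + 1) → AlgFrac M} {y : GammaLogAnCon M} {s s' δ : ℝ}

theorem filLog_mono (hs : 0 ≤ s) (h : s ≤ s') : filLog M s ⊆ filLog M s' := by
  intro y hy
  rw [mem_filLog_iff hs] at hy
  rw [mem_filLog_iff (hs.trans h)]
  obtain ⟨K, hK⟩ := hy
  refine ⟨K, ?_⟩
  filter_upwards [hK, eventually_pos_iff.2 ⟨1, one_pos, fun r hr hr1 => And.intro hr hr1⟩]
    with r h1 ⟨hr, hr1⟩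
  have h2 : 0 < r ^ (-s) := Real.rpow_pos_of_pos hr _
  have hK0 : 0 ≤ K := nonneg_of_mul_nonneg_left (gauss_nonneg.trans h1) h2
  exact h1.trans (mul_le_mul_of_nonneg_left
    (Real.rpow_le_rpow_of_exponent_ge hr hr1 (neg_le_neg h)) hK0)

/-- The equation `f(σ) y = 0`, solved for its `k`-th term: if the points before the `k`-th one lie
above a line of slope `-s'` through it, and those after it above a line of slope `-s`, then the
Gauss norms of `y` satisfy the two-sided recursion. -/
theorem eventually_gauss_recursion (hn : 1 ≤ n) (ha : ∀ i, a i ∈ gammaCon M) (ha0 : ∀ i, a i ≠ 0)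
    (hy : twistedEval M a y = 0) (k : Fin (n + 1))
    (hbefore : ∀ i < k, plotHeight M (a k) + s' * ((k : ℕ) - (i : ℕ) : ℝ) ≤ plotHeight M (a i))
    (hafter : ∀ i > k, plotHeight M (a k) - s * ((i : ℕ) - (k : ℕ) : ℝ) ≤ plotHeight M (a i)) :
    ∃ C : ℝ, ∀ᶠ x in 𝓝[>] (0 : ℝ),
      (∃ l : ℕ, 1 ≤ l ∧ l ≤ n ∧ gauss M x y ≤ ((p ^ S.f : ℕ) : ℝ) ^ (s * l) * Real.exp (C * x) *
        gauss M (((p ^ S.f : ℕ) : ℝ) ^ l * x) y) ∨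
      ∃ i < k, gauss M x y ≤ ((p ^ S.f : ℕ) : ℝ) ^ (-s' * ((k - i : ℕ) : ℝ)) * Real.exp (C * x) *
        gauss M (x / ((p ^ S.f : ℕ) : ℝ) ^ (k - i : ℕ)) y := by
  set q : ℝ := ((p ^ S.f : ℕ) : ℝ) with hq
  have hq1 : 1 < q := Nat.one_lt_cast.2 (Nat.one_lt_pow S.f_pos.ne' (Fact.out : p.Prime).one_lt)
  have hq0 : 0 < q := one_pos.trans hq1
  obtain ⟨C, hC⟩ := exists_gauss_le_of_twistedEval hn ha ha0 hy k
  rw [← hq] at hC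
  have habs : ∀ i, absAt M 1 (a i) = q ^ (-plotHeight M (a i)) := fun i => by
    rw [plotHeight, neg_neg, ← hq,
      Real.rpow_logb hq0 hq1.ne' (exists_normAn_ofCon_le (ha i) (ha0 i)).1]
  refine ⟨C * (q ^ (k : ℕ))⁻¹, ?_⟩
  have hqk : 0 < (q ^ (k : ℕ))⁻¹ := by positivity
  filter_upwards [(tendsto_mul_pos hqk).eventually hC] with x ⟨i, hik, h⟩
  rw [mul_inv_cancel_left₀ (pow_ne_zero _ hq0.ne'), habs, habs, ← Real.rpow_sub hq0, ← mul_assoc C]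
    at h
  rcases lt_or_gt_of_ne hik with hlt | hgt
  · refine Or.inr ⟨i, hlt, h.trans ?_⟩
    have h1 : q ^ (i : ℕ) * ((q ^ (k : ℕ))⁻¹ * x) = x / q ^ ((k : ℕ) - (i : ℕ)) := by
      rw [pow_sub₀ _ hq0.ne' (by omega : (i : ℕ) ≤ k)]
      field_simp
    rw [h1]
    refine mul_le_mul_of_nonneg_right (mul_le_mul_of_nonneg_right
      (Real.rpow_le_rpow_of_exponent_le hq1.le ?_) (Real.exp_pos _).le) gauss_nonneg
    have := hbefore i hlt
    rw [Nat.cast_sub (by omega : (i : ℕ) ≤ k)]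
    linarith
  · refine Or.inl ⟨(i : ℕ) - k, by omega, by omega, h.trans ?_⟩
    have h1 : q ^ (i : ℕ) * ((q ^ (k : ℕ))⁻¹ * x) = q ^ ((i : ℕ) - (k : ℕ)) * x := by
      rw [pow_sub₀ _ hq0.ne' (by omega : (k : ℕ) ≤ i)]
      ring
    rw [h1]
    refine mul_le_mul_of_nonneg_right (mul_le_mul_of_nonneg_right
      (Real.rpow_le_rpow_of_exponent_le hq1.le ?_) (Real.exp_pos _).le) gauss_nonneg
    have := hafter i hgt
    rw [Nat.cast_sub (by omega : (k : ℕ) ≤ i)]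
    linarith

/-- A solution has log-growth at most `s` if all slopes `-s_j` have `s_j ≤ s`. -/
theorem mem_filLog_of_line (hn : 1 ≤ n) (ha : ∀ i, a i ∈ gammaCon M) (ha0 : ∀ i, a i ≠ 0)
    (hy : twistedEval M a y = 0) (hy0 : y ≠ 0) (hs : 0 ≤ s)
    (hafter : ∀ i > (0 : Fin (n + 1)), plotHeight M (a 0) - s * ((i : ℕ) - ((0 : Fin (n + 1)) : ℕ) : ℝ) ≤
      plotHeight M (a i)) : y ∈ filLog M s := by
  have hq1 : (1 : ℝ) < ((p ^ S.f : ℕ) : ℝ) :=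
    Nat.one_lt_cast.2 (Nat.one_lt_pow S.f_pos.ne' (Fact.out : p.Prime).one_lt)
  obtain ⟨C, hC⟩ := eventually_gauss_recursion (s' := s + 1) hn ha ha0 hy 0
    (fun i hi => absurd hi (Fin.not_lt_zero i)) hafter
  have hC' := hC.mono fun x hx => hx.resolve_right fun ⟨i, hi, _⟩ => Fin.not_lt_zero i hi
  exact (mem_filLog_iff hs).2 (growth_of_recursion hq1 (lt_add_one s) (eventually_gauss_pos hy0)
    (exists_gauss_le y) (hC'.mono fun x => Or.inl) (Or.inr hC'))

/-- There is no log-growth strictly between the values belonging to the two edges of the Newton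
polygon at a vertex. -/
theorem mem_filLog_of_vertex (hn : 1 ≤ n) (ha : ∀ i, a i ∈ gammaCon M) (ha0 : ∀ i, a i ≠ 0)
    (hy : twistedEval M a y = 0) (hy0 : y ≠ 0) (hs : 0 ≤ s) (k : Fin (n + 1))
    (hbefore : ∀ i < k, plotHeight M (a k) + s' * ((k : ℕ) - (i : ℕ) : ℝ) ≤ plotHeight M (a i))
    (hafter : ∀ i > k, plotHeight M (a k) - s * ((i : ℕ) - (k : ℕ) : ℝ) ≤ plotHeight M (a i))
    (hδ0 : 0 ≤ δ) (hδ : δ < s') (hyδ : y ∈ filLog M δ) : y ∈ filLog M s := by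
  rcases le_or_gt s' s with hss | hss
  · exact filLog_mono hδ0 (hδ.le.trans hss) hyδ
  have hq1 : (1 : ℝ) < ((p ^ S.f : ℕ) : ℝ) :=
    Nat.one_lt_cast.2 (Nat.one_lt_pow S.f_pos.ne' (Fact.out : p.Prime).one_lt)
  obtain ⟨C, hC⟩ := eventually_gauss_recursion hn ha ha0 hy k hbefore hafter
  refine (mem_filLog_iff hs).2 (growth_of_recursion hq1 hss (eventually_gauss_pos hy0)
    (exists_gauss_le y) (hC.mono fun x hx => hx.imp_right fun ⟨i, hi, h⟩ => ⟨k - i, ?_, h⟩)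
    (Or.inl ⟨δ, hδ, (mem_filLog_iff hδ0).1 hyδ⟩))
  omega

/-- The theorem for any model of `Γ^alg`: the log-growth is given by the last edge of the Newton
polygon that bounds it. -/
theorem isBoundedLog_or_isExactlyOfLogGrowth (hn : 1 ≤ n) (ha : ∀ i, a i ∈ gammaCon M)
    (hstar : EveryPointOnNewtonPolygon M a) (hy : twistedEval M a y = 0) :
    IsBoundedLog M y ∨ ∃ s : ℝ, 0 < s ∧ IsNewtonSlope M a (-s) ∧ IsExactlyOfLogGrowth M y s := by
  by_cases hy0 : y = 0
  · exact Or.inl (hy0 ▸ zero_mem_filLog_zero)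
  have hne : ∀ i, a i ≠ 0 := fun i => (hstar i).1
  obtain ⟨h, hh⟩ : ∃ h : ℕ → ℝ, ∀ i : Fin (n + 1), h i = plotHeight M (a i) :=
    ⟨fun i => if hi : i < n + 1 then plotHeight M (a ⟨i, hi⟩) else 0, fun i => dif_pos i.2⟩
  have hline : ∀ {i j : ℕ}, i < n → j ≤ n → h i + (h (i + 1) - h i) * ((j : ℝ) - i) ≤ h j :=
    fun hi hj => line_le_of_convex (hstar.convex hh) hi hj
  -- `s k` is minus the slope of the edge after the `k`-th point; there is none after the last one
  set s : ℕ → ℝ := fun k => if k < n then max (h k - h (k + 1)) 0 else 0 with hs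
  have hs0 : ∀ k, 0 ≤ s k := fun k => by
    simp only [hs]
    split_ifs
    · exact le_max_right _ _
    · exact le_rfl
  have hafter : ∀ k : Fin (n + 1), ∀ i > k,
      plotHeight M (a k) - s k * ((i : ℕ) - (k : ℕ) : ℝ) ≤ plotHeight M (a i) := by
    intro k i hik
    have hkn : (k : ℕ) < n := by omega
    have h1 := hline hkn (Nat.lt_succ_iff.1 i.2)
    have h2 : h k - h (k + 1) ≤ s k := by
      simp only [hs, if_pos hkn]
      exact le_max_left _ _
    have h3 : (0 : ℝ) ≤ (i : ℕ) - (k : ℕ) := sub_nonneg.2 (Nat.cast_le.2 hik.le)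
    have h4 := mul_le_mul_of_nonneg_right h2 h3
    rw [← hh, ← hh]
    linarith
  have hbefore : ∀ k (hk : k < n), ∀ i < (⟨k + 1, by omega⟩ : Fin (n + 1)),
      plotHeight M (a ⟨k + 1, by omega⟩) + (h k - h (k + 1)) * (((k + 1 : ℕ) : ℝ) - (i : ℕ)) ≤
        plotHeight M (a i) := by
    intro k hk i hik
    have h1 := hline hk (Nat.lt_succ_iff.1 i.2)
    rw [← hh, ← hh]
    push_cast
    linarith
  have hzero : y ∈ filLog M (s 0) := mem_filLog_of_line hn ha hne hy hy0 (hs0 0) (hafter 0)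
  have hstep : ∀ k < n, ∀ δ, 0 ≤ δ → δ < h k - h (k + 1) → y ∈ filLog M δ →
      y ∈ filLog M (s (k + 1)) := fun k hk δ hδ0 hδ hyδ =>
    mem_filLog_of_vertex hn ha hne hy hy0 (hs0 _) ⟨k + 1, by omega⟩ (hbefore k hk) (hafter _)
      hδ0 hδ hyδ
  -- the last point for which the edge after it bounds the log-growth
  obtain ⟨k, ⟨hkn, hk⟩, hmax⟩ := Set.exists_max_image {k | k ≤ n ∧ y ∈ filLog M (s k)} id
    ((Set.finite_le_nat n).subset fun k hk => hk.1) ⟨0, Nat.zero_le n, hzero⟩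
  rcases (hs0 k).eq_or_lt with h0 | h0
  · rw [← h0] at hk
    exact Or.inl hk
  have hkn' : k < n := by
    by_contra hcon
    simp only [hs, if_neg hcon] at h0
    exact lt_irrefl _ h0
  have hsk : s k = h k - h (k + 1) := by
    simp only [hs, if_pos hkn'] at h0 ⊢
    exact max_eq_left ((lt_max_iff.1 h0).resolve_right (lt_irrefl 0)).le
  refine Or.inr ⟨s k, h0, ?_, h0, hk, fun δ hδ0 hδ hyδ => ?_⟩
  · rw [hsk, neg_sub]
    exact hstar.isNewtonSlope hh hkn'
  · have := hmax (k + 1) ⟨hkn', hstep k hkn' δ hδ0 (hsk ▸ hδ) hyδ⟩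
    simp only [id] at this
    omega

end Solutions

end LogGrowth

/-- Log-growth of solutions of a Frobenius equation all of whose points lie on the Newton polygon. -/
theorem mainTheorem3 {p : ℕ} [Fact p.Prime] {O : Type u} [CommRing O] [IsDomain O]
    [IsDiscreteValuationRing O] [CharZero O] [CharP (IsLocalRing.ResidueField O) p]
    [IsAdicComplete (IsLocalRing.maximalIdeal O) O] (S : LogGrowth.FrobDatum p O)
    (n : ℕ) (hn : 1 ≤ n) (a : Fin (n + 1) → LogGrowth.AlgFrac (LogGrowth.gammaAlg S))
    (ha : ∀ i, a i ∈ LogGrowth.gammaCon (LogGrowth.gammaAlg S))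
    (ha0 : a 0 ≠ 0) (han : a (Fin.last n) ≠ 0)
    (hstar : LogGrowth.EveryPointOnNewtonPolygon (LogGrowth.gammaAlg S) a)
    (y : LogGrowth.GammaLogAnCon (LogGrowth.gammaAlg S))
    (hy : LogGrowth.twistedEval (LogGrowth.gammaAlg S) a y = 0) :
    LogGrowth.IsBoundedLog (LogGrowth.gammaAlg S) y ∨
      ∃ s : ℝ, 0 < s ∧ LogGrowth.IsNewtonSlope (LogGrowth.gammaAlg S) a (-s) ∧
        LogGrowth.IsExactlyOfLogGrowth (LogGrowth.gammaAlg S) y s := by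
  exact LogGrowth.isBoundedLog_or_isExactlyOfLogGrowth hn ha hstar hy
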